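/- Let $a>0$, $b\ge 0$, $a+b=1$, and let $F(v)=a(v_1^2+v_2^2)^{1/2}+b(v_1^4+v_2^4)^{1/4}$ on $\mathbb R^2$. Let $L>0$, $\varepsilon>0$, and let $\alpha,\beta$ be even $C^\infty$ functions on $(-\varepsilon,\varepsilon)$ (for example even power series) with $\alpha(0)=\beta(0)=0$ and $\alpha+\beta<L$. Let $Q(L,\alpha,\beta)$ be the billiard table bounded by the arcs $\gamma_0(t)=(\alpha(t),t)$ and $\gamma_1(t)=(L-\beta(t),-t)$, $|t|<\varepsilon$, and by two horizontal segments joining their end points. Parametrize each arc by its local $F$-arc length $s$ with $s=0$ at $t=0$, let $R_0(s),R_1(s)$ be the Euclidean radii of curvature of the two arcs as functions of $s$, and write $R_j=R_j(0)$, $R_j''=R_j''(0)$; assume $R_0,R_1>0$. The Minkowski billiard in $Q(L,\alpha,\beta)$ is given by the reflection law that $x\in\partial Q$ is a critical point of $x\mapsto F(x-y_0)+F(y_1-x)$ when the ray $y_0x$ is reflected to $xy_1$. A phase point is described by $(s,u)$, where $s$ is the arc length parameter of the foot point and $u=\partial_s F(\gamma(s_1)-\gamma(s))$, where $\gamma(s_1)$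 is the next point of reflection. Let $P=(0,0)$ be the phase point over $\gamma_0$ on the period-2 orbit between $(0,0)$ and $(L,0)$. Then near $P$ the two-step billiard map $T^2$ (from $\gamma_0$ to $\gamma_1$ and back to $\gamma_0$) is a well-defined smooth map in the coordinates $(s,u)$, and $T^2(P)=P$. Call $\tau$ a first twist coefficient of a map $f$ at a fixed point $P$ if there are a smooth area- and orientation-preserving local change of coordinates $h$ with $h(0)=P$ and a number $\theta$ such that $$h^{-1}\circ f\circ h(z)=\begin{pmatrix}\cos\Theta&-\sin\Theta\\ \sin\Theta&\cos\Theta\end{pmatrix}z+O(|z|^4),\qquad \Theta=\theta+\tau|z|^2 .$$ Suppose that $P$ is an elliptic fixed point of $T^2$ (the eigenvalues $\lambda$ of $D_PT^2$ satisfy $|\lambda|=1$, $\lambda\ne\pm1$) and that $(L-aR_0)(L-aR_1)\neq0$. Put $$\tau_1=\frac{\Delta}{8a^2R_0R_1(L-aR_0)(L-aR_1)\bigl(L-a(R_0+R_1)\bigr)},$$ where $$\begin{aligned}\Delta={}&2aR_0^2\Bigl(-LR_1\bigl(a^2LR_1''+4a^2-18a+12\bigr)+a(2a^2-9a+6)R_1^2+a(3a-4)L^2\Bigr)\\&+R_0\Bigl(L^2R_1\bigl(a^2LR_0''+a^2LR_1''+8a^2-36a+24\bigr)-2aLR_1^2\bigl(a^2LR_0''+4a^2-18a+12\bigr)\\&\qquad+a^2R_1^3\bigl(a^2LR_0''+2a^2-9a+6\bigr)+a(4-3a)L^3\Bigr)\\&+a^2R_0^3\Bigl(R_1\bigl(a^2LR_1''+2a^2-9a+6\bigr)+a(4-3a)L\Bigr)-a(3a-4)LR_1(L-aR_1)^2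 .\end{aligned}$$ If $\lambda^4\ne1$, then $\tau_1$ is a first twist coefficient of $T^2$ at $P$. Whether or not $\lambda^4\neq 1$, every first twist coefficient of $T^2$ at $P$ equals $\tau_1$; so it is unique whenever it exists. -/

import Mathlib

open Set Filter Topology
open scoped ContDiff

noncomputable section

/-- The mixed norm `F_{a,b}(v) = a ‖v‖₂ + b ‖v‖₄` on the plane. -/
def mixedNorm (a b : ℝ) (v : ℝ × ℝ) : ℝ :=
  a * √(v.1 ^ 2 + v.2 ^ 2) + b * (v.1 ^ 4 + v.2 ^ 4) ^ (1 / 4 : ℝ)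

/-- The left arc `γ₀(t) = (α(t), t)` of the billiard table. -/
def leftArc (α : ℝ → ℝ) (t : ℝ) : ℝ × ℝ := (α t, t)

/-- The right arc `γ₁(t) = (L - β(t), -t)` of the billiard table. -/
def rightArc (L : ℝ) (β : ℝ → ℝ) (t : ℝ) : ℝ × ℝ := (L - β t, -t)

/-- The interior of the billiard table `Q(L, α, β)`: the region between the two arcs over `|y| < ε`.
It is bounded by the two arcs and by two horizontal segments joining their end points
(`α` and `β` are even in the theorem, so the right arc is the graph `x = L - β(y)`). -/
def billiardTable (L ε : ℝ) (α β : ℝ → ℝ) : Set (ℝ × ℝ) :=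
  {p | |p.2| < ε ∧ α p.2 < p.1 ∧ p.1 < L - β p.2}

/-- The signed `F`-length of the curve `g` from parameter `0` to parameter `t`. -/
def arcLength (F : ℝ × ℝ → ℝ) (g : ℝ → ℝ × ℝ) (t : ℝ) : ℝ :=
  ∫ τ in (0 : ℝ)..t, F (deriv g τ)

/-- The range of the local `F`-arc-length parameter of the arc `g`, `t ∈ (-ε, ε)`. -/
def arcRange (F : ℝ × ℝ → ℝ) (g : ℝ → ℝ × ℝ) (ε : ℝ) : Set ℝ :=
  arcLength F g '' Ioo (-ε) ε

/-- The arc `g`, `t ∈ (-ε, ε)`, reparametrized by its `F`-arc length `s`, with `s = 0` at `g 0`.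
Only its values for `s ∈ arcRange F g ε` are meaningful. -/
def arcParam (F : ℝ × ℝ → ℝ) (g : ℝ → ℝ × ℝ) (ε : ℝ) (s : ℝ) : ℝ × ℝ :=
  g (Function.invFunOn (arcLength F g) (Ioo (-ε) ε) s)

/-- The Euclidean radius of curvature of the plane curve `c` at parameter `s`, counted positive
where `c` turns clockwise. Both arcs run clockwise around the table, so it is positive
where the table is strictly convex. -/
def curvatureRadius (c : ℝ → ℝ × ℝ) (s : ℝ) : ℝ :=
  let x : ℝ → ℝ := fun σ => (c σ).1
  let y : ℝ → ℝ := fun σ => (c σ).2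
  (deriv x s ^ 2 + deriv y s ^ 2) ^ (3 / 2 : ℝ) /
    (deriv y s * deriv (deriv x) s - deriv x s * deriv (deriv y) s)

/-- The second phase space coordinate `u = ∂/∂s F(d(s₁) - c(s))` of the unit vector based at `c(s)`
that points to `d(s₁)`. -/
def momentum (F : ℝ × ℝ → ℝ) (c d : ℝ → ℝ × ℝ) (s s₁ : ℝ) : ℝ :=
  deriv (fun σ => F (d s₁ - c σ)) s

/-- The reflection law at the point `d(s₁)`: the broken line `x → d(s₁) → y` is a billiard
trajectory if `s₁` is a critical point of the sum of the two distances. -/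
def Reflects (F : ℝ × ℝ → ℝ) (d : ℝ → ℝ × ℝ) (x y : ℝ × ℝ) (s₁ : ℝ) : Prop :=
  deriv (fun σ => F (d σ - x) + F (y - d σ)) s₁ = 0

/-- The Minkowski billiard map in the table `Q`, from the boundary arc `c` (arc-length parameter in
`I`) to the boundary arc `d` (arc-length parameter in `J`), in the coordinates `(s, u)`:
the trajectory with coordinates `p = (s, u)` runs inside `Q` from `c(s)` to `d(s₁)`, where it is
reflected towards `c(s₂)`, and the reflected trajectory has coordinates `q = (s₁, u₁)`. -/
def BilliardStep (F : ℝ × ℝ → ℝ) (Q : Set (ℝ × ℝ)) (c : ℝ → ℝ × ℝ) (I : Set ℝ)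
    (d : ℝ → ℝ × ℝ) (J : Set ℝ) (p q : ℝ × ℝ) : Prop :=
  p.1 ∈ I ∧ q.1 ∈ J ∧ openSegment ℝ (c p.1) (d q.1) ⊆ Q ∧ p.2 = momentum F c d p.1 q.1 ∧
    ∃ s₂ ∈ I, openSegment ℝ (d q.1) (c s₂) ⊆ Q ∧ Reflects F d (c p.1) (c s₂) q.1 ∧
      q.2 = momentum F d c q.1 s₂

/-- The graph of the two-step billiard map `T²` of the table `Q(L, α, β)` for the norm `F`,
from the phase space over the left arc to itself through a reflection at the right arc,
in the coordinates `(s, u)`. -/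
def TwoStep (F : ℝ × ℝ → ℝ) (L ε : ℝ) (α β : ℝ → ℝ) (p q : ℝ × ℝ) : Prop :=
  let Q := billiardTable L ε α β
  let c := arcParam F (leftArc α) ε
  let I := arcRange F (leftArc α) ε
  let d := arcParam F (rightArc L β) ε
  let J := arcRange F (rightArc L β) ε
  ∃ m, BilliardStep F Q c I d J p m ∧ BilliardStep F Q d J c I m q

/-- The (complex) eigenvalues of the tangent map of `f` at `P`. -/
def multipliers (f : ℝ × ℝ → ℝ × ℝ) (P : ℝ × ℝ) : Set ℂ :=
  {μ | ((LinearMap.toMatrix (Module.Basis.finTwoProd ℝ) (Module.Basis.finTwoProd ℝ)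
    (fderiv ℝ f P : ℝ × ℝ →ₗ[ℝ] ℝ × ℝ)).map (algebraMap ℝ ℂ)).charpoly.IsRoot μ}

/-- `P` is an elliptic fixed point of `f`. -/
def IsEllipticFixedPoint (f : ℝ × ℝ → ℝ × ℝ) (P : ℝ × ℝ) : Prop :=
  f P = P ∧ ∀ μ ∈ multipliers f P, ‖μ‖ = 1 ∧ μ ≠ 1 ∧ μ ≠ -1

/-- The truncated normal form: the rotation by the angle `Θ(r²) = θ + τ r²` on the circle of
radius `r`. -/
def twistRotation (θ τ : ℝ) (z : ℝ × ℝ) : ℝ × ℝ :=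
  let Θ := θ + τ * (z.1 ^ 2 + z.2 ^ 2)
  (Real.cos Θ * z.1 - Real.sin Θ * z.2, Real.sin Θ * z.1 + Real.cos Θ * z.2)

/-- `τ` is the first twist coefficient of `f` at the fixed point `P`: in suitable smooth
coordinates around `P` that preserve area and orientation, `f` is the map `twistRotation θ τ`
up to terms of order at least four. -/
def IsFirstTwistCoefficient (f : ℝ × ℝ → ℝ × ℝ) (P : ℝ × ℝ) (τ : ℝ) : Prop :=
  ∃ (h : OpenPartialHomeomorph (ℝ × ℝ) (ℝ × ℝ)) (θ : ℝ),
    (0 : ℝ × ℝ) ∈ h.source ∧ h 0 = P ∧ ContDiffOn ℝ ∞ h h.source ∧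
    (∀ z ∈ h.source, (fderiv ℝ h z).det = 1) ∧
    (fun z => h.symm (f (h z)) - twistRotation θ τ z) =O[𝓝 0] fun z => ‖z‖ ^ 4

/-- The numerator `Δ` of the first twist coefficient, a polynomial in `a`, `L`, `R₀`, `R₁` and the
second derivatives `S₀ = R₀''`, `S₁ = R₁''`. -/
def twistNumerator (a L R₀ R₁ S₀ S₁ : ℝ) : ℝ :=
  2 * a * R₀ ^ 2 * (-L * R₁ * (a ^ 2 * L * S₁ + 4 * a ^ 2 - 18 * a + 12)
      + a * (2 * a ^ 2 - 9 * a + 6) * R₁ ^ 2 + a * (3 * a - 4) * L ^ 2)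
    + R₀ * (L ^ 2 * R₁ * (a ^ 2 * L * S₀ + a ^ 2 * L * S₁ + 8 * a ^ 2 - 36 * a + 24)
      - 2 * a * L * R₁ ^ 2 * (a ^ 2 * L * S₀ + 4 * a ^ 2 - 18 * a + 12)
      + a ^ 2 * R₁ ^ 3 * (a ^ 2 * L * S₀ + 2 * a ^ 2 - 9 * a + 6)
      + a * (4 - 3 * a) * L ^ 3)
    + a ^ 2 * R₀ ^ 3 * (R₁ * (a ^ 2 * L * S₁ + 2 * a ^ 2 - 9 * a + 6) + a * (4 - 3 * a) * L)
    - a * (3 * a - 4) * L * R₁ * (L - a * R₁) ^ 2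

end

/-! Let H(s, s₁) be the F-length of the chord from γ₀(s) to γ₁(s₁). Then u = ∂H/∂s, and the
reflection law reads ∂H/∂s₁(s, s₁) + ∂H/∂s₁(s₂, s₁) = 0, so H generates T². The mixed second
derivative of H at the origin is a/L ≠ 0, and the implicit function theorem yields a next point of
reflection. Conversely, strict convexity of F and visibility inside the table leave no other next
point (`sees_injective`), so the billiard relation is locally the graph of a smooth map
(`eventually_twoStep_iff`).

The arcs are even, so H has no cubic terms: its quadratic part is followed by a quartic form P
(`chordDeriv_jet`, `quarticField_chordQuartic`). Hence T² = A ∘ (id + X_K) + O(4), where the matrix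
A has equal diagonal entries and X_K is the Hamiltonian field of the quartic form K obtained by
adding up P over the two chords of the linearized orbit (`quartic_jet_of_generating`). A diagonal
area-preserving scaling turns the elliptic A into a rotation. In the complex coordinate the map is
then λz plus a cubic form plus O(4), the coefficient of z²z̄ is iτλ, and τ is given by the
rotational average of K (`twist_of_quartic_jet`).

Uniqueness: in a conjugacy h to the normal form, the linear part of h must be a rotation, the
quadratic part of h has no influence in degree three because f has no quadratic part, and the cubic
part of h cannot change the coefficient of z²z̄ (`resonant_coeff_eq_of_conj`). This needs only λ² ≠
1.

Existence: the monomials z³, zz̄², z̄³ are removed with the divisors λ³ - λ, λ̄ - λ, λ̄³ - λ, which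
do not vanish if λ⁴ ≠ 1. Compositions of shears realize the required cubic jet by an area-preserving
diffeomorphism (`isFirstTwistCoefficient_of_jet`).

It remains to express the coefficients of P by the curvature radii and their second derivatives
(`curvatureRadius_jet`) and to verify a rational identity (`twist_of_generating`,
`twist_chordQuartic`). -/

noncomputable section

/-! ### Calculus of remainders of order `‖z‖ ^ n`. -/

section VanishingOrder

variable {E F G : Type*} [NormedAddCommGroup E] [NormedAddCommGroup F] [NormedAddCommGroup G]

/-- The function `f` vanishes at the origin at least to the order `n`. -/
def VanishesToOrder (n : ℕ) (f : E → F) : Prop :=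
  f =O[𝓝 0] fun z => ‖z‖ ^ n

namespace VanishesToOrder

variable {m n : ℕ} {f g : E → F}

theorem congr' (hf : VanishesToOrder n f) (h : f =ᶠ[𝓝 0] g) : VanishesToOrder n g :=
  Asymptotics.IsBigO.congr' hf h EventuallyEq.rfl

theorem congr (hf : VanishesToOrder n f) (h : ∀ z, f z = g z) : VanishesToOrder n g :=
  hf.congr' (Eventually.of_forall h)

theorem add (hf : VanishesToOrder n f) (hg : VanishesToOrder n g) :
    VanishesToOrder n (fun z => f z + g z) :=
  Asymptotics.IsBigO.add hf hg

theorem sub (hf : VanishesToOrder n f) (hg : VanishesToOrder n g) :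
    VanishesToOrder n (fun z => f z - g z) :=
  Asymptotics.IsBigO.sub hf hg

theorem neg (hf : VanishesToOrder n f) : VanishesToOrder n (fun z => -f z) :=
  Asymptotics.IsBigO.neg_left hf

theorem mono (hf : VanishesToOrder m f) (hmn : n ≤ m) : VanishesToOrder n f := by
  refine Asymptotics.IsBigO.trans hf ?_
  refine Asymptotics.IsBigO.of_bound 1 ?_
  filter_upwards [Metric.ball_mem_nhds (0 : E) one_pos] with z hz
  rw [mem_ball_zero_iff] at hz
  simp only [norm_pow, norm_norm, one_mul]
  exact pow_le_pow_of_le_one (norm_nonneg z) hz.le hmn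

theorem mul {R : Type*} [NormedRing R] {f g : E → R} (hf : VanishesToOrder m f)
    (hg : VanishesToOrder n g) : VanishesToOrder (m + n) (fun z => f z * g z) := by
  have := Asymptotics.IsBigO.mul hf hg
  unfold VanishesToOrder
  simpa only [pow_add] using this

theorem mul' {R : Type*} [NormedRing R] {f g : E → R} {k : ℕ} (hf : VanishesToOrder m f)
    (hg : VanishesToOrder n g) (hk : k ≤ m + n) : VanishesToOrder k (fun z => f z * g z) :=
  (hf.mul hg).mono hk

theorem pow {R : Type*} [NormedRing R] [NormOneClass R] {f : E → R} (hf : VanishesToOrder m f)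
    (k : ℕ) : VanishesToOrder (m * k) (fun z => f z ^ k) := by
  have := Asymptotics.IsBigO.pow hf k
  unfold VanishesToOrder
  simpa only [pow_mul] using this

theorem const_mul {R : Type*} [NormedRing R] {f : E → R} (hf : VanishesToOrder m f) (c : R) :
    VanishesToOrder m (fun z => c * f z) :=
  Asymptotics.IsBigO.const_mul_left hf c

theorem of_continuousAt (hf : ContinuousAt f 0) : VanishesToOrder 0 f := by
  unfold VanishesToOrder
  simpa using hf.isBigO_one ℝ

theorem const (c : F) : VanishesToOrder 0 (fun _ : E => c) :=
  of_continuousAt continuousAt_const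

theorem id : VanishesToOrder 1 (fun z : E => z) := by
  unfold VanishesToOrder
  simpa using (Asymptotics.isBigO_refl (fun z : E => z) (𝓝 0)).norm_right

theorem tendsto (hf : VanishesToOrder n f) (hn : n ≠ 0) : Tendsto f (𝓝 0) (𝓝 0) := by
  refine Asymptotics.IsBigO.trans_tendsto hf ?_
  have : Continuous fun z : E => ‖z‖ ^ n := by fun_prop
  simpa [hn] using this.tendsto 0

theorem eq_zero (hf : VanishesToOrder n f) (hn : n ≠ 0) : f 0 = 0 := by
  obtain ⟨C, hC⟩ := Asymptotics.IsBigO.bound hf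
  simpa [hn] using hC.self_of_nhds

theorem comp {f : F → G} {g : E → F} (hf : VanishesToOrder n f) (hg : VanishesToOrder m g)
    (hm : m ≠ 0) : VanishesToOrder (m * n) (fun z => f (g z)) := by
  have h1 := Asymptotics.IsBigO.comp_tendsto hf (hg.tendsto hm)
  refine h1.trans ?_
  have := (Asymptotics.IsBigO.norm_left hg).pow n
  simpa only [Function.comp_def, pow_mul] using this

theorem comp' {f : F → G} {g : E → F} (hf : VanishesToOrder n f) (hg : VanishesToOrder 1 g) :
    VanishesToOrder n (fun z => f (g z)) := by
  simpa using hf.comp hg one_ne_zero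

theorem prodMk {f : E → F} {g : E → G} (hf : VanishesToOrder n f) (hg : VanishesToOrder n g) :
    VanishesToOrder n (fun z => (f z, g z)) :=
  Asymptotics.IsBigO.prod_left hf hg

theorem of_norm {f : E → F} {g : E → G} (hf : VanishesToOrder n f) (C : ℝ)
    (h : ∀ᶠ z in 𝓝 0, ‖g z‖ ≤ C * ‖f z‖) : VanishesToOrder n g :=
  (Asymptotics.IsBigO.of_bound C h).trans hf

end VanishesToOrder

variable [NormedSpace ℝ F] [NormedSpace ℝ G]

theorem ContinuousLinearMap.vanishesToOrder_comp {n : ℕ} (A : F →L[ℝ] G) {f : E → F}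
    (hf : VanishesToOrder n f) : VanishesToOrder n (fun z => A (f z)) :=
  (A.isBigO_comp f _).trans hf

variable [NormedSpace ℝ E]

theorem ContinuousLinearMap.vanishesToOrder_one (A : E →L[ℝ] F) : VanishesToOrder 1 (fun z => A z) :=
  A.vanishesToOrder_comp .id

theorem ContDiffAt.vanishesToOrder_one {f : E → F} {n : WithTop ℕ∞} (hf : ContDiffAt ℝ n f 0)
    (hn : n ≠ 0) (h0 : f 0 = 0) : VanishesToOrder 1 f := by
  have h := (hf.differentiableAt hn).isBigO_sub
  simp only [h0, sub_zero] at h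
  simpa [VanishesToOrder] using h.norm_right

/-- The derivative of order `n + 1` is continuous at the origin, hence bounded near it, and this
bounds the integral remainder. -/
theorem ContDiffAt.vanishesToOrder_taylor [CompleteSpace F] {f : E → F} {n : ℕ}
    (hf : ContDiffAt ℝ (n + 1) f 0) :
    VanishesToOrder (n + 1) (fun z => f z -
      ∑ k ∈ Finset.range (n + 1), (k.factorial : ℝ)⁻¹ • iteratedFDeriv ℝ k f 0 (fun _ => z)) := by
  have hcont : ContinuousAt (iteratedFDeriv ℝ (n + 1) f) 0 :=
    (hf.iteratedFDeriv_right (i := n + 1) (m := 0) (by simp)).continuousAt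
  have hb : ∀ᶠ z in 𝓝 (0 : E), ‖iteratedFDeriv ℝ (n + 1) f z‖ <
      ‖iteratedFDeriv ℝ (n + 1) f 0‖ + 1 :=
    hcont.norm.eventually_lt continuousAt_const (by simp)
  have hev : ∀ᶠ z in 𝓝 (0 : E), ContDiffAt ℝ (n + 1) f z ∧
      ‖iteratedFDeriv ℝ (n + 1) f z‖ < ‖iteratedFDeriv ℝ (n + 1) f 0‖ + 1 :=
    (hf.eventually (by norm_cast; exact WithTop.coe_ne_top)).and hb
  obtain ⟨δ, hδ, hball⟩ := Metric.eventually_nhds_iff_ball.1 hev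
  set C := ‖iteratedFDeriv ℝ (n + 1) f 0‖ + 1
  refine Asymptotics.IsBigO.of_bound C ?_
  filter_upwards [Metric.ball_mem_nhds (0 : E) hδ] with z hz
  have hseg : ∀ t ∈ Icc (0 : ℝ) 1, (0 : E) + t • z ∈ Metric.ball (0 : E) δ := by
    intro t ht
    rw [zero_add, mem_ball_zero_iff, norm_smul, Real.norm_eq_abs, abs_of_nonneg ht.1]
    rw [mem_ball_zero_iff] at hz
    nlinarith [norm_nonneg z, ht.2]
  have h := map_add_eq_sum_add_integral_iteratedFDeriv (f := f) (x := 0) (y := z) (n := n)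
    (fun t ht => (hball _ (hseg t ht)).1)
  rw [zero_add] at h
  rw [h, add_sub_cancel_left, norm_smul]
  have hC : 0 ≤ C := by positivity
  have hint : ‖∫ t in (0 : ℝ)..1, (1 - t) ^ n •
      iteratedFDeriv ℝ (n + 1) f (0 + t • z) (fun _ => z)‖ ≤ C * ‖z‖ ^ (n + 1) * |1 - 0| := by
    refine intervalIntegral.norm_integral_le_of_norm_le_const ?_
    intro t ht
    rw [uIoc_of_le zero_le_one] at ht
    have ht' : t ∈ Icc (0 : ℝ) 1 := ⟨ht.1.le, ht.2⟩
    rw [norm_smul]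
    have h1 : ‖(1 - t) ^ n‖ ≤ 1 := by
      rw [norm_pow, Real.norm_eq_abs, abs_of_nonneg (by linarith [ht.2])]
      exact pow_le_one₀ (by linarith [ht.2]) (by linarith [ht.1])
    have h2 : ‖iteratedFDeriv ℝ (n + 1) f (0 + t • z) (fun _ => z)‖ ≤ C * ‖z‖ ^ (n + 1) := by
      refine (ContinuousMultilinearMap.le_opNorm _ _).trans ?_
      simp only [Finset.prod_const, Finset.card_univ, Fintype.card_fin]
      gcongr
      exact (hball _ (hseg t ht')).2.le
    calc _ ≤ 1 * (C * ‖z‖ ^ (n + 1)) := by gcongr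
      _ = _ := one_mul _
  have hfac : ‖((n.factorial : ℝ))⁻¹‖ ≤ 1 := by
    rw [norm_inv, Real.norm_natCast]
    exact inv_le_one_of_one_le₀ (by exact_mod_cast n.factorial_pos)
  calc _ ≤ 1 * (C * ‖z‖ ^ (n + 1) * |1 - 0|) := by gcongr
    _ = _ := by simp

end VanishingOrder

/-- Taylor's formula in one variable. -/
theorem ContDiffAt.vanishesToOrder_taylor_real {f : ℝ → ℝ} {n : ℕ}
    (hf : ContDiffAt ℝ (n + 1) f 0) :
    VanishesToOrder (n + 1) (fun t => f t -
      ∑ k ∈ Finset.range (n + 1), iteratedDeriv k f 0 / k.factorial * t ^ k) := by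
  refine hf.vanishesToOrder_taylor.congr fun t => ?_
  congr 1
  refine Finset.sum_congr rfl fun k _ => ?_
  have : (fun _ : Fin k => t) = fun _ : Fin k => t • (1 : ℝ) := by simp
  rw [this, ContinuousMultilinearMap.map_smul_univ, iteratedDeriv_eq_iteratedFDeriv]
  simp only [Finset.prod_const, Finset.card_univ, Fintype.card_fin, smul_eq_mul]
  ring

/-- Mean value inequality on the ball of radius `‖t‖`. Remainder estimates may be integrated but not
differentiated, so jets are computed for the highest derivative and integrated down. -/
theorem VanishesToOrder.of_deriv {f f' : ℝ → ℝ} {n : ℕ} (h0 : f 0 = 0)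
    (hf : ∀ᶠ t in 𝓝 0, HasDerivAt f (f' t) t) (hf' : VanishesToOrder n f') :
    VanishesToOrder (n + 1) f := by
  obtain ⟨C, hC0, hC⟩ := Asymptotics.IsBigO.exists_nonneg hf'
  obtain ⟨δ, hδ, hball⟩ := Metric.eventually_nhds_iff_ball.1 (hf.and hC.bound)
  refine Asymptotics.IsBigO.of_bound C ?_
  filter_upwards [Metric.ball_mem_nhds (0 : ℝ) hδ] with t ht
  have hsub : Metric.closedBall (0 : ℝ) ‖t‖ ⊆ Metric.ball 0 δ :=
    Metric.closedBall_subset_ball (by simpa using ht)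
  have hCt : ∀ x ∈ Metric.closedBall (0 : ℝ) ‖t‖, ‖f' x‖ ≤ C * ‖t‖ ^ n := by
    intro x hx
    refine ((hball x (hsub hx)).2).trans ?_
    simp only [norm_pow, norm_norm]
    rw [mem_closedBall_zero_iff] at hx
    gcongr
  have := (convex_closedBall (0 : ℝ) ‖t‖).norm_image_sub_le_of_norm_hasDerivWithin_le
    (fun x hx => (hball x (hsub hx)).1.hasDerivWithinAt) hCt
    (show (0 : ℝ) ∈ Metric.closedBall (0 : ℝ) ‖t‖ by simp)
    (show t ∈ Metric.closedBall (0 : ℝ) ‖t‖ by simp)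
  rw [h0, sub_zero, sub_zero] at this
  simpa [pow_succ, mul_assoc] using this

/-! ### Third-order jets in the variables z and z̄. -/

open ComplexConjugate in
/-- The cubic form with complex values in `z` and its conjugate. -/
def cubicForm (c₀ c₁ c₂ c₃ z : ℂ) : ℂ :=
  c₀ * z ^ 3 + c₁ * z ^ 2 * conj z + c₂ * z * conj z ^ 2 + c₃ * conj z ^ 3

open ComplexConjugate in
/-- The quadratic form with complex values in `z` and its conjugate. -/
def quadraticForm (q₀ q₁ q₂ z : ℂ) : ℂ :=
  q₀ * z ^ 2 + q₁ * z * conj z + q₂ * conj z ^ 2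

section ComplexJets

open ComplexConjugate

/-- One argument is written as Re z + i Im z, with both parts expressed by z and z̄. Repetition
turns symmetric powers of real-linear maps into polynomials in z and z̄. -/
theorem curry_expand {k : ℕ} (M : ContinuousMultilinearMap ℝ (fun _ : Fin (k + 1) => ℂ) ℂ) (z : ℂ) :
    M (fun _ => z) = (z * (M.curryLeft 1 (fun _ => z) - Complex.I * M.curryLeft Complex.I (fun _ => z))
      + conj z * (M.curryLeft 1 (fun _ => z) + Complex.I * M.curryLeft Complex.I (fun _ => z))) / 2 := by
  have h := (M.curryLeft).map_add ((z.re : ℝ) • (1 : ℂ)) ((z.im : ℝ) • Complex.I)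
  have h2 := congrArg (fun A => A (fun _ : Fin k => z)) h
  simp only [map_smul, add_apply, smul_apply] at h2
  have e : M (fun _ => z) = M.curryLeft z (fun _ => z) := by
    rw [ContinuousMultilinearMap.curryLeft_apply]
    congr 1
    ext i
    refine Fin.cases ?_ (fun j => ?_) i <;> simp
  have e2 : (z.re : ℝ) • (1 : ℂ) + (z.im : ℝ) • Complex.I = z := by
    simp [Complex.re_add_im]
  rw [e2] at h2
  rw [e, h2, Complex.real_smul, Complex.real_smul, Complex.re_eq_add_conj, Complex.im_eq_sub_conj]
  field_simp
  linear_combination ((z - conj z) * M.curryLeft Complex.I (fun _ => z)) * Complex.I_sq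

theorem exists_linear_coeffs (M : ContinuousMultilinearMap ℝ (fun _ : Fin 1 => ℂ) ℂ) :
    ∃ m n : ℂ, ∀ z, M (fun _ => z) = m * z + n * conj z := by
  have e : ∀ w z : ℂ, M.curryLeft w (fun _ : Fin 0 => z) = M.curryLeft w (fun _ => 0) :=
    fun w z => congrArg _ (Subsingleton.elim _ _)
  refine ⟨(M.curryLeft 1 (fun _ => 0) - Complex.I * M.curryLeft Complex.I (fun _ => 0)) / 2,
    (M.curryLeft 1 (fun _ => 0) + Complex.I * M.curryLeft Complex.I (fun _ => 0)) / 2,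
    fun z => ?_⟩
  rw [curry_expand, e 1, e Complex.I]
  ring

theorem exists_quadratic_coeffs (M : ContinuousMultilinearMap ℝ (fun _ : Fin 2 => ℂ) ℂ) :
    ∃ q₀ q₁ q₂ : ℂ, ∀ z, M (fun _ => z) = quadraticForm q₀ q₁ q₂ z := by
  obtain ⟨m, n, h⟩ := exists_linear_coeffs (M.curryLeft 1)
  obtain ⟨m', n', h'⟩ := exists_linear_coeffs (M.curryLeft Complex.I)
  refine ⟨(m - Complex.I * m') / 2, (n - Complex.I * n' + m + Complex.I * m') / 2,
    (n + Complex.I * n') / 2, fun z => ?_⟩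
  rw [curry_expand, h, h', quadraticForm]
  ring

theorem exists_cubic_coeffs (M : ContinuousMultilinearMap ℝ (fun _ : Fin 3 => ℂ) ℂ) :
    ∃ c₀ c₁ c₂ c₃ : ℂ, ∀ z, M (fun _ => z) = cubicForm c₀ c₁ c₂ c₃ z := by
  obtain ⟨p, q, r, h⟩ := exists_quadratic_coeffs (M.curryLeft 1)
  obtain ⟨p', q', r', h'⟩ := exists_quadratic_coeffs (M.curryLeft Complex.I)
  refine ⟨(p - Complex.I * p') / 2, (q - Complex.I * q' + p + Complex.I * p') / 2,
    (r - Complex.I * r' + q + Complex.I * q') / 2, (r + Complex.I * r') / 2, fun z => ?_⟩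
  rw [curry_expand, h, h', quadraticForm, quadraticForm, cubicForm]
  ring

theorem ContDiffAt.exists_complex_jet {h : ℂ → ℂ} (hh : ContDiffAt ℝ 4 h 0) (h0 : h 0 = 0) :
    ∃ m n q₀ q₁ q₂ c₀ c₁ c₂ c₃ : ℂ, (∀ z, fderiv ℝ h 0 z = m * z + n * conj z) ∧
      VanishesToOrder 4 (fun z => h z -
        (m * z + n * conj z + quadraticForm q₀ q₁ q₂ z + cubicForm c₀ c₁ c₂ c₃ z)) := by
  obtain ⟨m, n, h1⟩ := exists_linear_coeffs (iteratedFDeriv ℝ 1 h 0)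
  obtain ⟨q₀, q₁, q₂, h2⟩ := exists_quadratic_coeffs (iteratedFDeriv ℝ 2 h 0)
  obtain ⟨c₀, c₁, c₂, c₃, h3⟩ := exists_cubic_coeffs (iteratedFDeriv ℝ 3 h 0)
  refine ⟨m, n, q₀ / 2, q₁ / 2, q₂ / 2, c₀ / 6, c₁ / 6, c₂ / 6, c₃ / 6, fun z => ?_, ?_⟩
  · rw [← h1 z, iteratedFDeriv_one_apply]
  · have := ContDiffAt.vanishesToOrder_taylor (n := 3) (f := h) (by norm_num; exact hh)
    refine this.congr fun z => ?_
    simp only [Finset.sum_range_succ, Finset.range_zero, Finset.sum_empty, h1, h2, h3,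
      iteratedFDeriv_zero_apply, h0, Complex.real_smul, quadraticForm, cubicForm]
    norm_num [Nat.factorial]
    ring

variable {E : Type*} [NormedAddCommGroup E]

theorem VanishesToOrder.conj {n : ℕ} {f : E → ℂ} (hf : VanishesToOrder n f) :
    VanishesToOrder n (fun z => conj (f z)) :=
  hf.of_norm 1 (Eventually.of_forall fun z => by simp)

theorem vanishesToOrder_cubicForm {f : E → ℂ} (hf : VanishesToOrder 1 f) (c₀ c₁ c₂ c₃ : ℂ) :
    VanishesToOrder 3 (fun z => cubicForm c₀ c₁ c₂ c₃ (f z)) := by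
  unfold cubicForm
  exact ((((hf.pow 3).const_mul _).add (((hf.pow 2).const_mul _).mul hf.conj)).add
    ((hf.const_mul _).mul (hf.conj.pow 2))).add ((hf.conj.pow 3).const_mul _)

/-- The difference factors as (f - g) A + conj (f - g) B with A and B of order two. -/
theorem vanishesToOrder_cubicForm_sub {k : ℕ} {f g : E → ℂ} (hf : VanishesToOrder 1 f)
    (hg : VanishesToOrder 1 g) (hfg : VanishesToOrder k (fun z => f z - g z)) (c₀ c₁ c₂ c₃ : ℂ) :
    VanishesToOrder (k + 2)
      (fun z => cubicForm c₀ c₁ c₂ c₃ (f z) - cubicForm c₀ c₁ c₂ c₃ (g z)) := by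
  have hA : VanishesToOrder 2 (fun z => c₀ * (f z ^ 2 + f z * g z + g z ^ 2) +
      c₁ * ((f z + g z) * conj (f z)) + c₂ * conj (f z) ^ 2) :=
    (((((hf.pow 2).add (hf.mul hg)).add (hg.pow 2)).const_mul _).add
      (((hf.add hg).mul hf.conj).const_mul _)).add ((hf.conj.pow 2).const_mul _)
  have hB : VanishesToOrder 2 (fun z => c₁ * g z ^ 2 +
      c₂ * (g z * (conj (f z) + conj (g z))) +
      c₃ * (conj (f z) ^ 2 + conj (f z) * conj (g z) + conj (g z) ^ 2)) :=
    (((hg.pow 2).const_mul _).add ((hg.mul (hf.conj.add hg.conj)).const_mul _)).add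
      ((((hf.conj.pow 2).add (hf.conj.mul hg.conj)).add (hg.conj.pow 2)).const_mul _)
  refine ((hfg.mul hA).add (hfg.conj.mul hB)).congr fun z => ?_
  simp only [cubicForm, map_sub]
  ring

theorem vanishesToOrder_quadraticForm_sub {k : ℕ} {f g : E → ℂ} (hf : VanishesToOrder 1 f)
    (hg : VanishesToOrder 1 g) (hfg : VanishesToOrder k (fun z => f z - g z)) (q₀ q₁ q₂ : ℂ) :
    VanishesToOrder (k + 1)
      (fun z => quadraticForm q₀ q₁ q₂ (f z) - quadraticForm q₀ q₁ q₂ (g z)) := by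
  have hA : VanishesToOrder 1 (fun z => q₀ * (f z + g z) + q₁ * conj (f z)) :=
    ((hf.add hg).const_mul _).add (hf.conj.const_mul _)
  have hB : VanishesToOrder 1 (fun z => q₁ * g z + q₂ * (conj (f z) + conj (g z))) :=
    (hg.const_mul _).add ((hf.conj.add hg.conj).const_mul _)
  refine ((hfg.mul hA).add (hfg.conj.mul hB)).congr fun z => ?_
  simp only [quadraticForm, map_sub]
  ring

theorem eq_zero_of_vanishesToOrder_mul_pow {c : ℂ} {n : ℕ}
    (h : VanishesToOrder (n + 1) (fun t : ℝ => (t : ℂ) ^ n * c)) : c = 0 := by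
  obtain ⟨C, hC⟩ := Asymptotics.IsBigO.bound h
  have h1 : ∀ᶠ t : ℝ in 𝓝[≠] 0, ‖c‖ ≤ C * ‖t‖ := by
    filter_upwards [hC.filter_mono nhdsWithin_le_nhds, self_mem_nhdsWithin] with t ht ht0
    have hpos : 0 < ‖t‖ ^ n := by
      have : t ≠ 0 := ht0
      positivity
    rw [norm_mul, norm_pow, norm_pow, norm_norm, Complex.norm_real, pow_succ] at ht
    exact le_of_mul_le_mul_left (by linarith) hpos
  have h2 : Tendsto (fun t : ℝ => C * ‖t‖) (𝓝[≠] 0) (𝓝 0) := by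
    have : Continuous fun t : ℝ => C * ‖t‖ := by fun_prop
    simpa using (this.tendsto 0).mono_left nhdsWithin_le_nhds
  have := ge_of_tendsto h2 h1
  exact norm_le_zero_iff.1 this

/-- On each real line through the origin the sum is a polynomial of degree at most three in t that
is O(t⁴). -/
theorem homogeneous_parts_eq_zero {P₁ P₂ P₃ : ℂ → ℂ} (h₁ : ∀ (t : ℝ) z, P₁ (t * z) = t * P₁ z)
    (h₂ : ∀ (t : ℝ) z, P₂ (t * z) = t ^ 2 * P₂ z) (h₃ : ∀ (t : ℝ) z, P₃ (t * z) = t ^ 3 * P₃ z)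
    (h : VanishesToOrder 4 (fun z => P₁ z + P₂ z + P₃ z)) (z : ℂ) : P₁ z = 0 ∧ P₃ z = 0 := by
  have hlin : VanishesToOrder 1 (fun t : ℝ => (t : ℂ) * z) := by
    refine VanishesToOrder.id.of_norm ‖z‖ (Eventually.of_forall fun t : ℝ => ?_)
    rw [norm_mul, Complex.norm_real, mul_comm]
  have hof : VanishesToOrder 1 (fun t : ℝ => (t : ℂ)) :=
    VanishesToOrder.id.of_norm 1 (Eventually.of_forall fun t : ℝ => by simp)
  have h4 : VanishesToOrder 4 (fun t : ℝ => (t : ℂ) * P₁ z + (t : ℂ) ^ 2 * P₂ z + (t : ℂ) ^ 3 * P₃ z) :=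
    (h.comp' hlin).congr fun t => by rw [h₁, h₂, h₃]
  have e1 : P₁ z = 0 := by
    apply eq_zero_of_vanishesToOrder_mul_pow (n := 1)
    refine (((h4.mono (by norm_num)).sub ((hof.pow 2).mul (.const (P₂ z)))).sub
      (((hof.pow 3).mul (.const (P₃ z))).mono (by norm_num))).congr fun t => ?_
    ring
  have e2 : P₂ z = 0 := by
    apply eq_zero_of_vanishesToOrder_mul_pow (n := 2)
    refine ((h4.mono (by norm_num)).sub ((hof.pow 3).mul (.const (P₃ z)))).congr fun t => ?_
    rw [e1]; ring
  refine ⟨e1, eq_zero_of_vanishesToOrder_mul_pow (n := 3) (h4.congr fun t => ?_)⟩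
  rw [e1, e2]; ring

/-- On the unit circle the four monomials have the frequencies 3, 1, -1, -3. The frequency 1 is
isolated by a discrete Fourier sum over the directions of 1, i, 1 + i, 1 - i; the opposite
directions add nothing because the form is odd. -/
theorem cubicForm_coeff_eq_zero {c₀ c₁ c₂ c₃ : ℂ} (h : ∀ z, cubicForm c₀ c₁ c₂ c₃ z = 0) :
    c₁ = 0 := by
  have h1 := h 1
  have h2 := h Complex.I
  have h3 := h (1 + Complex.I)
  have h4 := h (1 - Complex.I)
  simp only [cubicForm, map_one, map_add, map_sub, Complex.conj_I] at h1 h2 h3 h4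
  have e2 : Complex.I ^ 2 = -1 := Complex.I_sq
  have e3 : Complex.I ^ 3 = -Complex.I := by rw [pow_succ, e2]; ring
  ring_nf at h1 h2 h3 h4
  simp only [e2, e3] at h1 h2 h3 h4
  linear_combination (1 / 4 : ℂ) * h1 - (Complex.I / 4) * h2 + (1 - Complex.I) / 16 * h3 +
    (1 + Complex.I) / 16 * h4 + (c₁ - c₂) / 2 * e2

end ComplexJets

/-! ### Uniqueness of the twist coefficient. -/

section Twist

open ComplexConjugate

/-- The truncated normal form `twistRotation θ τ` in the complex coordinate. -/
def complexTwist (θ τ : ℝ) (z : ℂ) : ℂ :=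
  Complex.exp ((θ + τ * Complex.normSq z : ℝ) * Complex.I) * z

/-- With w = iτ|z|² the error of exp w = 1 + w + O(w²), multiplied by z, has order five. -/
theorem vanishesToOrder_complexTwist_sub (θ τ : ℝ) :
    VanishesToOrder 4 (fun z => complexTwist θ τ z -
      (Complex.exp (θ * Complex.I) * z +
        cubicForm 0 (Complex.I * τ * Complex.exp (θ * Complex.I)) 0 0 z)) := by
  have hexp : VanishesToOrder 2 (fun w : ℂ => Complex.exp w - 1 - w) := by
    refine Asymptotics.IsBigO.of_bound 1 ?_
    filter_upwards [Metric.closedBall_mem_nhds (0 : ℂ) one_pos] with w hw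
    rw [mem_closedBall_zero_iff] at hw
    simpa using Complex.norm_exp_sub_one_sub_id_le hw
  have hsq : VanishesToOrder 2 (fun z : ℂ => Complex.I * τ * (z * conj z)) :=
    (VanishesToOrder.id.mul VanishesToOrder.id.conj).const_mul _
  have h := (((hexp.comp hsq two_ne_zero).mul (VanishesToOrder.id (E := ℂ))).const_mul
    (Complex.exp (θ * Complex.I))).mono (show 4 ≤ 2 * 2 + 1 by norm_num)
  refine h.congr fun z => ?_
  have e : ((θ + τ * Complex.normSq z : ℝ) : ℂ) * Complex.I =
      θ * Complex.I + Complex.I * τ * (z * conj z) := by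
    push_cast
    rw [Complex.normSq_eq_conj_mul_self]
    ring
  rw [complexTwist, e, Complex.exp_add, cubicForm]
  ring

theorem vanishesToOrder_complexTwist (θ τ : ℝ) : VanishesToOrder 1 (complexTwist θ τ) := by
  have h1 : VanishesToOrder 1 (fun z : ℂ => Complex.exp (θ * Complex.I) * z) :=
    VanishesToOrder.id.const_mul _
  refine (((vanishesToOrder_complexTwist_sub θ τ).mono (by norm_num)).add (h1.add
    ((vanishesToOrder_cubicForm .id 0 (Complex.I * τ * Complex.exp (θ * Complex.I)) 0 0).mono (by norm_num)))).congr fun z => ?_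
  ring

theorem toComplex_twistRotation (θ τ : ℝ) (z : ℝ × ℝ) :
    Complex.equivRealProdCLM.symm (twistRotation θ τ z) =
      complexTwist θ τ (Complex.equivRealProdCLM.symm z) := by
  simp only [Complex.equivRealProdCLM_symm_apply, twistRotation, complexTwist]
  have e : Complex.normSq (z.1 + z.2 * Complex.I) = z.1 ^ 2 + z.2 ^ 2 := Complex.normSq_add_mul_I _ _
  rw [e]
  generalize θ + τ * (z.1 ^ 2 + z.2 ^ 2) = φ
  rw [Complex.exp_mul_I, ← Complex.ofReal_cos, ← Complex.ofReal_sin]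
  apply Complex.ext
  · simp
  · simp; ring

/-- The coefficient of the resonant cubic term determines the twist. -/
theorem resonant_coeff_eq_of_conj {f h : ℂ → ℂ} {l c₀ c₁ c₂ c₃ : ℂ} {θ τ : ℝ}
    (hl : l ^ 2 ≠ 1) (hl1 : ‖l‖ = 1)
    (hf : VanishesToOrder 4 (fun z => f z - (l * z + cubicForm c₀ c₁ c₂ c₃ z)))
    (hh : ContDiffAt ℝ 4 h 0) (h0 : h 0 = 0)
    (hdet : (fderiv ℝ h 0 1).re * (fderiv ℝ h 0 Complex.I).im -
      (fderiv ℝ h 0 Complex.I).re * (fderiv ℝ h 0 1).im = 1)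
    (hconj : VanishesToOrder 4 (fun z => f (h z) - h (complexTwist θ τ z))) :
    c₁ = Complex.I * τ * l := by
  obtain ⟨m, n, q₀, q₁, q₂, k₀, k₁, k₂, k₃, hlin, hjet⟩ := hh.exists_complex_jet h0
  set e := Complex.exp (θ * Complex.I) with he
  have he1 : e * conj e = 1 := by
    rw [Complex.mul_conj, Complex.normSq_eq_norm_sq, he, Complex.norm_exp_ofReal_mul_I]; simp
  have hll : l * conj l = 1 := by
    rw [Complex.mul_conj, Complex.normSq_eq_norm_sq, hl1]; simp
  have hN := vanishesToOrder_complexTwist_sub θ τ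
  have hN1 := vanishesToOrder_complexTwist θ τ
  have hid : VanishesToOrder 1 (fun z : ℂ => z) := .id
  have hez : VanishesToOrder 1 (fun z : ℂ => e * z) := hid.const_mul _
  have hN3 : VanishesToOrder 3 (fun z => complexTwist θ τ z - e * z) := by
    refine ((hN.mono (by norm_num)).add
      (vanishesToOrder_cubicForm hid 0 (Complex.I * τ * e) 0 0)).congr fun z => ?_
    ring
  have hh1 : VanishesToOrder 1 h := hh.vanishesToOrder_one (by norm_num) h0
  have hL1 : VanishesToOrder 1 (fun z : ℂ => m * z + n * conj z) :=
    (hid.const_mul _).add (hid.conj.const_mul _)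
  have hq2 : VanishesToOrder 2 (fun z : ℂ => quadraticForm q₀ q₁ q₂ z) := by
    unfold quadraticForm
    exact (((hid.pow 2).const_mul _).add ((hid.const_mul _).mul hid.conj)).add
      ((hid.conj.pow 2).const_mul _)
  have hh2 : VanishesToOrder 2 (fun z => h z - (m * z + n * conj z)) := by
    refine ((hjet.mono (by norm_num)).add (hq2.add
      ((vanishesToOrder_cubicForm hid k₀ k₁ k₂ k₃).mono (by norm_num)))).congr fun z => ?_
    ring
  -- The quadratic part of `h` contributes only to degree two: `f` has no quadratic part, and the
  -- twist differs from its linear part by terms of order three.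
  have key : VanishesToOrder 4 (fun z =>
      (l * (m * z + n * conj z) - (m * (e * z) + n * conj (e * z))) +
      (l * quadraticForm q₀ q₁ q₂ z - quadraticForm q₀ q₁ q₂ (e * z)) +
      (l * cubicForm k₀ k₁ k₂ k₃ z + cubicForm c₀ c₁ c₂ c₃ (m * z + n * conj z) -
        cubicForm k₀ k₁ k₂ k₃ (e * z) - m * cubicForm 0 (Complex.I * τ * e) 0 0 z -
        n * conj (cubicForm 0 (Complex.I * τ * e) 0 0 z))) := by
    have t1 := hf.comp' hh1
    have t2 := hjet.const_mul l
    have t3 := vanishesToOrder_cubicForm_sub hh1 hL1 hh2 c₀ c₁ c₂ c₃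
    have t4 := hjet.comp' hN1
    have t5 := vanishesToOrder_quadraticForm_sub hN1 hez hN3 q₀ q₁ q₂
    have t6 := (vanishesToOrder_cubicForm_sub hN1 hez hN3 k₀ k₁ k₂ k₃).mono
      (show 4 ≤ 3 + 2 by norm_num)
    refine ((((((hconj.sub t1).sub t2).sub t3).add t4).add
      ((hN.const_mul m).add (hN.conj.const_mul n))).add (t5.add t6)).congr fun z => ?_
    simp only [map_sub, map_add, map_mul]
    ring
  have hom := homogeneous_parts_eq_zero
    (P₁ := fun z => l * (m * z + n * conj z) - (m * (e * z) + n * conj (e * z)))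
    (P₂ := fun z => l * quadraticForm q₀ q₁ q₂ z - quadraticForm q₀ q₁ q₂ (e * z))
    (fun t z => by simp only [map_mul, Complex.conj_ofReal]; ring)
    (fun t z => by simp only [quadraticForm, map_mul, Complex.conj_ofReal]; ring)
    (fun t z => by simp only [cubicForm, map_mul, map_add, map_pow, Complex.conj_ofReal]; ring)
    key
  have a1 := (hom 1).1
  have a2 := (hom Complex.I).1
  simp only [map_mul, map_one, Complex.conj_I] at a1 a2
  -- The values at 1 and i separate the coefficients of z and z̄.
  have hm : m * (l - e) = 0 := by
    linear_combination (1 / 2 : ℂ) * a1 - Complex.I / 2 * a2 +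
      (m * (l - e) / 2 - n * (l - conj e) / 2) * Complex.I_sq
  have hn : n * (l - conj e) = 0 := by
    linear_combination (1 / 2 : ℂ) * a1 + Complex.I / 2 * a2 -
      (m * (l - e) / 2 - n * (l - conj e) / 2) * Complex.I_sq
  -- The real determinant of z ↦ m z + n z̄ is |m|² - |n|². It forces m ≠ 0 and hence e = l; then l²
  -- ≠ 1 gives n = 0, so `h` is a rotation to first order.
  have hmn : Complex.normSq m - Complex.normSq n = 1 := by
    rw [← hdet, hlin, hlin]
    simp only [Complex.normSq_apply, map_one, Complex.conj_I, Complex.add_re, Complex.add_im,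
      Complex.mul_re, Complex.mul_im, Complex.one_re, Complex.one_im, Complex.I_re, Complex.I_im,
      Complex.neg_re, Complex.neg_im]
    ring
  have hm0 : m ≠ 0 := by
    rintro rfl
    rw [map_zero] at hmn
    linarith [Complex.normSq_nonneg n]
  have hel : e = l := (sub_eq_zero.1 ((mul_eq_zero.1 hm).resolve_left hm0)).symm
  rw [hel] at hn key
  have hn0 : n = 0 := by
    refine (mul_eq_zero.1 hn).resolve_right fun h => hl ?_
    linear_combination l * h + hll
  have hmm : m * conj m = 1 := by
    rw [hn0, map_zero, sub_zero] at hmn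
    rw [Complex.mul_conj, hmn]; simp
  -- The coefficient `k₁` of the cubic part of `h` cancels here because l² l̄ = l; this is the
  -- resonance.
  have hc := cubicForm_coeff_eq_zero
    (c₀ := l * k₀ + c₀ * m ^ 3 - k₀ * l ^ 3) (c₁ := c₁ * m - Complex.I * τ * l * m)
    (c₂ := l * k₂ + c₂ * m * conj m ^ 2 - k₂ * l * conj l ^ 2)
    (c₃ := l * k₃ + c₃ * conj m ^ 3 - k₃ * conj l ^ 3) fun z => by
      have := (hom z).2
      rw [hn0, hel] at this
      simp only [cubicForm, map_mul, zero_mul, add_zero, zero_add] at this ⊢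
      linear_combination this - c₁ * m * z ^ 2 * conj z * hmm + k₁ * l * z ^ 2 * conj z * hll
  have : m * (c₁ - Complex.I * τ * l) = 0 := by linear_combination hc
  exact sub_eq_zero.1 ((mul_eq_zero.1 this).resolve_left hm0)

theorem det_eq_of_prod (A : ℝ × ℝ →L[ℝ] ℝ × ℝ) :
    A.det = (A (1, 0)).1 * (A (0, 1)).2 - (A (0, 1)).1 * (A (1, 0)).2 := by
  rw [ContinuousLinearMap.det, ← LinearMap.det_toMatrix (Module.Basis.finTwoProd ℝ),
    Matrix.det_fin_two]
  simp [LinearMap.toMatrix_apply]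

theorem VanishesToOrder.of_toComplex {E : Type*} [NormedAddCommGroup E] {n : ℕ} {f : E → ℝ × ℝ}
    (h : VanishesToOrder n (fun z => Complex.equivRealProdCLM.symm (f z))) : VanishesToOrder n f :=
  ((Complex.equivRealProdCLM : ℂ →L[ℝ] ℝ × ℝ).vanishesToOrder_comp h).congr fun z => by simp

theorem VanishesToOrder.toComplex {E : Type*} [NormedAddCommGroup E] {n : ℕ} {f : E → ℝ × ℝ}
    (h : VanishesToOrder n f) :
    VanishesToOrder n (fun z => Complex.equivRealProdCLM.symm (f z)) :=
  (Complex.equivRealProdCLM.symm : ℝ × ℝ →L[ℝ] ℂ).vanishesToOrder_comp h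

theorem vanishesToOrder_one_toComplex :
    VanishesToOrder 1 (fun z : ℝ × ℝ => Complex.equivRealProdCLM.symm z) :=
  VanishesToOrder.id.toComplex

theorem IsFirstTwistCoefficient.resonant_coeff_eq {f : ℝ × ℝ → ℝ × ℝ} {l c₀ c₁ c₂ c₃ : ℂ} {τ : ℝ}
    (hl : l ^ 2 ≠ 1) (hl1 : ‖l‖ = 1)
    (hf : VanishesToOrder 4 (fun z => Complex.equivRealProdCLM.symm (f z) -
      (l * Complex.equivRealProdCLM.symm z +
        cubicForm c₀ c₁ c₂ c₃ (Complex.equivRealProdCLM.symm z))))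
    (hτ : IsFirstTwistCoefficient f 0 τ) : c₁ = Complex.I * τ * l := by
  obtain ⟨h, θ, h0s, h0, hsm, hdet, hO⟩ := hτ
  have hnhds : h.source ∈ 𝓝 (0 : ℝ × ℝ) := h.open_source.mem_nhds h0s
  have hat : ContDiffAt ℝ ∞ h 0 := hsm.contDiffAt hnhds
  have hto := vanishesToOrder_one_toComplex
  have hof : VanishesToOrder 1 (fun z : ℂ => Complex.equivRealProdCLM z) :=
    (Complex.equivRealProdCLM : ℂ →L[ℝ] ℝ × ℝ).vanishesToOrder_one
  have hh1 : VanishesToOrder 1 h := hat.vanishesToOrder_one (by simp) h0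
  have hf1 : VanishesToOrder 1 f := by
    refine VanishesToOrder.of_toComplex ?_
    refine ((hf.mono (by norm_num)).add ((hto.const_mul l).add
      ((vanishesToOrder_cubicForm hto c₀ c₁ c₂ c₃).mono (by norm_num)))).congr fun z => ?_
    ring
  have hN1 : VanishesToOrder 1 (twistRotation θ τ) := by
    refine VanishesToOrder.of_toComplex ?_
    refine ((vanishesToOrder_complexTwist θ τ).comp' hto).congr fun z => ?_
    rw [toComplex_twistRotation]
  -- Applying the locally Lipschitz map `h` to both sides preserves the order of the error. Of
  -- `h.symm` only the continuity is used.
  have hconj : VanishesToOrder 4 (fun z => f (h z) - h (twistRotation θ τ z)) := by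
    obtain ⟨K, s, hs, hK⟩ := (hat.of_le (by simp : (1 : WithTop ℕ∞) ≤ ∞)).exists_lipschitzOnWith
    have htgt : ∀ᶠ z in 𝓝 (0 : ℝ × ℝ), f (h z) ∈ h.target :=
      ((hf1.comp' hh1).tendsto one_ne_zero).eventually
        (h.open_target.mem_nhds (h0 ▸ h.map_source h0s))
    have hsymm0 : Tendsto (fun z => h.symm (f (h z))) (𝓝 0) (𝓝 0) := by
      have h1 : ContinuousAt h.symm 0 := h.symm.continuousAt (h0 ▸ h.map_source h0s)
      have h2 : h.symm 0 = 0 := by conv_lhs => rw [← h0, h.left_inv h0s]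
      rw [ContinuousAt, h2] at h1
      exact h1.comp ((hf1.comp' hh1).tendsto one_ne_zero)
    refine VanishesToOrder.of_norm (f := fun z => h.symm (f (h z)) - twistRotation θ τ z) hO K ?_
    filter_upwards [htgt, hsymm0.eventually hs, (hN1.tendsto one_ne_zero).eventually hs]
      with z hz hz1 hz2
    have := hK.norm_sub_le hz1 hz2
    rwa [h.right_inv hz] at this
  have hcalc : ∀ v, fderiv ℝ (fun z : ℂ => Complex.equivRealProdCLM.symm
      (h (Complex.equivRealProdCLM z))) 0 v =
      Complex.equivRealProdCLM.symm (fderiv ℝ h 0 (Complex.equivRealProdCLM v)) := by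
    intro v
    have h1 : HasFDerivAt h (fderiv ℝ h 0) (Complex.equivRealProdCLM 0) := by
      rw [map_zero]
      exact (hat.differentiableAt (by simp)).hasFDerivAt
    have h2 := (Complex.equivRealProdCLM.symm.hasFDerivAt
      (x := h (Complex.equivRealProdCLM 0))).comp (0 : ℂ)
      (h1.comp (0 : ℂ) Complex.equivRealProdCLM.hasFDerivAt)
    have h3 := h2.fderiv
    simp only [Function.comp_def] at h3
    rw [h3]
    rfl
  refine resonant_coeff_eq_of_conj (c₀ := c₀) (c₂ := c₂) (c₃ := c₃) (θ := θ) (τ := τ)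
    (f := fun z => Complex.equivRealProdCLM.symm (f (Complex.equivRealProdCLM z)))
    (h := fun z => Complex.equivRealProdCLM.symm (h (Complex.equivRealProdCLM z)))
    hl hl1 ?_ ?_ ?_ ?_ ?_
  · refine (hf.comp' hof).congr fun z => ?_
    simp only [ContinuousLinearEquiv.symm_apply_apply]
  · refine Complex.equivRealProdCLM.symm.contDiff.contDiffAt.comp _ ?_
    refine ContDiffAt.comp _ ?_ Complex.equivRealProdCLM.contDiff.contDiffAt
    rw [map_zero]
    exact_mod_cast contDiffAt_infty.1 hat 4
  · rw [map_zero, h0, map_zero]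
  · rw [hcalc, hcalc, ← hdet 0 h0s, det_eq_of_prod]
    simp [Complex.equivRealProdCLM_apply]
  · refine (hconj.comp' hof).toComplex.congr fun z => ?_
    simp only [map_sub, ContinuousLinearEquiv.apply_symm_apply]
    congr 3
    apply Complex.equivRealProdCLM.symm.injective
    rw [toComplex_twistRotation, ContinuousLinearEquiv.symm_apply_apply,
      ContinuousLinearEquiv.symm_apply_apply]

end Twist

/-! ### Existence of the normal form: shears and the homological equation. -/

section NormalForm

open ComplexConjugate

/-- The germ `z ↦ z + cubic terms + O(|z|⁴)` is realized by a global diffeomorphism that preserves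
area and orientation. -/
def IsAreaPreservingJet (c₀ c₁ c₂ c₃ : ℂ) : Prop :=
  ∃ g : (ℝ × ℝ) ≃ₜ (ℝ × ℝ), ContDiff ℝ ∞ g ∧ ContDiff ℝ ∞ g.symm ∧
    (∀ z, (fderiv ℝ g z).det = 1) ∧ g 0 = 0 ∧
    VanishesToOrder 4 (fun z => Complex.equivRealProdCLM.symm (g z) -
      (Complex.equivRealProdCLM.symm z +
        cubicForm c₀ c₁ c₂ c₃ (Complex.equivRealProdCLM.symm z)))

/-- Composition adds the cubic parts: since k z - z has order three, replacing k z by z in a cubic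
form costs only terms of order five. -/
theorem IsAreaPreservingJet.add {c₀ c₁ c₂ c₃ d₀ d₁ d₂ d₃ : ℂ}
    (hc : IsAreaPreservingJet c₀ c₁ c₂ c₃) (hd : IsAreaPreservingJet d₀ d₁ d₂ d₃) :
    IsAreaPreservingJet (c₀ + d₀) (c₁ + d₁) (c₂ + d₂) (c₃ + d₃) := by
  obtain ⟨g, hg, hg', hdet, h0, hj⟩ := hc
  obtain ⟨k, hk, hk', hdet', h0', hj'⟩ := hd
  refine ⟨k.trans g, hg.comp hk, hk'.comp hg', fun z => ?_, by simp [h0, h0'], ?_⟩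
  · have h1 := (hg.differentiable (by simp) (k z)).hasFDerivAt
    have h2 := (hk.differentiable (by simp) z).hasFDerivAt
    have h3 := (h1.comp z h2).fderiv
    change (fderiv ℝ (g ∘ k) z).det = 1
    rw [h3, ContinuousLinearMap.det, ContinuousLinearMap.toLinearMap_comp, LinearMap.det_comp]
    have e1 := hdet (k z)
    have e2 := hdet' z
    rw [ContinuousLinearMap.det] at e1 e2
    rw [e1, e2, one_mul]
  · have hto := vanishesToOrder_one_toComplex
    have hk1 : VanishesToOrder 1 k := hk.contDiffAt.vanishesToOrder_one (by simp) h0'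
    have hk3 : VanishesToOrder 3 (fun z => Complex.equivRealProdCLM.symm (k z) -
        Complex.equivRealProdCLM.symm z) := by
      refine ((hj'.mono (by norm_num)).add (vanishesToOrder_cubicForm hto d₀ d₁ d₂ d₃)).congr
        fun z => ?_
      ring
    refine (((hj.comp' hk1).add hj').add ((vanishesToOrder_cubicForm_sub hk1.toComplex hto hk3
      c₀ c₁ c₂ c₃).mono (by norm_num))).congr fun z => ?_
    simp only [Homeomorph.trans_apply, cubicForm]
    ring

/-- The shear along the lines on which `z ↦ Re (conj e * z)` is constant. -/
theorem isAreaPreservingJet_shear (c : ℝ) (e : ℂ) :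
    IsAreaPreservingJet (Complex.I * c / 8 * (e * conj e ^ 3))
      (Complex.I * c / 8 * (3 * e ^ 2 * conj e ^ 2))
      (Complex.I * c / 8 * (3 * e ^ 3 * conj e)) (Complex.I * c / 8 * e ^ 4) := by
  -- Time-one map of the Hamiltonian -c ℓ⁴/4 with ℓ = Re (ē z). It preserves ℓ, so its inverse is
  -- obtained by changing the sign of c; in complex notation it is z + i c e ℓ³.
  let G : ℝ → ℝ × ℝ → ℝ × ℝ := fun c z =>
    (z.1 - c * e.im * (e.re * z.1 + e.im * z.2) ^ 3, z.2 + c * e.re * (e.re * z.1 + e.im * z.2) ^ 3)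
  have hG : ∀ c, ContDiff ℝ ∞ (G c) := fun c => by fun_prop
  have hinv : ∀ c z, G (-c) (G c z) = z := by
    intro c z
    have : e.re * (G c z).1 + e.im * (G c z).2 = e.re * z.1 + e.im * z.2 := by
      simp only [G]; ring
    change ((G c z).1 - -c * e.im * (e.re * (G c z).1 + e.im * (G c z).2) ^ 3,
      (G c z).2 + -c * e.re * (e.re * (G c z).1 + e.im * (G c z).2) ^ 3) = z
    rw [this]
    ext <;> simp [G]
  refine ⟨⟨⟨G c, G (-c), hinv c, fun z => by simpa using hinv (-c) z⟩, (hG c).continuous,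
    (hG (-c)).continuous⟩, hG c, hG (-c), fun z => ?_, ?_, ?_⟩
  · have h1 : HasFDerivAt (fun z : ℝ × ℝ => e.re * z.1 + e.im * z.2)
        (e.re • ContinuousLinearMap.fst ℝ ℝ ℝ + e.im • ContinuousLinearMap.snd ℝ ℝ ℝ) z :=
      (hasFDerivAt_fst.const_mul _).add (hasFDerivAt_snd.const_mul _)
    have h2 := (hasFDerivAt_fst.sub ((h1.pow 3).const_mul (c * e.im))).prodMk
      ((hasFDerivAt_snd (p := z)).add ((h1.pow 3).const_mul (c * e.re)))
    have h3 : fderiv ℝ (G c) z = _ := h2.fderiv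
    change (fderiv ℝ (G c) z).det = 1
    rw [h3, det_eq_of_prod]
    simp
    ring
  · simp [G]
  · refine VanishesToOrder.congr (f := fun _ : ℝ × ℝ => (0 : ℂ))
      (Asymptotics.isBigO_zero _ _) fun z => ?_
    have hsplit : ∀ w : ℂ, cubicForm (Complex.I * c / 8 * (e * conj e ^ 3))
        (Complex.I * c / 8 * (3 * e ^ 2 * conj e ^ 2)) (Complex.I * c / 8 * (3 * e ^ 3 * conj e))
        (Complex.I * c / 8 * e ^ 4) w =
        Complex.I * c / 8 * e * (conj e * w + e * conj w) ^ 3 := by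
      intro w
      rw [cubicForm]
      ring
    have he : e = e.re + e.im * Complex.I := (Complex.re_add_im e).symm
    have hlin : conj e * (z.1 + z.2 * Complex.I) + e * conj (z.1 + z.2 * Complex.I : ℂ) =
        2 * (e.re * z.1 + e.im * z.2 : ℝ) := by
      apply Complex.ext <;> simp <;> ring
    change (0 : ℂ) = Complex.equivRealProdCLM.symm (G c z) - _
    simp only [Complex.equivRealProdCLM_symm_apply, hsplit, hlin, G]
    generalize e.re * z.1 + e.im * z.2 = l
    push_cast
    linear_combination Complex.I * c * l ^ 3 * he + c * l ^ 3 * e.im * Complex.I_sq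

theorem IsAreaPreservingJet.exists_of_eq {c₀ c₁ c₂ c₃ d₀ d₂ d₃ : ℂ}
    (h : IsAreaPreservingJet c₀ c₁ c₂ c₃) (h₀ : c₀ = d₀) (h₂ : c₂ = d₂) (h₃ : c₃ = d₃) :
    ∃ w, IsAreaPreservingJet d₀ w d₂ d₃ := by
  subst h₀ h₂ h₃
  exact ⟨_, h⟩

/-- Area preservation in degree three ties the coefficient of zz̄² to that of z³ by the factor -3
and a conjugation. Thus A and B are four real parameters, and four shears suffice; the resonant
coefficient `w` is left uncontrolled since it plays no role. -/
theorem exists_isAreaPreservingJet (A B : ℂ) :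
    ∃ w : ℂ, IsAreaPreservingJet A w (-3 * conj A) B := by
  set α : ℂ := -8 * Complex.I * A with hα
  set β : ℂ := -8 * Complex.I * B with hβ
  have hA : A = Complex.I / 8 * (α.re + α.im * Complex.I) := by
    rw [Complex.re_add_im, hα]; linear_combination A * Complex.I_sq
  have hB : B = Complex.I / 8 * (β.re + β.im * Complex.I) := by
    rw [Complex.re_add_im, hβ]; linear_combination B * Complex.I_sq
  -- Solution of the linear system for the strengths p, p', q, r of the shears along e = 1, i, 1 +
  -- i, 2 + i. It is triangular: among the four values e⁴ = 1, 1, -4, -7 + 24i only the last is not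
  -- real.
  set r : ℝ := β.im / 24 with hr
  set q : ℝ := -(α.im + 20 * r) / 4 with hq
  set p : ℝ := ((β.re + 4 * q + 7 * r) + (α.re - 15 * r)) / 2 with hp
  set p' : ℝ := ((β.re + 4 * q + 7 * r) - (α.re - 15 * r)) / 2 with hp'
  have h := (((isAreaPreservingJet_shear p 1).add (isAreaPreservingJet_shear p' Complex.I)).add
    (isAreaPreservingJet_shear q (1 + Complex.I))).add (isAreaPreservingJet_shear r (2 + Complex.I))
  have h24 : β.im = 24 * r := by rw [hr]; ring
  have e1 : α.im = -4 * q - 20 * r := by rw [hq]; ring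
  have e2 : α.re = p - p' + 15 * r := by rw [hp, hp']; ring
  have e3 : β.re = p + p' - 4 * q - 7 * r := by rw [hp, hp']; ring
  rw [e1, e2] at hA
  rw [h24, e3] at hB
  have p2 := Complex.I_sq
  have p3 : Complex.I ^ 3 = -Complex.I := Complex.I_pow_three
  have p4 : Complex.I ^ 4 = 1 := Complex.I_pow_four
  have p5 : Complex.I ^ 5 = Complex.I := by rw [pow_succ, p4, one_mul]
  refine h.exists_of_eq ?_ ?_ ?_
  · rw [hA]
    simp only [map_one, map_add, Complex.conj_I, map_ofNat]
    push_cast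
    ring_nf
    simp only [p2, p4, p5]
    ring
  · rw [hA]
    simp only [map_one, map_add, map_mul, map_div₀, Complex.conj_I, map_ofNat, Complex.conj_ofReal]
    push_cast
    ring_nf
    simp only [p2, p4, p5]
    ring
  · rw [hB]
    push_cast
    ring_nf
    simp only [p2, p3, p4, p5]
    ring

/-- Homological equation: a cubic change of coordinates alters the coefficient of zʲz̄ᵏ by a
multiple of lʲl̄ᵏ - l. The condition `hc` expresses area preservation of `f` in degree three, so the
choice of `A` that removes z³ removes zz̄² as well. -/
theorem isFirstTwistCoefficient_of_jet {f : ℝ × ℝ → ℝ × ℝ} {l c₀ c₂ c₃ : ℂ} {τ : ℝ}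
    (hl1 : ‖l‖ = 1) (hl : l ^ 2 ≠ 1) (hl4 : l ^ 4 ≠ 1) (hc : c₂ = -3 * l ^ 2 * conj c₀)
    (hf : VanishesToOrder 4 (fun z => Complex.equivRealProdCLM.symm (f z) -
      (l * Complex.equivRealProdCLM.symm z +
        cubicForm c₀ (Complex.I * τ * l) c₂ c₃ (Complex.equivRealProdCLM.symm z)))) :
    IsFirstTwistCoefficient f 0 τ := by
  have hll : l * conj l = 1 := by
    rw [Complex.mul_conj, Complex.normSq_eq_norm_sq, hl1]; simp
  have hl0 : l ≠ 0 := by rintro rfl; simp at hl1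
  have hA0 : l ^ 3 - l ≠ 0 := by
    intro h
    exact hl (mul_left_cancel₀ hl0 (by linear_combination h))
  have hB0 : conj l ^ 3 - l ≠ 0 := by
    intro h
    refine hl4 ?_
    linear_combination (-l ^ 3) * h + (l ^ 2 * conj l ^ 2 + l * conj l + 1) * hll
  obtain ⟨w, g, hg, hg', hdet, hg0, hj⟩ :=
    exists_isAreaPreservingJet (c₀ / (l ^ 3 - l)) (c₃ / (conj l ^ 3 - l))
  set A := c₀ / (l ^ 3 - l) with hA
  set B := c₃ / (conj l ^ 3 - l) with hB
  have eA : A * (l ^ 3 - l) = c₀ := div_mul_cancel₀ _ hA0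
  have eB : B * (conj l ^ 3 - l) = c₃ := div_mul_cancel₀ _ hB0
  obtain ⟨θ, hθ⟩ : ∃ θ : ℝ, Complex.exp (θ * Complex.I) = l := by
    refine ⟨Complex.arg l, ?_⟩
    have := Complex.norm_mul_exp_arg_mul_I l
    rwa [hl1, Complex.ofReal_one, one_mul] at this
  refine ⟨g.toOpenPartialHomeomorph, θ, mem_univ _, hg0, hg.contDiffOn, fun z _ => hdet z, ?_⟩
  have hto := vanishesToOrder_one_toComplex
  have hg1 : VanishesToOrder 1 g := hg.contDiffAt.vanishesToOrder_one (by simp) hg0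
  have hf1 : VanishesToOrder 1 f := by
    refine VanishesToOrder.of_toComplex ?_
    refine ((hf.mono (by norm_num)).add ((hto.const_mul l).add
      ((vanishesToOrder_cubicForm hto c₀ (Complex.I * τ * l) c₂ c₃).mono
        (by norm_num)))).congr fun z => ?_
    ring
  have hN1 : VanishesToOrder 1 (twistRotation θ τ) := by
    refine VanishesToOrder.of_toComplex ?_
    refine ((vanishesToOrder_complexTwist θ τ).comp' hto).congr fun z => ?_
    rw [toComplex_twistRotation]
  have hN := (vanishesToOrder_complexTwist_sub θ τ).comp' hto
  rw [hθ] at hN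
  have hN3 : VanishesToOrder 3 (fun z => Complex.equivRealProdCLM.symm (twistRotation θ τ z) -
      l * Complex.equivRealProdCLM.symm z) := by
    refine ((hN.mono (by norm_num)).add (vanishesToOrder_cubicForm hto 0
      (Complex.I * τ * l) 0 0)).congr fun z => ?_
    rw [toComplex_twistRotation]
    ring
  have hg3 : VanishesToOrder 3 (fun z => Complex.equivRealProdCLM.symm (g z) -
      Complex.equivRealProdCLM.symm z) := by
    refine ((hj.mono (by norm_num)).add (vanishesToOrder_cubicForm hto A w (-3 * conj A) B)).congr
      fun z => ?_
    ring
  have hconj : VanishesToOrder 4 (fun z => f (g z) - g (twistRotation θ τ z)) := by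
    refine VanishesToOrder.of_toComplex ?_
    have t1 := hf.comp' hg1
    have t2 := hj.const_mul l
    have t3 := (vanishesToOrder_cubicForm_sub hg1.toComplex hto hg3 c₀ (Complex.I * τ * l) c₂
      c₃).mono (show 4 ≤ 3 + 2 by norm_num)
    have t4 := hj.comp' hN1
    have t5 := (vanishesToOrder_cubicForm_sub hN1.toComplex (hto.const_mul l) hN3 A w (-3 * conj A)
      B).mono (show 4 ≤ 3 + 2 by norm_num)
    refine (((((t1.add t2).add t3).sub t4).sub t5).sub hN).congr fun z => ?_
    rw [map_sub, toComplex_twistRotation]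
    generalize Complex.equivRealProdCLM.symm z = x
    generalize Complex.equivRealProdCLM.symm (f (g z)) = y
    have eA' : conj A * (conj l ^ 3 - conj l) = conj c₀ := by
      rw [← eA]; simp
    simp only [cubicForm, map_mul]
    clear_value A B
    linear_combination x ^ 3 * eA + conj x ^ 3 * eB - x * conj x ^ 2 * hc -
      3 * l ^ 2 * x * conj x ^ 2 * eA' + (w * l * x ^ 2 * conj x +
        3 * conj A * x * conj x ^ 2 * (l * conj l ^ 2 - l)) * hll
  obtain ⟨K, s, hs, hK⟩ :=
    (hg'.contDiffAt (x := 0)).of_le (by simp : (1 : WithTop ℕ∞) ≤ ∞) |>.exists_lipschitzOnWith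
  refine hconj.of_norm K ?_
  filter_upwards [((hf1.comp' hg1).tendsto one_ne_zero).eventually hs,
    ((hg1.comp' hN1).tendsto one_ne_zero).eventually hs] with z hz1 hz2
  have := hK.norm_sub_le hz1 hz2
  simpa using this

end NormalForm

/-! ### Reduction of the elliptic linear part to a rotation; the twist of a quartic Hamiltonian. -/

section LinearChange

open ComplexConjugate

theorem IsFirstTwistCoefficient.conj_linear {f : ℝ × ℝ → ℝ × ℝ} {τ : ℝ}
    (h : IsFirstTwistCoefficient f 0 τ) (Φ : (ℝ × ℝ) ≃L[ℝ] (ℝ × ℝ))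
    (hΦ : (Φ.symm : ℝ × ℝ →L[ℝ] ℝ × ℝ).det = 1) :
    IsFirstTwistCoefficient (fun z => Φ.symm (f (Φ z))) 0 τ := by
  obtain ⟨h, θ, h0s, h0, hsm, hdet, hO⟩ := h
  refine ⟨h.transHomeomorph Φ.symm.toHomeomorph, θ, h0s, ?_, ?_, fun z hz => ?_, ?_⟩
  · change Φ.symm (h 0) = 0
    rw [h0, map_zero]
  · exact Φ.symm.contDiff.comp_contDiffOn hsm
  · have h1 : HasFDerivAt h (fderiv ℝ h z) z :=
      ((hsm.contDiffAt (h.open_source.mem_nhds hz)).differentiableAt (by simp)).hasFDerivAt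
    have h2 := (Φ.symm.hasFDerivAt.comp z h1).fderiv
    change (fderiv ℝ (Φ.symm ∘ h) z).det = 1
    have e := hdet z hz
    rw [ContinuousLinearMap.det] at e hΦ
    rw [h2, ContinuousLinearMap.det, ContinuousLinearMap.toLinearMap_comp, LinearMap.det_comp, e, hΦ,
      one_mul]
  · refine hO.congr_left fun z => ?_
    change _ = h.symm (Φ (Φ.symm (f (Φ (Φ.symm (h z)))))) - _
    simp

/-- The diagonal area-preserving change of coordinates `(x, y) ↦ (μ x, y / μ)`. -/
def diagonalScaling (μ : ℝ) (hμ : μ ≠ 0) : (ℝ × ℝ) ≃L[ℝ] (ℝ × ℝ) :=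
  ContinuousLinearEquiv.equivOfInverse
    ((μ • ContinuousLinearMap.fst ℝ ℝ ℝ).prod (μ⁻¹ • ContinuousLinearMap.snd ℝ ℝ ℝ))
    ((μ⁻¹ • ContinuousLinearMap.fst ℝ ℝ ℝ).prod (μ • ContinuousLinearMap.snd ℝ ℝ ℝ))
    (fun z => by ext <;> simp [hμ]) (fun z => by ext <;> simp [hμ])

theorem diagonalScaling_apply (μ : ℝ) (hμ : μ ≠ 0) (z : ℝ × ℝ) :
    diagonalScaling μ hμ z = (μ * z.1, μ⁻¹ * z.2) := rfl

theorem diagonalScaling_symm_apply (μ : ℝ) (hμ : μ ≠ 0) (z : ℝ × ℝ) :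
    (diagonalScaling μ hμ).symm z = (μ⁻¹ * z.1, μ * z.2) := rfl

theorem det_diagonalScaling (μ : ℝ) (hμ : μ ≠ 0) :
    (diagonalScaling μ hμ : ℝ × ℝ →L[ℝ] ℝ × ℝ).det = 1 := by
  rw [det_eq_of_prod]
  simp [diagonalScaling_apply, hμ]

theorem det_diagonalScaling_symm (μ : ℝ) (hμ : μ ≠ 0) :
    ((diagonalScaling μ hμ).symm : ℝ × ℝ →L[ℝ] ℝ × ℝ).det = 1 := by
  rw [det_eq_of_prod]
  simp [diagonalScaling_symm_apply, hμ]

theorem isFirstTwistCoefficient_conj_diagonal_iff {f : ℝ × ℝ → ℝ × ℝ} {τ μ : ℝ} (hμ : μ ≠ 0) :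
    IsFirstTwistCoefficient
      (fun z => (diagonalScaling μ hμ).symm (f (diagonalScaling μ hμ z))) 0 τ ↔
      IsFirstTwistCoefficient f 0 τ := by
  refine ⟨fun h => ?_, fun h => h.conj_linear _ (det_diagonalScaling_symm μ hμ)⟩
  have := h.conj_linear (diagonalScaling μ hμ).symm (det_diagonalScaling μ hμ)
  simpa using this

/-- The Hamiltonian vector field of the quartic form with the coefficients `k i`. -/
def quarticField (k : Fin 5 → ℝ) (z : ℝ × ℝ) : ℝ × ℝ :=
  (k 1 * z.1 ^ 3 + 2 * k 2 * z.1 ^ 2 * z.2 + 3 * k 3 * z.1 * z.2 ^ 2 + 4 * k 4 * z.2 ^ 3,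
    -(4 * k 0 * z.1 ^ 3 + 3 * k 1 * z.1 ^ 2 * z.2 + 2 * k 2 * z.1 * z.2 ^ 2 + k 3 * z.2 ^ 3))

-- In complex notation the Hamiltonian field of K is -2i ∂K/∂z̄. Here `a₀` and `a₃` are the
-- coefficients of z³z̄ and z̄⁴ in the scaled quartic form; that of z²z̄² is its mean over the unit
-- circle, (3k₀μ⁴ + k₂ + 3k₄μ⁻⁴)/8.
open ComplexConjugate in
theorem complex_quarticField {μ : ℝ} (hμ : μ ≠ 0) (k : Fin 5 → ℝ) (z : ℝ × ℝ) :
    let a₀ : ℂ := ((4 * k 0 * μ ^ 4 - 4 * k 4 * (μ ^ 4)⁻¹ : ℝ) -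
      (2 * k 1 * μ ^ 2 + 2 * k 3 * (μ ^ 2)⁻¹ : ℝ) * Complex.I) / 16
    let a₃ : ℂ := ((k 0 * μ ^ 4 - k 2 + k 4 * (μ ^ 4)⁻¹ : ℝ) -
      (k 3 * (μ ^ 2)⁻¹ - k 1 * μ ^ 2 : ℝ) * Complex.I) / 16
    Complex.equivRealProdCLM.symm
      ((diagonalScaling μ hμ).symm (quarticField k (diagonalScaling μ hμ z))) =
      cubicForm (-2 * Complex.I * a₀)
        (Complex.I * (-(3 * k 0 * μ ^ 4 + k 2 + 3 * k 4 * (μ ^ 4)⁻¹) / 2 : ℝ))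
        (-6 * Complex.I * conj a₀) (-8 * Complex.I * a₃) (Complex.equivRealProdCLM.symm z) := by
  intro a₀ a₃
  have h16 : ∀ x y : ℝ, ((x : ℂ) - y * Complex.I) / 16 = ⟨x / 16, -y / 16⟩ := by
    intro x y
    rw [div_eq_iff (by norm_num)]
    apply Complex.ext <;> simp
  have hz : Complex.equivRealProdCLM.symm z = ⟨z.1, z.2⟩ := by
    rw [Complex.equivRealProdCLM_symm_apply]
    exact (Complex.mk_eq_add_mul_I _ _).symm
  simp only [a₀, a₃, h16, hz, cubicForm]
  rw [Complex.equivRealProdCLM_symm_apply]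
  simp only [diagonalScaling_symm_apply, diagonalScaling_apply, quarticField]
  apply Complex.ext
  · simp [pow_succ]
    field_simp
    ring
  · simp [pow_succ]
    field_simp
    ring

/-- The first twist coefficient of a map whose linear part has equal diagonal entries and whose cubic
part is generated by a quartic Hamiltonian. -/
theorem twist_of_quartic_jet {f : ℝ × ℝ → ℝ × ℝ} {p q r : ℝ} {k : Fin 5 → ℝ}
    (hdet : p ^ 2 - q * r = 1) (hp : p ^ 2 < 1)
    (hf : VanishesToOrder 4 (fun z => f z -
      (p * (z.1 + (quarticField k z).1) + q * (z.2 + (quarticField k z).2),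
        r * (z.1 + (quarticField k z).1) + p * (z.2 + (quarticField k z).2)))) :
    (p ≠ 0 → IsFirstTwistCoefficient f 0 (-(3 * k 0 * (-q / r) + k 2 + 3 * k 4 * (-r / q)) / 2)) ∧
    ∀ τ, IsFirstTwistCoefficient f 0 τ →
      τ = -(3 * k 0 * (-q / r) + k 2 + 3 * k 4 * (-r / q)) / 2 := by
  have hqr : q * r < 0 := by linarith
  have hq : q ≠ 0 := by rintro rfl; simp at hqr
  have hr : r ≠ 0 := by rintro rfl; simp at hqr
  have hpos : 0 < -q / r := by
    have : -q / r = -(q * r) / r ^ 2 := by field_simp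
    rw [this]
    have : 0 < r ^ 2 := by positivity
    exact div_pos (by linarith) this
  -- The scaling replaces q, r by q/μ², rμ². The choice μ⁴ = -q/r makes them opposite, and the
  -- matrix becomes the rotation by the argument of p + i r μ².
  set μ := √√(-q / r) with hμdef
  have hμ2 : μ ^ 2 = √(-q / r) := Real.sq_sqrt (Real.sqrt_nonneg _)
  have hμ4 : μ ^ 4 = -q / r := by
    rw [show μ ^ 4 = (μ ^ 2) ^ 2 by ring, hμ2, Real.sq_sqrt hpos.le]
  have hμ : μ ≠ 0 := (Real.sqrt_pos.2 (Real.sqrt_pos.2 hpos)).ne'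
  have hqμ : q = -r * μ ^ 4 := by rw [hμ4]; field_simp
  have hrq : -r / q = (μ ^ 4)⁻¹ := by rw [hμ4]; field_simp
  rw [← hμ4, hrq]
  clear_value μ
  set T := -(3 * k 0 * μ ^ 4 + k 2 + 3 * k 4 * (μ ^ 4)⁻¹) / 2 with hT
  set l : ℂ := p + (r * μ ^ 2 : ℝ) * Complex.I with hl
  have hnorm : p ^ 2 + (r * μ ^ 2) ^ 2 = 1 := by rw [← hdet, hqμ]; ring
  have hl1 : ‖l‖ = 1 := by
    have : ‖l‖ ^ 2 = 1 := by
      rw [← Complex.normSq_eq_norm_sq, hl, Complex.normSq_add_mul_I, hnorm]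
    exact (pow_eq_one_iff_of_nonneg (norm_nonneg l) two_ne_zero).1 this
  have hll : l * conj l = 1 := by
    rw [Complex.mul_conj, Complex.normSq_eq_norm_sq, hl1]; simp
  have hrμ : r * μ ^ 2 ≠ 0 := by positivity
  have hl2 : l ^ 2 ≠ 1 := by
    intro h
    have h1 : l = conj l := by linear_combination conj l * h - l * hll
    have h2 := congrArg Complex.im h1
    rw [hl] at h2
    simp only [map_add, map_mul, Complex.conj_ofReal, Complex.conj_I, Complex.add_im,
      Complex.ofReal_im, Complex.mul_im, Complex.ofReal_re, Complex.I_im, Complex.I_re,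
      Complex.neg_im, Complex.neg_re] at h2
    apply hrμ
    linarith
  have hl4 : p ≠ 0 → l ^ 4 ≠ 1 := by
    intro hp0 h
    have h1 : (l ^ 2 - 1) * (l ^ 2 + 1) = 0 := by linear_combination h
    have h2 := (mul_eq_zero.1 h1).resolve_left (sub_ne_zero.2 hl2)
    have h3 : l = -conj l := by linear_combination conj l * h2 - l * hll
    have h4 := congrArg Complex.re h3
    rw [hl] at h4
    simp only [map_add, map_mul, Complex.conj_ofReal, Complex.conj_I, Complex.add_re,
      Complex.ofReal_im, Complex.mul_re, Complex.ofReal_re, Complex.I_im, Complex.I_re,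
      Complex.neg_im, Complex.neg_re] at h4
    apply hp0
    linarith
  set a₀ : ℂ := ((4 * k 0 * μ ^ 4 - 4 * k 4 * (μ ^ 4)⁻¹ : ℝ) -
    (2 * k 1 * μ ^ 2 + 2 * k 3 * (μ ^ 2)⁻¹ : ℝ) * Complex.I) / 16 with ha₀
  set a₃ : ℂ := ((k 0 * μ ^ 4 - k 2 + k 4 * (μ ^ 4)⁻¹ : ℝ) -
    (k 3 * (μ ^ 2)⁻¹ - k 1 * μ ^ 2 : ℝ) * Complex.I) / 16 with ha₃
  have hjet : VanishesToOrder 4 (fun z => Complex.equivRealProdCLM.symm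
      ((diagonalScaling μ hμ).symm (f (diagonalScaling μ hμ z))) -
      (l * Complex.equivRealProdCLM.symm z +
        cubicForm (l * (-2 * Complex.I * a₀)) (Complex.I * T * l)
          (l * (-6 * Complex.I * conj a₀)) (l * (-8 * Complex.I * a₃))
          (Complex.equivRealProdCLM.symm z))) := by
    have h1 := hf.comp' (diagonalScaling μ hμ : ℝ × ℝ →L[ℝ] ℝ × ℝ).vanishesToOrder_one
    have h2 := ((diagonalScaling μ hμ).symm : ℝ × ℝ →L[ℝ] ℝ × ℝ).vanishesToOrder_comp h1
    refine h2.toComplex.congr fun z => ?_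
    simp only [ContinuousLinearEquiv.coe_coe, map_sub]
    congr 1
    have hfield := complex_quarticField hμ k z
    simp only [← hT] at hfield
    have hsplit : ∀ w c₀ c₁ c₂ c₃ : ℂ, cubicForm (l * c₀) (c₁ * l) (l * c₂) (l * c₃) w =
        l * cubicForm c₀ c₁ c₂ c₃ w := by
      intros; simp only [cubicForm]; ring
    rw [hsplit, ← hfield, hl]
    simp only [Complex.equivRealProdCLM_symm_apply, diagonalScaling_symm_apply,
      diagonalScaling_apply]
    generalize quarticField k (μ * z.1, μ⁻¹ * z.2) = v
    rw [hqμ]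
    apply Complex.ext
    · simp [pow_succ]
      field_simp
      ring
    · simp [pow_succ]
      field_simp
      ring
  constructor
  · intro hp0
    refine (isFirstTwistCoefficient_conj_diagonal_iff hμ).1
      (isFirstTwistCoefficient_of_jet hl1 hl2 (hl4 hp0) ?_ hjet)
    simp only [map_mul, map_neg, Complex.conj_I, map_ofNat]
    linear_combination (6 * Complex.I * l * conj a₀) * hll
  · intro τ hτ
    have h := IsFirstTwistCoefficient.resonant_coeff_eq hl2 hl1 hjet
      ((isFirstTwistCoefficient_conj_diagonal_iff hμ).2 hτ)
    have hl0 : l ≠ 0 := by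
      intro h0
      rw [h0, norm_zero] at hl1
      exact zero_ne_one hl1
    have h' := mul_left_cancel₀ Complex.I_ne_zero (mul_right_cancel₀ hl0 h)
    exact_mod_cast h'.symm

end LinearChange

/-! ### Derivative and strict convexity of the norm. -/

section MixedNorm

/-- The derivative of `mixedNorm a b` at `v` in the direction `w`. -/
def mixedNormDeriv (a b : ℝ) (v w : ℝ × ℝ) : ℝ :=
  a * ((v.1 * w.1 + v.2 * w.2) / √(v.1 ^ 2 + v.2 ^ 2)) +
    b * ((v.1 ^ 3 * w.1 + v.2 ^ 3 * w.2) * (v.1 ^ 4 + v.2 ^ 4) ^ (-(3 / 4) : ℝ))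

theorem sq_add_sq_pos_of_ne_zero {v : ℝ × ℝ} (hv : v ≠ 0) : 0 < v.1 ^ 2 + v.2 ^ 2 := by
  by_contra h
  refine hv (Prod.ext ?_ ?_)
  · exact pow_eq_zero_iff two_ne_zero |>.1 (le_antisymm (by nlinarith [sq_nonneg v.2]) (sq_nonneg v.1))
  · exact pow_eq_zero_iff two_ne_zero |>.1 (le_antisymm (by nlinarith [sq_nonneg v.1]) (sq_nonneg v.2))

theorem quartic_pos_of_ne_zero {v : ℝ × ℝ} (hv : v ≠ 0) : 0 < v.1 ^ 4 + v.2 ^ 4 := by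
  have := sq_add_sq_pos_of_ne_zero hv
  nlinarith [sq_nonneg (v.1 ^ 2 - v.2 ^ 2), mul_pos this this]

theorem mixedNorm_neg (a b : ℝ) (v : ℝ × ℝ) : mixedNorm a b (-v) = mixedNorm a b v := by
  simp [mixedNorm, Even.neg_pow (by decide : Even 4)]

theorem mixedNorm_pos {a b : ℝ} (ha : 0 < a) (hb : 0 ≤ b) {v : ℝ × ℝ} (hv : v ≠ 0) :
    0 < mixedNorm a b v := by
  have h1 := sq_add_sq_pos_of_ne_zero hv
  have h2 := quartic_pos_of_ne_zero hv
  have h3 : 0 < √(v.1 ^ 2 + v.2 ^ 2) := Real.sqrt_pos.2 h1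
  unfold mixedNorm
  positivity

theorem HasDerivAt.mixedNorm {x y : ℝ → ℝ} {x' y' t : ℝ} (a b : ℝ) (hx : HasDerivAt x x' t)
    (hy : HasDerivAt y y' t) (h0 : (x t, y t) ≠ 0) :
    HasDerivAt (fun t => mixedNorm a b (x t, y t)) (mixedNormDeriv a b (x t, y t) (x', y')) t := by
  have h1 := sq_add_sq_pos_of_ne_zero h0
  have h2 := quartic_pos_of_ne_zero h0
  simp only at h1 h2
  have d1 := (((hx.pow 2).add (hy.pow 2)).sqrt h1.ne').const_mul a
  have d2 := (((hx.pow 4).add (hy.pow 4)).rpow_const (p := 1 / 4) (Or.inl h2.ne')).const_mul b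
  refine (d1.add d2).congr_deriv ?_
  have e : (1 / 4 - 1 : ℝ) = -(3 / 4) := by norm_num
  have h3 : √(x t ^ 2 + y t ^ 2) ≠ 0 := (Real.sqrt_pos.2 h1).ne'
  simp only [mixedNormDeriv, e, Pi.add_apply, Pi.pow_apply]
  field_simp
  push_cast
  ring

theorem mixedNormDeriv_self (a b : ℝ) {v : ℝ × ℝ} (hv : v ≠ 0) :
    mixedNormDeriv a b v v = mixedNorm a b v := by
  have h1 := sq_add_sq_pos_of_ne_zero hv
  have h2 := quartic_pos_of_ne_zero hv
  have e1 : (v.1 * v.1 + v.2 * v.2) / √(v.1 ^ 2 + v.2 ^ 2) = √(v.1 ^ 2 + v.2 ^ 2) := by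
    rw [← sq, ← sq, Real.div_sqrt]
  have e2 : (v.1 ^ 3 * v.1 + v.2 ^ 3 * v.2) * (v.1 ^ 4 + v.2 ^ 4) ^ (-(3 / 4) : ℝ) =
      (v.1 ^ 4 + v.2 ^ 4) ^ (1 / 4 : ℝ) := by
    have h := Real.rpow_add h2 1 (-(3 / 4))
    rw [Real.rpow_one] at h
    rw [← pow_succ, ← pow_succ, ← h]
    norm_num
  rw [mixedNormDeriv, mixedNorm, e1, e2]

theorem mixedNormDeriv_sub (a b : ℝ) (v w w' : ℝ × ℝ) :
    mixedNormDeriv a b v (w - w') = mixedNormDeriv a b v w - mixedNormDeriv a b v w' := by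
  simp only [mixedNormDeriv, Prod.fst_sub, Prod.snd_sub]
  ring

theorem mixedNormDeriv_smul (a b k : ℝ) (v w : ℝ × ℝ) :
    mixedNormDeriv a b v (k • w) = k * mixedNormDeriv a b v w := by
  simp only [mixedNormDeriv, Prod.smul_fst, Prod.smul_snd, smul_eq_mul]
  ring

theorem mixedNormDeriv_neg_left (a b : ℝ) (v w : ℝ × ℝ) :
    mixedNormDeriv a b (-v) w = -mixedNormDeriv a b v w := by
  simp only [mixedNormDeriv, Prod.fst_neg, Prod.snd_neg, Even.neg_pow (by decide : Even 4),
    Even.neg_pow (by decide : Even 2), Odd.neg_pow (by decide : Odd 3)]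
  ring

theorem mixedNormDeriv_smul_left (a b : ℝ) {k : ℝ} (hk : 0 < k) (v w : ℝ × ℝ) :
    mixedNormDeriv a b (k • v) w = mixedNormDeriv a b v w := by
  have h1 : (k • v).1 ^ 2 + (k • v).2 ^ 2 = k ^ 2 * (v.1 ^ 2 + v.2 ^ 2) := by simp; ring
  have h2 : (k • v).1 ^ 4 + (k • v).2 ^ 4 = k ^ 4 * (v.1 ^ 4 + v.2 ^ 4) := by simp; ring
  have h3 : (k ^ 4) ^ (-(3 / 4) : ℝ) = (k ^ 3)⁻¹ := by
    rw [← Real.rpow_natCast, ← Real.rpow_mul hk.le, ← Real.rpow_natCast, ← Real.rpow_neg hk.le]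
    norm_num
  rw [mixedNormDeriv, mixedNormDeriv, h1, h2, Real.sqrt_mul (sq_nonneg k), Real.sqrt_sq hk.le,
    Real.mul_rpow (by positivity) (by positivity), h3]
  simp only [Prod.smul_fst, Prod.smul_snd, smul_eq_mul]
  congr 2
  · rw [show k * v.1 * w.1 + k * v.2 * w.2 = k * (v.1 * w.1 + v.2 * w.2) by ring,
      mul_div_mul_left _ _ hk.ne']
  · field_simp

/-- Two applications of the Cauchy-Schwarz inequality, P² ≤ S U and U² ≤ S T, give P⁴ ≤ S³ T. -/
theorem quartic_holder {v w : ℝ × ℝ} (hv : v ≠ 0) :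
    (v.1 ^ 3 * w.1 + v.2 ^ 3 * w.2) * (v.1 ^ 4 + v.2 ^ 4) ^ (-(3 / 4) : ℝ) ≤
      (w.1 ^ 4 + w.2 ^ 4) ^ (1 / 4 : ℝ) := by
  have hS := quartic_pos_of_ne_zero hv
  have hT : 0 ≤ w.1 ^ 4 + w.2 ^ 4 := by positivity
  set S := v.1 ^ 4 + v.2 ^ 4 with hSdef
  set T := w.1 ^ 4 + w.2 ^ 4 with hTdef
  set P := v.1 ^ 3 * w.1 + v.2 ^ 3 * w.2 with hP
  have hσ : (S ^ (1 / 4 : ℝ)) ^ 4 = S := by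
    rw [← Real.rpow_natCast, ← Real.rpow_mul hS.le]; norm_num
  have hρ : (T ^ (1 / 4 : ℝ)) ^ 4 = T := by
    rw [← Real.rpow_natCast, ← Real.rpow_mul hT]; norm_num
  have hσ' : S ^ (-(3 / 4) : ℝ) = ((S ^ (1 / 4 : ℝ)) ^ 3)⁻¹ := by
    rw [← Real.rpow_natCast, ← Real.rpow_mul hS.le, ← Real.rpow_neg hS.le]; norm_num
  have hσpos : 0 < S ^ (1 / 4 : ℝ) := Real.rpow_pos_of_pos hS _
  have hρnn : 0 ≤ T ^ (1 / 4 : ℝ) := Real.rpow_nonneg hT _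
  rw [hσ', ← div_eq_mul_inv, div_le_iff₀ (by positivity)]
  set U := v.1 ^ 2 * w.1 ^ 2 + v.2 ^ 2 * w.2 ^ 2 with hU
  have c1 : P ^ 2 ≤ S * U := by
    rw [hP, hSdef, hU]
    nlinarith [sq_nonneg (v.1 ^ 2 * v.2 * w.2 - v.2 ^ 2 * v.1 * w.1)]
  have c2 : U ^ 2 ≤ S * T := by
    rw [hTdef, hSdef, hU]
    nlinarith [sq_nonneg (v.1 ^ 2 * w.2 ^ 2 - v.2 ^ 2 * w.1 ^ 2)]
  have hU0 : 0 ≤ U := by positivity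
  have c3 : P ^ 4 ≤ (T ^ (1 / 4 : ℝ) * (S ^ (1 / 4 : ℝ)) ^ 3) ^ 4 := by
    calc P ^ 4 = (P ^ 2) ^ 2 := by ring
      _ ≤ (S * U) ^ 2 := pow_le_pow_left₀ (sq_nonneg P) c1 2
      _ = S ^ 2 * U ^ 2 := by ring
      _ ≤ S ^ 2 * (S * T) := by gcongr
      _ = T * S ^ 3 := by ring
      _ = (T ^ (1 / 4 : ℝ)) ^ 4 * ((S ^ (1 / 4 : ℝ)) ^ 4) ^ 3 := by rw [hσ, hρ]
      _ = _ := by ring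
  have c4 : |P| ^ 4 ≤ (T ^ (1 / 4 : ℝ) * (S ^ (1 / 4 : ℝ)) ^ 3) ^ 4 := by
    rwa [(by decide : Even 4).pow_abs]
  exact (le_abs_self P).trans ((pow_le_pow_iff_left₀ (abs_nonneg P) (by positivity)
    four_ne_zero).1 c4)

theorem inner_div_sqrt_le {v : ℝ × ℝ} (w : ℝ × ℝ) (hv : v ≠ 0) :
    (v.1 * w.1 + v.2 * w.2) / √(v.1 ^ 2 + v.2 ^ 2) ≤ √(w.1 ^ 2 + w.2 ^ 2) := by
  have h1 := sq_add_sq_pos_of_ne_zero hv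
  rw [div_le_iff₀ (Real.sqrt_pos.2 h1), ← Real.sqrt_mul (by positivity)]
  apply Real.le_sqrt_of_sq_le
  nlinarith [sq_nonneg (v.1 * w.2 - v.2 * w.1)]

/-- Strict convexity of the norm: its derivative separates the directions. -/
theorem exists_smul_of_mixedNormDeriv_eq {a b : ℝ} (ha : 0 < a) (hb : 0 ≤ b) {v w : ℝ × ℝ}
    (hv : v ≠ 0) (hw : w ≠ 0)
    (h : mixedNormDeriv a b v (v - w) = mixedNormDeriv a b w (v - w)) :
    ∃ k : ℝ, 0 < k ∧ w = k • v := by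
  rw [mixedNormDeriv_sub, mixedNormDeriv_sub, mixedNormDeriv_self a b hv,
    mixedNormDeriv_self a b hw] at h
  have q1 := quartic_holder (w := w) hv
  have q2 := quartic_holder (w := v) hw
  have i1 := inner_div_sqrt_le w hv
  have i2 := inner_div_sqrt_le v hw
  have b1 := mul_le_mul_of_nonneg_left q1 hb
  have b2 := mul_le_mul_of_nonneg_left q2 hb
  have a1 := mul_le_mul_of_nonneg_left i1 ha.le
  have a2 := mul_le_mul_of_nonneg_left i2 ha.le
  simp only [mixedNormDeriv, mixedNorm] at h
  -- The hypothesis says that the four duality inequalities add up to an equality, so each is sharp.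
  -- Since a > 0, the equality case of the Euclidean one alone makes the vectors positively
  -- parallel.
  have key : a * ((v.1 * w.1 + v.2 * w.2) / √(v.1 ^ 2 + v.2 ^ 2)) = a * √(w.1 ^ 2 + w.2 ^ 2) := by
    linarith
  have hv2 := sq_add_sq_pos_of_ne_zero hv
  have hw2 := sq_add_sq_pos_of_ne_zero hw
  have key2 := mul_left_cancel₀ ha.ne' key
  rw [div_eq_iff (Real.sqrt_pos.2 hv2).ne'] at key2
  have hpos : 0 < v.1 * w.1 + v.2 * w.2 := by
    rw [key2]
    exact mul_pos (Real.sqrt_pos.2 hw2) (Real.sqrt_pos.2 hv2)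
  have hsq : (v.1 * w.1 + v.2 * w.2) ^ 2 = (w.1 ^ 2 + w.2 ^ 2) * (v.1 ^ 2 + v.2 ^ 2) := by
    rw [key2, mul_pow, Real.sq_sqrt hw2.le, Real.sq_sqrt hv2.le]
  have hpar : v.1 * w.2 - v.2 * w.1 = 0 := by
    have : (v.1 * w.2 - v.2 * w.1) ^ 2 = 0 := by linear_combination -hsq
    exact pow_eq_zero_iff two_ne_zero |>.1 this
  refine ⟨(v.1 * w.1 + v.2 * w.2) / (v.1 ^ 2 + v.2 ^ 2), div_pos hpos hv2, Prod.ext ?_ ?_⟩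
  · simp only [Prod.smul_fst, smul_eq_mul]
    field_simp
    linear_combination (-v.2) * hpar
  · simp only [Prod.smul_snd, smul_eq_mul]
    field_simp
    linear_combination v.1 * hpar

/-- For chords tangent to the arc this gives |u| = 1, so that |u| < 1 excludes them. -/
theorem abs_mixedNormDeriv_smul_self {a b : ℝ} {w : ℝ × ℝ} {k : ℝ} (hk : k ≠ 0) (hw : w ≠ 0) :
    |mixedNormDeriv a b (k • w) w| = |mixedNorm a b w| := by
  rcases lt_or_gt_of_ne hk with h | h
  · have : k • w = -((-k) • w) := by simp
    rw [this, mixedNormDeriv_neg_left, mixedNormDeriv_smul_left a b (by linarith),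
      mixedNormDeriv_self a b hw, abs_neg]
  · rw [mixedNormDeriv_smul_left a b h, mixedNormDeriv_self a b hw]

variable {E : Type*} [NormedAddCommGroup E] [NormedSpace ℝ E] {n : WithTop ℕ∞} {z : E}

theorem ContDiffAt.mixedNorm {x y : E → ℝ} (a b : ℝ) (hx : ContDiffAt ℝ n x z)
    (hy : ContDiffAt ℝ n y z) (h0 : (x z, y z) ≠ 0) :
    ContDiffAt ℝ n (fun z => mixedNorm a b (x z, y z)) z := by
  have h1 := sq_add_sq_pos_of_ne_zero h0
  have h2 := quartic_pos_of_ne_zero h0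
  exact (contDiffAt_const.mul (((hx.pow 2).add (hy.pow 2)).sqrt h1.ne')).add
    (contDiffAt_const.mul (((hx.pow 4).add (hy.pow 4)).rpow_const_of_ne h2.ne'))

theorem ContDiffAt.mixedNormDeriv {x y x' y' : E → ℝ} (a b : ℝ) (hx : ContDiffAt ℝ n x z)
    (hy : ContDiffAt ℝ n y z) (hx' : ContDiffAt ℝ n x' z) (hy' : ContDiffAt ℝ n y' z)
    (h0 : (x z, y z) ≠ 0) :
    ContDiffAt ℝ n (fun z => mixedNormDeriv a b (x z, y z) (x' z, y' z)) z := by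
  have h1 := sq_add_sq_pos_of_ne_zero h0
  have h2 := quartic_pos_of_ne_zero h0
  exact (contDiffAt_const.mul (((hx.mul hx').add (hy.mul hy')).div
      (((hx.pow 2).add (hy.pow 2)).sqrt h1.ne') (Real.sqrt_pos.2 h1).ne')).add
    (contDiffAt_const.mul ((((hx.pow 3).mul hx').add ((hy.pow 3).mul hy')).mul
      (((hx.pow 4).add (hy.pow 4)).rpow_const_of_ne h2.ne')))

end MixedNorm

/-! ### Arc-length parametrization and curvature radius. -/

section Arc

/-- The parameter `t` of the point of the left arc with the `F`-arc-length parameter `s`. -/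
def footParam (F : ℝ × ℝ → ℝ) (α : ℝ → ℝ) (ε s : ℝ) : ℝ :=
  Function.invFunOn (arcLength F (leftArc α)) (Ioo (-ε) ε) s

theorem arcParam_leftArc (F : ℝ × ℝ → ℝ) (α : ℝ → ℝ) (ε s : ℝ) :
    arcParam F (leftArc α) ε s = (α (footParam F α ε s), footParam F α ε s) := rfl

/-- The right arc is the image of a left arc under the reflection at (L/2, 0). As F is even, every
statement on right arcs reduces to left arcs. -/
theorem rightArc_eq (L : ℝ) (β : ℝ → ℝ) : rightArc L β = fun t => (L, 0) - leftArc β t := by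
  ext t <;> simp [rightArc, leftArc]

theorem arcLength_rightArc {F : ℝ × ℝ → ℝ} (hF : ∀ v, F (-v) = F v) (L : ℝ) (β : ℝ → ℝ) :
    arcLength F (rightArc L β) = arcLength F (leftArc β) := by
  ext t
  have : deriv (rightArc L β) = fun τ => -deriv (leftArc β) τ := by
    ext1 τ
    rw [rightArc_eq, deriv_const_sub]
  simp only [arcLength, this, hF]

theorem arcParam_rightArc {F : ℝ × ℝ → ℝ} (hF : ∀ v, F (-v) = F v) (L : ℝ) (β : ℝ → ℝ) (ε s : ℝ) :
    arcParam F (rightArc L β) ε s = (L, 0) - arcParam F (leftArc β) ε s := by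
  rw [arcParam, arcLength_rightArc hF, rightArc_eq]
  rfl

theorem arcRange_rightArc {F : ℝ × ℝ → ℝ} (hF : ∀ v, F (-v) = F v) (L : ℝ) (β : ℝ → ℝ) (ε : ℝ) :
    arcRange F (rightArc L β) ε = arcRange F (leftArc β) ε := by
  rw [arcRange, arcRange, arcLength_rightArc hF]

theorem curvatureRadius_const_sub (c : ℝ → ℝ × ℝ) (p : ℝ × ℝ) :
    curvatureRadius (fun s => p - c s) = curvatureRadius c := by
  ext s
  have h1 : deriv (fun σ => (p - c σ).1) = fun σ => -deriv (fun σ => (c σ).1) σ := by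
    ext σ; simp only [Prod.fst_sub, deriv_const_sub]
  have h2 : deriv (fun σ => (p - c σ).2) = fun σ => -deriv (fun σ => (c σ).2) σ := by
    ext σ; simp only [Prod.snd_sub, deriv_const_sub]
  simp only [curvatureRadius, h1, h2, deriv.fun_neg, neg_sq, neg_mul_neg]

variable {a b ε : ℝ} {α : ℝ → ℝ}

theorem hasDerivAt_of_contDiffOn (hα : ContDiffOn ℝ ∞ α (Ioo (-ε) ε)) {t : ℝ}
    (ht : t ∈ Ioo (-ε) ε) : HasDerivAt α (deriv α t) t :=
  ((hα.contDiffAt (isOpen_Ioo.mem_nhds ht)).differentiableAt (by simp)).hasDerivAt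

theorem deriv_leftArc (hα : ContDiffOn ℝ ∞ α (Ioo (-ε) ε)) {t : ℝ} (ht : t ∈ Ioo (-ε) ε) :
    deriv (leftArc α) t = (deriv α t, 1) :=
  ((hasDerivAt_of_contDiffOn hα ht).prodMk (hasDerivAt_id t)).deriv

theorem contDiffOn_deriv_Ioo (hα : ContDiffOn ℝ ∞ α (Ioo (-ε) ε)) :
    ContDiffOn ℝ ∞ (deriv α) (Ioo (-ε) ε) :=
  ((contDiffOn_infty_iff_deriv_of_isOpen isOpen_Ioo).1 hα).2

/-- The `F`-speed of the left arc. -/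
def arcSpeed (a b : ℝ) (α : ℝ → ℝ) (t : ℝ) : ℝ := mixedNorm a b (deriv α t, 1)

theorem arcSpeed_pos (ha : 0 < a) (hb : 0 ≤ b) (t : ℝ) : 0 < arcSpeed a b α t :=
  mixedNorm_pos ha hb (by simp [Prod.ext_iff])

theorem contDiffOn_arcSpeed (a b : ℝ) (hα : ContDiffOn ℝ ∞ α (Ioo (-ε) ε)) :
    ContDiffOn ℝ ∞ (arcSpeed a b α) (Ioo (-ε) ε) := fun _ ht =>
  ((((contDiffOn_deriv_Ioo hα).contDiffAt (isOpen_Ioo.mem_nhds ht)).mixedNorm a b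
    contDiffAt_const (by simp [Prod.ext_iff]))).contDiffWithinAt

theorem hasStrictDerivAt_arcLength (a b : ℝ) (hα : ContDiffOn ℝ ∞ α (Ioo (-ε) ε)) (hε : 0 < ε)
    {t : ℝ} (ht : t ∈ Ioo (-ε) ε) :
    HasStrictDerivAt (arcLength (mixedNorm a b) (leftArc α)) (arcSpeed a b α t) t := by
  have h0 : (0 : ℝ) ∈ Ioo (-ε) ε := ⟨by linarith, hε⟩
  have hcont := (contDiffOn_arcSpeed a b hα).continuousOn
  have heq : EqOn (fun τ => mixedNorm a b (deriv (leftArc α) τ)) (arcSpeed a b α) (Ioo (-ε) ε) :=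
    fun τ hτ => by simp only [deriv_leftArc hα hτ, arcSpeed]
  have hcont' : ContinuousOn (fun τ => mixedNorm a b (deriv (leftArc α) τ)) (Ioo (-ε) ε) :=
    hcont.congr heq
  have hsub : uIcc 0 t ⊆ Ioo (-ε) ε := ordConnected_Ioo.uIcc_subset h0 ht
  have h := intervalIntegral.integral_hasStrictDerivAt_right
    (hcont'.mono hsub).intervalIntegrable
    (hcont'.stronglyMeasurableAtFilter isOpen_Ioo t ht)
    (hcont'.continuousAt (isOpen_Ioo.mem_nhds ht))
  rwa [show mixedNorm a b (deriv (leftArc α) t) = arcSpeed a b α t from heq ht] at h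

theorem strictMonoOn_arcLength (ha : 0 < a) (hb : 0 ≤ b) (hα : ContDiffOn ℝ ∞ α (Ioo (-ε) ε))
    (hε : 0 < ε) : StrictMonoOn (arcLength (mixedNorm a b) (leftArc α)) (Ioo (-ε) ε) := by
  refine strictMonoOn_of_deriv_pos (convex_Ioo _ _) (fun t ht =>
    (hasStrictDerivAt_arcLength a b hα hε ht).hasDerivAt.continuousAt.continuousWithinAt)
    fun t ht => ?_
  rw [interior_Ioo] at ht
  rw [(hasStrictDerivAt_arcLength a b hα hε ht).hasDerivAt.deriv]
  exact arcSpeed_pos ha hb t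

theorem footParam_mem {F : ℝ × ℝ → ℝ} {s : ℝ} (hs : s ∈ arcRange F (leftArc α) ε) :
    footParam F α ε s ∈ Ioo (-ε) ε :=
  Function.invFunOn_mem hs

theorem arcLength_footParam {F : ℝ × ℝ → ℝ} {s : ℝ} (hs : s ∈ arcRange F (leftArc α) ε) :
    arcLength F (leftArc α) (footParam F α ε s) = s :=
  Function.invFunOn_eq hs

theorem footParam_injOn {F : ℝ × ℝ → ℝ} :
    InjOn (footParam F α ε) (arcRange F (leftArc α) ε) := fun s hs s' hs' h => by
  rw [← arcLength_footParam hs, ← arcLength_footParam hs', h]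

theorem footParam_arcLength (ha : 0 < a) (hb : 0 ≤ b) (hα : ContDiffOn ℝ ∞ α (Ioo (-ε) ε))
    (hε : 0 < ε) {t : ℝ} (ht : t ∈ Ioo (-ε) ε) :
    footParam (mixedNorm a b) α ε (arcLength (mixedNorm a b) (leftArc α) t) = t :=
  (strictMonoOn_arcLength ha hb hα hε).injOn.leftInvOn_invFunOn ht

theorem isOpen_arcRange (ha : 0 < a) (hb : 0 ≤ b) (hα : ContDiffOn ℝ ∞ α (Ioo (-ε) ε))
    (hε : 0 < ε) : IsOpen (arcRange (mixedNorm a b) (leftArc α) ε) := by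
  rw [isOpen_iff_mem_nhds]
  rintro _ ⟨t, ht, rfl⟩
  rw [← (hasStrictDerivAt_arcLength a b hα hε ht).map_nhds_eq (arcSpeed_pos ha hb t).ne']
  exact image_mem_map (isOpen_Ioo.mem_nhds ht)

theorem zero_mem_arcRange (F : ℝ × ℝ → ℝ) (α : ℝ → ℝ) (hε : 0 < ε) :
    (0 : ℝ) ∈ arcRange F (leftArc α) ε :=
  ⟨0, ⟨by linarith, hε⟩, by simp [arcLength]⟩

theorem footParam_zero (ha : 0 < a) (hb : 0 ≤ b) (hα : ContDiffOn ℝ ∞ α (Ioo (-ε) ε))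
    (hε : 0 < ε) : footParam (mixedNorm a b) α ε 0 = 0 := by
  have := footParam_arcLength ha hb hα hε (t := 0) ⟨by linarith, hε⟩
  simpa [arcLength] using this

theorem hasDerivAt_footParam (ha : 0 < a) (hb : 0 ≤ b) (hα : ContDiffOn ℝ ∞ α (Ioo (-ε) ε))
    (hε : 0 < ε) {s : ℝ} (hs : s ∈ arcRange (mixedNorm a b) (leftArc α) ε) :
    HasDerivAt (footParam (mixedNorm a b) α ε)
      (arcSpeed a b α (footParam (mixedNorm a b) α ε s))⁻¹ s := by
  have ht := footParam_mem hs
  have hd := hasStrictDerivAt_arcLength a b hα hε ht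
  refine HasDerivAt.of_local_left_inverse ?_ hd.hasDerivAt (arcSpeed_pos ha hb _).ne' ?_
  · intro U hU
    have h := hd.map_nhds_eq (arcSpeed_pos ha hb _).ne'
    rw [arcLength_footParam hs] at h
    rw [mem_map, ← h, mem_map]
    filter_upwards [hU, isOpen_Ioo.mem_nhds ht] with t htU ht'
    rwa [mem_preimage, mem_preimage, footParam_arcLength ha hb hα hε ht']
  · filter_upwards [(isOpen_arcRange ha hb hα hε).mem_nhds hs] with s' hs'
    exact arcLength_footParam hs'

/-- The inverse y of the arc length solves the autonomous equation y' = 1/speed(y), which gains one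
derivative in each step of the induction. -/
theorem contDiffOn_footParam (ha : 0 < a) (hb : 0 ≤ b) (hα : ContDiffOn ℝ ∞ α (Ioo (-ε) ε))
    (hε : 0 < ε) : ContDiffOn ℝ ∞ (footParam (mixedNorm a b) α ε)
      (arcRange (mixedNorm a b) (leftArc α) ε) := by
  have hopen := isOpen_arcRange ha hb hα hε
  have hdiff : DifferentiableOn ℝ (footParam (mixedNorm a b) α ε)
      (arcRange (mixedNorm a b) (leftArc α) ε) := fun s hs =>
    (hasDerivAt_footParam ha hb hα hε hs).differentiableAt.differentiableWithinAt
  rw [contDiffOn_infty]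
  intro n
  induction n with
  | zero => exact contDiffOn_zero.2 hdiff.continuousOn
  | succ n ih =>
    push_cast
    rw [contDiffOn_succ_iff_deriv_of_isOpen hopen]
    refine ⟨hdiff, by simp, ?_⟩
    have h1 : ContDiffOn ℝ n (fun t => (arcSpeed a b α t)⁻¹) (Ioo (-ε) ε) :=
      ((contDiffOn_arcSpeed a b hα).of_le (by exact_mod_cast le_top)).inv
        fun t _ => (arcSpeed_pos ha hb t).ne'
    refine (h1.comp ih fun s hs => footParam_mem hs).congr fun s hs => ?_
    exact (hasDerivAt_footParam ha hb hα hε hs).deriv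

/-- The curvature radius of the left arc as a function of the parameter `t`. -/
theorem curvatureRadius_arcParam (ha : 0 < a) (hb : 0 ≤ b) (hα : ContDiffOn ℝ ∞ α (Ioo (-ε) ε))
    (hε : 0 < ε) {s : ℝ} (hs : s ∈ arcRange (mixedNorm a b) (leftArc α) ε) :
    curvatureRadius (arcParam (mixedNorm a b) (leftArc α) ε) s =
      (1 + deriv α (footParam (mixedNorm a b) α ε s) ^ 2) ^ (3 / 2 : ℝ) /
        deriv (deriv α) (footParam (mixedNorm a b) α ε s) := by
  set y := footParam (mixedNorm a b) α ε with hy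
  set g : ℝ → ℝ := fun t => (arcSpeed a b α t)⁻¹ with hg
  have hgpos : ∀ t, 0 < g t := fun t => inv_pos.2 (arcSpeed_pos ha hb t)
  have hnhds := (isOpen_arcRange ha hb hα hε).mem_nhds hs
  have hdy : ∀ s ∈ arcRange (mixedNorm a b) (leftArc α) ε, HasDerivAt y (g (y s)) s :=
    fun s hs => hasDerivAt_footParam ha hb hα hε hs
  have ht := footParam_mem hs
  have hdg : HasDerivAt g (deriv g (y s)) (y s) :=
    ((((contDiffOn_arcSpeed a b hα).contDiffAt (isOpen_Ioo.mem_nhds ht)).inv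
      (arcSpeed_pos ha hb _).ne').differentiableAt (by simp)).hasDerivAt
  have hdα' : HasDerivAt (deriv α) (deriv (deriv α) (y s)) (y s) :=
    hasDerivAt_of_contDiffOn (contDiffOn_deriv_Ioo hα) ht
  have ey : deriv y =ᶠ[𝓝 s] fun s => g (y s) := by
    filter_upwards [hnhds] with s hs using (hdy s hs).deriv
  have ex : deriv (fun s => α (y s)) =ᶠ[𝓝 s] fun s => deriv α (y s) * g (y s) := by
    filter_upwards [hnhds] with s hs
    exact ((hasDerivAt_of_contDiffOn hα (footParam_mem hs)).comp s (hdy s hs)).deriv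
  have eyy : deriv (deriv y) s = deriv g (y s) * g (y s) := by
    rw [ey.deriv_eq]
    exact (hdg.comp s (hdy s hs)).deriv
  have exx : deriv (deriv fun s => α (y s)) s =
      deriv (deriv α) (y s) * g (y s) * g (y s) + deriv α (y s) * (deriv g (y s) * g (y s)) := by
    rw [ex.deriv_eq]
    exact ((hdα'.comp s (hdy s hs)).mul (hdg.comp s (hdy s hs))).deriv
  change (deriv (fun s => α (y s)) s ^ 2 + deriv y s ^ 2) ^ (3 / 2 : ℝ) /
    (deriv y s * deriv (deriv fun s => α (y s)) s - deriv (fun s => α (y s)) s *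
      deriv (deriv y) s) = _
  rw [eyy, exx, ey.eq_of_nhds, ex.eq_of_nhds]
  -- The second-order terms of the reparametrization cancel, so their value is irrelevant.
  generalize deriv g (y s) = G
  have hG := hgpos (y s)
  generalize g (y s) = γ at *
  have h1 : (deriv α (y s) * γ) ^ 2 + γ ^ 2 = γ ^ 2 * (1 + deriv α (y s) ^ 2) := by ring
  have h2 : (γ ^ 2) ^ (3 / 2 : ℝ) = γ ^ 3 := by
    rw [← Real.rpow_natCast, ← Real.rpow_mul hG.le, ← Real.rpow_natCast]; norm_num
  rw [h1, Real.mul_rpow (by positivity) (by positivity), h2]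
  have h3 : γ * (deriv (deriv α) (y s) * γ * γ + deriv α (y s) * (G * γ)) -
      deriv α (y s) * γ * (G * γ) = γ ^ 3 * deriv (deriv α) (y s) := by ring
  rw [h3, mul_div_mul_left _ _ (by positivity)]

end Arc

/-! ### Taylor expansions of the arcs at the vertex. -/

section ArcJet

theorem real_eq_zero_of_vanishesToOrder_mul_pow {c : ℝ} {n : ℕ}
    (h : VanishesToOrder (n + 1) (fun t : ℝ => t ^ n * c)) : c = 0 := by
  have h' : VanishesToOrder (n + 1) (fun t : ℝ => (t : ℂ) ^ n * (c : ℂ)) :=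
    h.of_norm 1 (Eventually.of_forall fun t => by simp)
  exact_mod_cast eq_zero_of_vanishesToOrder_mul_pow h'

theorem quadratic_coeffs_eq_zero {c₀ c₁ c₂ : ℝ}
    (h : VanishesToOrder 3 (fun t : ℝ => c₀ + c₁ * t + c₂ * t ^ 2)) : c₀ = 0 ∧ c₁ = 0 ∧ c₂ = 0 := by
  have hid : VanishesToOrder 1 (fun t : ℝ => t) := .id
  have h0 : c₀ = 0 := by
    apply real_eq_zero_of_vanishesToOrder_mul_pow (n := 0)
    refine (((h.mono (by norm_num)).sub (hid.const_mul c₁)).sub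
      (((hid.pow 2).const_mul c₂).mono (by norm_num))).congr fun t => ?_
    ring
  have h1 : c₁ = 0 := by
    apply real_eq_zero_of_vanishesToOrder_mul_pow (n := 1)
    refine ((h.mono (by norm_num)).sub ((hid.pow 2).const_mul c₂)).congr fun t => ?_
    rw [h0]; ring
  refine ⟨h0, h1, real_eq_zero_of_vanishesToOrder_mul_pow (n := 2) (h.congr fun t => ?_)⟩
  rw [h0, h1]; ring

theorem ContDiffAt.vanishesToOrder_two {φ : ℝ → ℝ} {m : ℝ} (hφ : ContDiffAt ℝ 2 φ 0)
    (hm : HasDerivAt φ m 0) : VanishesToOrder 2 (fun v => φ v - (φ 0 + m * v)) := by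
  have := ContDiffAt.vanishesToOrder_taylor_real (n := 1) (f := φ) (by norm_num; exact hφ)
  refine this.congr fun v => ?_
  simp [Finset.sum_range_succ, hm.deriv]

variable {a b ε : ℝ} {α : ℝ → ℝ}

theorem deriv_neg_of_even (heven : ∀ t ∈ Ioo (-ε) ε, α (-t) = α t) {t : ℝ} (ht : t ∈ Ioo (-ε) ε) :
    deriv α (-t) = -deriv α t := by
  have h : (fun x => α (-x)) =ᶠ[𝓝 t] α := by
    filter_upwards [isOpen_Ioo.mem_nhds ht] with x hx using heven x hx
  have := h.deriv_eq
  rw [deriv_comp_neg] at this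
  linarith

theorem deriv_neg_of_odd (hodd : ∀ t ∈ Ioo (-ε) ε, α (-t) = -α t) {t : ℝ} (ht : t ∈ Ioo (-ε) ε) :
    deriv α (-t) = deriv α t := by
  have h : (fun x => α (-x)) =ᶠ[𝓝 t] fun x => -α x := by
    filter_upwards [isOpen_Ioo.mem_nhds ht] with x hx using hodd x hx
  have := h.deriv_eq
  rw [deriv_comp_neg, deriv.fun_neg] at this
  linarith

/-- The second derivative is expanded, its linear term vanishes by evenness, and two integrations
give the slope and the arc. -/
theorem exists_arc_jet (hα : ContDiffOn ℝ ∞ α (Ioo (-ε) ε)) (hε : 0 < ε) (hα0 : α 0 = 0)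
    (heven : ∀ t ∈ Ioo (-ε) ε, α (-t) = α t) :
    ∃ κ c : ℝ, VanishesToOrder 3 (fun t => deriv (deriv α) t - (κ + 3 * c * t ^ 2)) ∧
      VanishesToOrder 4 (fun t => deriv α t - (κ * t + c * t ^ 3)) ∧
      VanishesToOrder 4 (fun t => α t - κ / 2 * t ^ 2) := by
  have h0 : (0 : ℝ) ∈ Ioo (-ε) ε := ⟨by linarith, hε⟩
  have hnhds := isOpen_Ioo.mem_nhds h0
  have hα' := contDiffOn_deriv_Ioo hα
  have hα'' := contDiffOn_deriv_Ioo hα'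
  have hodd : ∀ t ∈ Ioo (-ε) ε, deriv α (-t) = -deriv α t := fun t ht => deriv_neg_of_even heven ht
  have heven' : ∀ t ∈ Ioo (-ε) ε, deriv (deriv α) (-t) = deriv (deriv α) t :=
    fun t ht => deriv_neg_of_odd hodd ht
  have hid : VanishesToOrder 1 (fun t : ℝ => t) := .id
  have hT := ContDiffAt.vanishesToOrder_taylor_real (n := 2) (f := deriv (deriv α))
    (by exact_mod_cast contDiffAt_infty.1 (hα''.contDiffAt hnhds) 3)
  simp only [Finset.sum_range_succ, Finset.range_zero, Finset.sum_empty] at hT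
  set d := fun k => iteratedDeriv k (deriv (deriv α)) 0
  have hd1 : d 1 = 0 := by
    have hT' := hT.comp' (hid.neg)
    have : VanishesToOrder 3 (fun t : ℝ => 0 + d 1 * t + 0 * t ^ 2) := by
      have h2 : VanishesToOrder 3 _ := (hT'.sub hT).const_mul (1 / 2 : ℝ)
      refine h2.congr' ?_
      filter_upwards [hnhds] with t ht
      rw [heven' t ht]
      simp [d]
      ring
    exact (quadratic_coeffs_eq_zero this).2.1
  refine ⟨d 0, d 2 / 6, ?_⟩
  have j2 : VanishesToOrder 3 (fun t => deriv (deriv α) t - (d 0 + 3 * (d 2 / 6) * t ^ 2)) := by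
    refine hT.congr fun t => ?_
    have hd1' : iteratedDeriv 1 (deriv (deriv α)) 0 = 0 := hd1
    simp only [d, hd1', Nat.factorial]
    push_cast
    ring
  have z1 : deriv α 0 = 0 := by
    have := hodd 0 h0
    rw [neg_zero] at this
    linarith
  have j1 : VanishesToOrder 4 (fun t => deriv α t - (d 0 * t + d 2 / 6 * t ^ 3)) := by
    refine VanishesToOrder.of_deriv (by simp [z1]) ?_ j2
    filter_upwards [hnhds] with t ht
    refine ((hasDerivAt_of_contDiffOn hα' ht).sub (((hasDerivAt_id t).const_mul _).add
      ((hasDerivAt_pow 3 t).const_mul _))).congr_deriv ?_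
    norm_num; ring
  refine ⟨j2, j1, ?_⟩
  have j1' : VanishesToOrder 3 (fun t => deriv α t - d 0 * t) := by
    refine ((j1.mono (by norm_num)).add ((hid.pow 3).const_mul (d 2 / 6))).congr fun t => ?_
    ring
  refine VanishesToOrder.of_deriv (by simp [hα0]) ?_ j1'
  filter_upwards [hnhds] with t ht
  refine ((hasDerivAt_of_contDiffOn hα ht).sub ((hasDerivAt_pow 2 t).const_mul _)).congr_deriv ?_
  norm_num; ring

/-- The quartic norm of (α', 1) is 1 + O(t⁴), so only the Euclidean part enters, with its weight a;
a + b = 1 normalizes the speed at the vertex. -/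
theorem arcSpeed_inv_jet (hab : a + b = 1) {κ c : ℝ}
    (hj : VanishesToOrder 4 (fun t => deriv α t - (κ * t + c * t ^ 3))) :
    VanishesToOrder 4 (fun t => (arcSpeed a b α t)⁻¹ - (1 - a / 2 * κ ^ 2 * t ^ 2)) := by
  have hid : VanishesToOrder 1 (fun t : ℝ => t) := .id
  have hp3 : VanishesToOrder 3 (fun t => deriv α t - κ * t) := by
    refine ((hj.mono (by norm_num)).add ((hid.pow 3).const_mul c)).congr fun t => ?_
    ring
  have hp : VanishesToOrder 1 (deriv α) := by
    refine ((hp3.mono (by norm_num)).add (hid.const_mul κ)).congr fun t => ?_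
    ring
  have hp2 : VanishesToOrder 4 (fun t => deriv α t ^ 2 - κ ^ 2 * t ^ 2) := by
    refine (hp3.mul (hp.add (hid.const_mul κ))).congr fun t => ?_
    ring
  have q1 : VanishesToOrder 2 (fun v : ℝ => √(1 + v) - (1 + 1 / 2 * v)) := by
    have h1 : HasDerivAt (fun v : ℝ => √(1 + v)) (1 / 2) 0 := by
      have := (((hasDerivAt_id (0 : ℝ)).const_add 1).sqrt (by simp))
      simpa using this
    have h2 : ContDiffAt ℝ 2 (fun v : ℝ => √(1 + v)) 0 :=
      (contDiffAt_const.add contDiffAt_id).sqrt (by simp)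
    simpa using h2.vanishesToOrder_two h1
  have q2 : VanishesToOrder 1 (fun v : ℝ => (1 + v) ^ (1 / 4 : ℝ) - 1) :=
    ContDiffAt.vanishesToOrder_one (n := 1)
      (((contDiffAt_const.add contDiffAt_id).rpow_const_of_ne (by simp)).sub contDiffAt_const)
      one_ne_zero (by simp)
  have e1 : VanishesToOrder 4 (fun t => √(1 + deriv α t ^ 2) - (1 + 1 / 2 * (κ ^ 2 * t ^ 2))) := by
    refine ((q1.comp (hp.pow 2) (by norm_num)).add (hp2.const_mul (1 / 2))).congr fun t => ?_
    ring
  have e2 : VanishesToOrder 4 (fun t => (1 + deriv α t ^ 4) ^ (1 / 4 : ℝ) - 1) :=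
    q2.comp (hp.pow 4) (by norm_num)
  have e3 : VanishesToOrder 4 (fun t => (arcSpeed a b α t - 1) - a / 2 * κ ^ 2 * t ^ 2) := by
    refine ((e1.const_mul a).add (e2.const_mul b)).congr fun t => ?_
    simp only [arcSpeed, mixedNorm, one_pow, add_comm _ (1 : ℝ)]
    linear_combination -hab
  have e4 : VanishesToOrder 2 (fun t => arcSpeed a b α t - 1) := by
    refine ((e3.mono (by norm_num)).add ((hid.pow 2).const_mul (a / 2 * κ ^ 2))).congr fun t => ?_
    ring
  have q3 : VanishesToOrder 2 (fun v : ℝ => (1 + v)⁻¹ - (1 + -1 * v)) := by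
    have h1 : HasDerivAt (fun v : ℝ => (1 + v)⁻¹) (-1) 0 := by
      have := (((hasDerivAt_id (0 : ℝ)).const_add 1).fun_inv (by simp))
      simpa using this
    have h2 : ContDiffAt ℝ 2 (fun v : ℝ => (1 + v)⁻¹) 0 :=
      (contDiffAt_const.add contDiffAt_id).inv (by simp)
    simpa using h2.vanishesToOrder_two h1
  refine ((q3.comp e4 (by norm_num)).sub e3).congr fun t => ?_
  rw [add_sub_cancel]
  ring

/-- The jets of the arc in the arc-length parameter. -/
theorem arcParam_jet (ha : 0 < a) (hb : 0 ≤ b) (hab : a + b = 1)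
    (hα : ContDiffOn ℝ ∞ α (Ioo (-ε) ε)) (hε : 0 < ε) {κ c : ℝ}
    (hj : VanishesToOrder 4 (fun t => deriv α t - (κ * t + c * t ^ 3)))
    (hj0 : VanishesToOrder 4 (fun t => α t - κ / 2 * t ^ 2)) :
    VanishesToOrder 4 (fun s => footParam (mixedNorm a b) α ε s - (s - a * κ ^ 2 / 6 * s ^ 3)) ∧
    VanishesToOrder 4 (fun s => (arcSpeed a b α (footParam (mixedNorm a b) α ε s))⁻¹ -
      (1 - a / 2 * κ ^ 2 * s ^ 2)) ∧
    VanishesToOrder 4 (fun s => deriv α (footParam (mixedNorm a b) α ε s) *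
      (arcSpeed a b α (footParam (mixedNorm a b) α ε s))⁻¹ -
      (κ * s + (c - 2 / 3 * a * κ ^ 3) * s ^ 3)) ∧
    VanishesToOrder 4 (fun s => α (footParam (mixedNorm a b) α ε s) - κ / 2 * s ^ 2) := by
  set y := footParam (mixedNorm a b) α ε with hy
  have hid : VanishesToOrder 1 (fun t : ℝ => t) := .id
  have h0 := zero_mem_arcRange (mixedNorm a b) α hε
  have hnhds := (isOpen_arcRange ha hb hα hε).mem_nhds h0
  have hy0 : y 0 = 0 := footParam_zero ha hb hα hε
  have hy1 : VanishesToOrder 1 y :=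
    ((contDiffOn_footParam ha hb hα hε).contDiffAt hnhds).vanishesToOrder_one (by simp) hy0
  have hg := (arcSpeed_inv_jet hab hj).comp' hy1
  have hd : ∀ᶠ s in 𝓝 0, HasDerivAt y (arcSpeed a b α (y s))⁻¹ s := by
    filter_upwards [hnhds] with s hs using hasDerivAt_footParam ha hb hα hε hs
  have hg2 : VanishesToOrder 2 (fun s => (arcSpeed a b α (y s))⁻¹ - 1) := by
    refine ((hg.mono (by norm_num)).sub ((hy1.pow 2).const_mul (a / 2 * κ ^ 2))).congr fun s => ?_
    ring
  -- Bootstrapping: this rough expansion of y sharpens that of y', whose integral is `hy5`.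
  have hy3 : VanishesToOrder 3 (fun s => y s - s) := by
    refine VanishesToOrder.of_deriv (by simp [hy0]) ?_ hg2
    filter_upwards [hd] with s hs using hs.sub (hasDerivAt_id s)
  have hys : VanishesToOrder 4 (fun s => y s ^ 2 - s ^ 2) := by
    refine (hy3.mul (hy1.add hid)).congr fun s => ?_
    ring
  have hg4 : VanishesToOrder 4 (fun s => (arcSpeed a b α (y s))⁻¹ - (1 - a / 2 * κ ^ 2 * s ^ 2)) := by
    refine (hg.sub (hys.const_mul (a / 2 * κ ^ 2))).congr fun s => ?_
    ring
  have hy5 : VanishesToOrder 5 (fun s => y s - (s - a * κ ^ 2 / 6 * s ^ 3)) := by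
    refine VanishesToOrder.of_deriv (by simp [hy0]) ?_ hg4
    filter_upwards [hd] with s hs
    refine (hs.sub ((hasDerivAt_id s).sub ((hasDerivAt_pow 3 s).const_mul _))).congr_deriv ?_
    norm_num; ring
  have hy4 := hy5.mono (show 4 ≤ 5 by norm_num)
  have hyc : VanishesToOrder 4 (fun s => y s ^ 3 - s ^ 3) := by
    refine ((hy3.mul (((hy1.pow 2).add (hy1.mul hid)).add (hid.pow 2))).mono
      (by norm_num)).congr fun s => ?_
    ring
  have hp : VanishesToOrder 4 (fun s => deriv α (y s) -
      (κ * s + (c - a * κ ^ 3 / 6) * s ^ 3)) := by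
    refine (((hj.comp' hy1).add (hy4.const_mul κ)).add (hyc.const_mul c)).congr fun s => ?_
    ring
  refine ⟨hy4, hg4, ?_, ?_⟩
  · have hpol : VanishesToOrder 0 (fun s : ℝ => 1 - a / 2 * κ ^ 2 * s ^ 2) :=
      .of_continuousAt (by fun_prop)
    have hpb : VanishesToOrder 0 (fun s => deriv α (y s)) := by
      refine (VanishesToOrder.of_continuousAt (f := fun s : ℝ => κ * s + (c - a * κ ^ 3 / 6) * s ^ 3)
        (by fun_prop)).add (hp.mono (by norm_num)) |>.congr fun s => ?_
      ring
    refine (((hpb.mul' hg4 le_rfl).add (hp.mul' hpol le_rfl)).sub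
      (((hid.pow 5).const_mul ((c - a * κ ^ 3 / 6) * (a / 2 * κ ^ 2))).mono
        (by norm_num))).congr fun s => ?_
    ring
  · refine ((hj0.comp' hy1).add (hys.const_mul (κ / 2))).congr fun s => ?_
    ring

/-- The curvature radius at the vertex of the arc and its second derivative. -/
theorem curvatureRadius_jet (ha : 0 < a) (hb : 0 ≤ b) (hab : a + b = 1)
    (hα : ContDiffOn ℝ ∞ α (Ioo (-ε) ε)) (hε : 0 < ε) {κ c : ℝ}
    (hj2 : VanishesToOrder 3 (fun t => deriv (deriv α) t - (κ + 3 * c * t ^ 2)))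
    (hj : VanishesToOrder 4 (fun t => deriv α t - (κ * t + c * t ^ 3)))
    (hj0 : VanishesToOrder 4 (fun t => α t - κ / 2 * t ^ 2)) :
    curvatureRadius (arcParam (mixedNorm a b) (leftArc α) ε) 0 = κ⁻¹ ∧
    (κ ≠ 0 → iteratedDeriv 2 (curvatureRadius (arcParam (mixedNorm a b) (leftArc α) ε)) 0 =
      3 * κ - 6 * c / κ ^ 2) := by
  set y := footParam (mixedNorm a b) α ε with hy
  have hid : VanishesToOrder 1 (fun t : ℝ => t) := .id
  have h0 := zero_mem_arcRange (mixedNorm a b) α hε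
  have hnhds := (isOpen_arcRange ha hb hα hε).mem_nhds h0
  have h0' : (0 : ℝ) ∈ Ioo (-ε) ε := ⟨by linarith, hε⟩
  have hy0 : y 0 = 0 := footParam_zero ha hb hα hε
  have hysm : ContDiffAt ℝ ∞ y 0 := (contDiffOn_footParam ha hb hα hε).contDiffAt hnhds
  have hy1 : VanishesToOrder 1 y := hysm.vanishesToOrder_one (by simp) hy0
  have hy4 := (arcParam_jet ha hb hab hα hε hj hj0).1
  have hcr : curvatureRadius (arcParam (mixedNorm a b) (leftArc α) ε) =ᶠ[𝓝 0]
      fun s => (1 + deriv α (y s) ^ 2) ^ (3 / 2 : ℝ) / deriv (deriv α) (y s) := by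
    filter_upwards [hnhds] with s hs using curvatureRadius_arcParam ha hb hα hε hs
  have hp0 : deriv α 0 = 0 := by
    have := hj.eq_zero (by norm_num)
    simpa using this
  have hk0 : deriv (deriv α) 0 = κ := by
    have := hj2.eq_zero (by norm_num)
    linarith
  refine ⟨by rw [hcr.eq_of_nhds, hy0, hp0, hk0]; simp, fun hκ => ?_⟩
  rw [hcr.iteratedDeriv_eq]
  have hα' := contDiffOn_deriv_Ioo hα
  have hα'' := contDiffOn_deriv_Ioo hα'
  have hnhds' := isOpen_Ioo.mem_nhds h0'
  have hsm : ContDiffAt ℝ 3 (fun s => (1 + deriv α (y s) ^ 2) ^ (3 / 2 : ℝ) /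
      deriv (deriv α) (y s)) 0 := by
    have c1 : ContDiffAt ℝ ∞ (fun s => deriv α (y s)) 0 :=
      ContDiffAt.comp (g := deriv α) 0 (by rw [hy0]; exact hα'.contDiffAt hnhds') hysm
    have c2 : ContDiffAt ℝ ∞ (fun s => deriv (deriv α) (y s)) 0 :=
      ContDiffAt.comp (g := deriv (deriv α)) 0 (by rw [hy0]; exact hα''.contDiffAt hnhds') hysm
    have c3 := ((contDiffAt_const (c := (1 : ℝ))).add (c1.pow 2)).rpow_const_of_ne (p := 3 / 2)
      (by positivity) |>.div c2 (by rw [hy0, hk0]; exact hκ)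
    exact_mod_cast contDiffAt_infty.1 c3 3
  have hT := ContDiffAt.vanishesToOrder_taylor_real (n := 2) hsm
  simp only [Finset.sum_range_succ, Finset.range_zero, Finset.sum_empty] at hT
  set ρ : ℝ → ℝ := fun s => (1 + deriv α (y s) ^ 2) ^ (3 / 2 : ℝ) / deriv (deriv α) (y s) with hρ
  have hp3 : VanishesToOrder 3 (fun t => deriv α t - κ * t) := by
    refine ((hj.mono (by norm_num)).add ((hid.pow 3).const_mul c)).congr fun t => ?_
    ring
  have hp : VanishesToOrder 1 (deriv α) := by
    refine ((hp3.mono (by norm_num)).add (hid.const_mul κ)).congr fun t => ?_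
    ring
  have hp2 : VanishesToOrder 3 (fun t => deriv α t ^ 2 - κ ^ 2 * t ^ 2) := by
    refine ((hp3.mul (hp.add (hid.const_mul κ))).mono (by norm_num)).congr fun t => ?_
    ring
  have q1 : VanishesToOrder 2 (fun v : ℝ => (1 + v) ^ (3 / 2 : ℝ) - (1 + 3 / 2 * v)) := by
    have h1 : HasDerivAt (fun v : ℝ => (1 + v) ^ (3 / 2 : ℝ)) (3 / 2) 0 := by
      have := (((hasDerivAt_id (0 : ℝ)).const_add 1).rpow_const (p := 3 / 2) (by simp))
      simpa using this
    have h2 : ContDiffAt ℝ 2 (fun v : ℝ => (1 + v) ^ (3 / 2 : ℝ)) 0 :=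
      (contDiffAt_const.add contDiffAt_id).rpow_const_of_ne (by simp)
    simpa using h2.vanishesToOrder_two h1
  have q2 : VanishesToOrder 2 (fun v : ℝ => (κ + v)⁻¹ - (κ⁻¹ + -1 / κ ^ 2 * v)) := by
    have h1 : HasDerivAt (fun v : ℝ => (κ + v)⁻¹) (-1 / κ ^ 2) 0 := by
      have := (((hasDerivAt_id (0 : ℝ)).const_add κ).fun_inv (by simpa using hκ))
      simpa using this
    have h2 : ContDiffAt ℝ 2 (fun v : ℝ => (κ + v)⁻¹) 0 :=
      (contDiffAt_const.add contDiffAt_id).inv (by simpa using hκ)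
    simpa using h2.vanishesToOrder_two h1
  have e1 : VanishesToOrder 3 (fun t => (1 + deriv α t ^ 2) ^ (3 / 2 : ℝ) -
      (1 + 3 / 2 * κ ^ 2 * t ^ 2)) := by
    refine (((q1.comp (hp.pow 2) (by norm_num)).mono (by norm_num)).add
      (hp2.const_mul (3 / 2))).congr fun t => ?_
    ring
  have e2 : VanishesToOrder 2 (fun t => deriv (deriv α) t - κ) := by
    refine ((hj2.mono (by norm_num)).add ((hid.pow 2).const_mul (3 * c))).congr fun t => ?_
    ring
  have e3 : VanishesToOrder 3 (fun t => (deriv (deriv α) t)⁻¹ -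
      (κ⁻¹ - 3 * c / κ ^ 2 * t ^ 2)) := by
    refine (((q2.comp e2 (by norm_num)).mono (by norm_num)).add
      (hj2.const_mul (-1 / κ ^ 2))).congr fun t => ?_
    rw [add_sub_cancel]
    ring
  have e4 : VanishesToOrder 3 (fun t => (1 + deriv α t ^ 2) ^ (3 / 2 : ℝ) * (deriv (deriv α) t)⁻¹ -
      (κ⁻¹ + (3 / 2 * κ - 3 * c / κ ^ 2) * t ^ 2)) := by
    have b1 : VanishesToOrder 0 (fun t : ℝ => κ⁻¹ - 3 * c / κ ^ 2 * t ^ 2) :=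
      .of_continuousAt (by fun_prop)
    have b2 : VanishesToOrder 0 (fun t => (1 + deriv α t ^ 2) ^ (3 / 2 : ℝ)) := by
      refine (VanishesToOrder.of_continuousAt (f := fun t : ℝ => 1 + 3 / 2 * κ ^ 2 * t ^ 2)
        (by fun_prop)).add (e1.mono (by norm_num)) |>.congr fun s => ?_
      ring
    refine (((b2.mul' e3 le_rfl).add (e1.mul' b1 le_rfl)).sub
      (((hid.pow 4).const_mul (3 / 2 * κ ^ 2 * (3 * c / κ ^ 2))).mono (by norm_num))).congr
      fun t => ?_
    field_simp
    ring
  have e5 : VanishesToOrder 3 (fun s => y s ^ 2 - s ^ 2) := by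
    refine (((hy4.mono (show 3 ≤ 4 by norm_num)).sub
      ((hid.pow 3).const_mul (a * κ ^ 2 / 6))).mul' (hy1.add hid)
      (show 3 ≤ 3 + 1 by norm_num)).congr fun s => ?_
    ring
  have e6 := (e4.comp' hy1).add (e5.const_mul (3 / 2 * κ - 3 * c / κ ^ 2))
  -- Two expansions of the same function with errors of order three have equal coefficients; this
  -- avoids differentiating the quotient twice.
  have e7 := quadratic_coeffs_eq_zero
    (c₀ := iteratedDeriv 0 ρ 0 - κ⁻¹) (c₁ := iteratedDeriv 1 ρ 0)
    (c₂ := iteratedDeriv 2 ρ 0 / 2 - (3 / 2 * κ - 3 * c / κ ^ 2)) <| (e6.sub hT).congr fun s => by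
      simp only [hρ]
      norm_num [Nat.factorial]
      ring
  linear_combination 2 * e7.2.2

end ArcJet

/-! ### Third-order expansion of the derivative of the chord length. -/

section GeneratingFunction

/-- A strictly convex even arc with curvature `κ` and the cubic coefficient `c` of its slope. -/
structure IsTableArc (ε : ℝ) (α : ℝ → ℝ) (κ c : ℝ) : Prop where
  smooth : ContDiffOn ℝ ∞ α (Ioo (-ε) ε)
  even : ∀ t ∈ Ioo (-ε) ε, α (-t) = α t
  jet₂ : VanishesToOrder 3 (fun t => deriv (deriv α) t - (κ + 3 * c * t ^ 2))
  jet₁ : VanishesToOrder 4 (fun t => deriv α t - (κ * t + c * t ^ 3))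
  jet₀ : VanishesToOrder 4 (fun t => α t - κ / 2 * t ^ 2)
  pos : 0 < κ

/-- The derivative with respect to `s` of the distance from the point with the parameter `s` on the
left arc to the point with the parameter `s₁` on the right arc. -/
def chordDeriv (a b L ε : ℝ) (α β : ℝ → ℝ) (s s₁ : ℝ) : ℝ :=
  let y := footParam (mixedNorm a b) α ε s
  let y₁ := footParam (mixedNorm a b) β ε s₁
  mixedNormDeriv a b (L - α y - β y₁, -(y + y₁))
    (-(deriv α y * (arcSpeed a b α y)⁻¹), -(arcSpeed a b α y)⁻¹)

/-- The cubic part of `chordDeriv`; the parameters `κ`, `c` and `κ₁` describe the arcs. -/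
def chordCubic (a b L κ c κ₁ s s₁ : ℝ) : ℝ :=
  -(c - 2 / 3 * a * κ ^ 3) * s ^ 3 + a / 2 * κ * s * (s + s₁) ^ 2 / L ^ 2 -
    a ^ 2 / (6 * L) * (κ ^ 2 * s ^ 3 + κ₁ ^ 2 * s₁ ^ 3) +
    a * (s + s₁) * (κ * s ^ 2 + κ₁ * s₁ ^ 2) / (2 * L ^ 2) +
    (b - a / 2) * (s + s₁) ^ 3 / L ^ 3 - a ^ 2 / 2 * κ ^ 2 * s ^ 2 * (s + s₁) / L

/-- The derivative of a norm is homogeneous of degree zero in the base point, so only the slope Y/X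
of the chord matters. -/
theorem mixedNormDeriv_eq_slope (a b : ℝ) {X Y p g : ℝ} (hX : 0 < X) :
    mixedNormDeriv a b (X, -Y) (-p, -g) =
      a * ((-p + g * (Y / X)) * (√(1 + (Y / X) ^ 2))⁻¹) +
      b * ((-p + g * (Y / X) ^ 3) * (1 + (Y / X) ^ 4) ^ (-(3 / 4) : ℝ)) := by
  have hv : ((X, -Y) : ℝ × ℝ) = X • (1, -(Y / X)) := by
    ext <;> simp
    field_simp
  rw [hv, mixedNormDeriv_smul_left a b hX]
  simp only [mixedNormDeriv, one_pow, neg_sq, Even.neg_pow (by decide : Even 4),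
    Odd.neg_pow (by decide : Odd 3)]
  ring

/-- Here w is the slope of the chord and (p, g) the unit tangent. In the cubic terms w and p may be
replaced by their linear parts `w₁` and `p₁`. The Euclidean part contributes (-p + g w)(1 - w²/2),
the quartic part -p + g w³. -/
theorem chordDeriv_slope_jet {E : Type*} [NormedAddCommGroup E] {a b : ℝ} (hab : a + b = 1)
    {w p g w₁ p₁ q : E → ℝ} (hw₁ : VanishesToOrder 1 w₁) (hp₁ : VanishesToOrder 1 p₁)
    (hw : VanishesToOrder 3 (fun z => w z - w₁ z)) (hp : VanishesToOrder 3 (fun z => p z - p₁ z))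
    (hq : VanishesToOrder 2 q) (hg : VanishesToOrder 4 (fun z => g z - (1 - q z))) :
    VanishesToOrder 4 (fun z => (a * ((-p z + g z * w z) * (√(1 + w z ^ 2))⁻¹) +
      b * ((-p z + g z * w z ^ 3) * (1 + w z ^ 4) ^ (-(3 / 4) : ℝ))) -
      (-p z + a * w z - a * q z * w₁ z + a / 2 * p₁ z * w₁ z ^ 2 +
        (b - a / 2) * w₁ z ^ 3)) := by
  have hw1 : VanishesToOrder 1 w :=
    ((hw.mono (by norm_num)).add hw₁).congr fun z => by ring
  have hp1 : VanishesToOrder 1 p :=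
    ((hp.mono (by norm_num)).add hp₁).congr fun z => by ring
  have hg2 : VanishesToOrder 2 (fun z => g z - 1) :=
    ((hg.mono (by norm_num)).sub hq).congr fun z => by ring
  have hg0 : VanishesToOrder 0 g :=
    ((hg2.mono (by norm_num)).add (.const 1)).congr fun z => by ring
  have r1 : VanishesToOrder 2 (fun v : ℝ => (√(1 + v))⁻¹ - (1 + -(1 / 2) * v)) := by
    have h1 : HasDerivAt (fun v : ℝ => (√(1 + v))⁻¹) (-(1 / 2)) 0 := by
      have := (((hasDerivAt_id (0 : ℝ)).const_add 1).sqrt (by simp)).fun_inv (by simp)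
      simpa using this
    have h2 : ContDiffAt ℝ 2 (fun v : ℝ => (√(1 + v))⁻¹) 0 :=
      ((contDiffAt_const.add contDiffAt_id).sqrt (by simp)).inv (by simp)
    simpa using h2.vanishesToOrder_two h1
  have r2 : VanishesToOrder 1 (fun v : ℝ => (1 + v) ^ (-(3 / 4) : ℝ) - 1) :=
    ContDiffAt.vanishesToOrder_one (n := 1)
      (((contDiffAt_const.add contDiffAt_id).rpow_const_of_ne (by simp)).sub contDiffAt_const)
      one_ne_zero (by simp)
  have hA := r1.comp (hw1.pow 2) (by norm_num)
  have hB := r2.comp (hw1.pow 4) (by norm_num)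
  have hu : VanishesToOrder 1 (fun z => -p z + g z * w z) :=
    hp1.neg.add (hg0.mul' hw1 (by norm_num))
  have hu' : VanishesToOrder 1 (fun z => -p z + g z * w z ^ 3) :=
    hp1.neg.add (hg0.mul' (hw1.pow 3) (by norm_num))
  have t1 : VanishesToOrder 4 (fun z => q z * w z - q z * w₁ z) :=
    (hq.mul' hw (show 4 ≤ 2 + 3 by norm_num)).congr fun z => by ring
  have hww : VanishesToOrder 4 (fun z => w z ^ 2 - w₁ z ^ 2) :=
    (hw.mul' (hw1.add hw₁) le_rfl).congr fun z => by ring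
  have t2 : VanishesToOrder 4 (fun z => p z * w z ^ 2 - p₁ z * w₁ z ^ 2) :=
    ((hp.mul' (hw1.pow 2) (by norm_num)).add (hp₁.mul' hww (by norm_num))).congr
      fun z => by ring
  have t3 : VanishesToOrder 4 (fun z => w z ^ 3 - w₁ z ^ 3) :=
    ((hw.mul' (hw1.pow 2) (by norm_num)).add (hw₁.mul' hww (by norm_num))).congr
      fun z => by ring
  have t4 : VanishesToOrder 4 (fun z => g z * w z ^ 3 - w₁ z ^ 3) :=
    ((hg2.mul' (hw1.pow 3) (by norm_num)).add t3).congr fun z => by ring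
  have t5 : VanishesToOrder 4 (fun z => g z * w z - (w z - q z * w₁ z)) :=
    ((hg.mul' hw1 (by norm_num)).sub t1).congr fun z => by ring
  refine (((((hu.mul' hA (by norm_num)).const_mul a).add
    ((hu'.mul' hB (by norm_num)).const_mul b)).add (t5.const_mul a)).add
    ((t2.const_mul (a / 2)).add (t4.const_mul (b - a / 2)))).congr fun z => ?_
  linear_combination (p z) * hab

variable {a b L ε κ c κ₁ c₁ : ℝ} {α β : ℝ → ℝ}

/-- The linear part is -κ s plus a times the slope (s + s₁)/L: the unit circle of the quartic norm
is flat in the direction of the axis, so b does not enter at this order. -/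
theorem chordDeriv_jet (ha : 0 < a) (hb : 0 ≤ b) (hab : a + b = 1) (hL : 0 < L) (hε : 0 < ε)
    (hα : IsTableArc ε α κ c) (hβ : IsTableArc ε β κ₁ c₁) :
    VanishesToOrder 4 (fun z : ℝ × ℝ => chordDeriv a b L ε α β z.1 z.2 -
      ((a / L - κ) * z.1 + a / L * z.2 + chordCubic a b L κ c κ₁ z.1 z.2)) := by
  have hs : VanishesToOrder 1 (fun z : ℝ × ℝ => z.1) :=
    (ContinuousLinearMap.fst ℝ ℝ ℝ).vanishesToOrder_one
  have ht : VanishesToOrder 1 (fun z : ℝ × ℝ => z.2) :=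
    (ContinuousLinearMap.snd ℝ ℝ ℝ).vanishesToOrder_one
  obtain ⟨jy, jg, jp, jx⟩ := arcParam_jet ha hb hab hα.smooth hε hα.jet₁ hα.jet₀
  obtain ⟨jy₁, -, -, jx₁⟩ := arcParam_jet ha hb hab hβ.smooth hε hβ.jet₁ hβ.jet₀
  have jy := jy.comp' hs
  have jg := jg.comp' hs
  have jp := jp.comp' hs
  have jx := jx.comp' hs
  have jy₁ := jy₁.comp' ht
  have jx₁ := jx₁.comp' ht
  set y : ℝ → ℝ := footParam (mixedNorm a b) α ε with hy
  set y₁ : ℝ → ℝ := footParam (mixedNorm a b) β ε with hy₁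
  set g : ℝ × ℝ → ℝ := fun z => (arcSpeed a b α (y z.1))⁻¹ with hg
  set p : ℝ × ℝ → ℝ := fun z => deriv α (y z.1) * (arcSpeed a b α (y z.1))⁻¹ with hp
  set v : ℝ × ℝ → ℝ := fun z => α (y z.1) + β (y₁ z.2) with hv
  set Y : ℝ × ℝ → ℝ := fun z => y z.1 + y₁ z.2 with hY
  have hσ : VanishesToOrder 1 (fun z : ℝ × ℝ => z.1 + z.2) := hs.add ht
  have jv : VanishesToOrder 4 (fun z => v z - (κ / 2 * z.1 ^ 2 + κ₁ / 2 * z.2 ^ 2)) :=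
    (jx.add jx₁).congr fun z => by simp only [hv]; ring
  have hv2 : VanishesToOrder 2 v :=
    ((jv.mono (by norm_num)).add (((hs.pow 2).const_mul (κ / 2)).add
      ((ht.pow 2).const_mul (κ₁ / 2)))).congr fun z => by ring
  have jY : VanishesToOrder 4 (fun z => Y z -
      (z.1 + z.2 - a / 6 * (κ ^ 2 * z.1 ^ 3 + κ₁ ^ 2 * z.2 ^ 3))) :=
    (jy.add jy₁).congr fun z => by simp only [hY]; ring
  have hY3 : VanishesToOrder 3 (fun z => Y z - (z.1 + z.2)) :=
    ((jY.mono (by norm_num)).sub ((((hs.pow 3).const_mul (κ ^ 2)).add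
      ((ht.pow 3).const_mul (κ₁ ^ 2))).const_mul (a / 6))).congr fun z => by ring
  have hY1 : VanishesToOrder 1 Y :=
    ((hY3.mono (by norm_num)).add hσ).congr fun z => by ring
  have r : VanishesToOrder 2 (fun v : ℝ => (L - v)⁻¹ - (L⁻¹ + 1 / L ^ 2 * v)) := by
    have h1 : HasDerivAt (fun v : ℝ => (L - v)⁻¹) (1 / L ^ 2) 0 := by
      have := (((hasDerivAt_id (0 : ℝ)).const_sub L).fun_inv (by simpa using hL.ne'))
      simpa using this
    have h2 : ContDiffAt ℝ 2 (fun v : ℝ => (L - v)⁻¹) 0 :=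
      (contDiffAt_const.sub contDiffAt_id).inv (by simpa using hL.ne')
    simpa using h2.vanishesToOrder_two h1
  have jr := r.comp hv2 (by norm_num)
  -- Since v has order two and Y order one, 1/(L - v) is needed only up to v/L².
  have jw : VanishesToOrder 4 (fun z => Y z / (L - v z) -
      ((z.1 + z.2) / L - a / (6 * L) * (κ ^ 2 * z.1 ^ 3 + κ₁ ^ 2 * z.2 ^ 3) +
        (z.1 + z.2) * (κ * z.1 ^ 2 + κ₁ * z.2 ^ 2) / (2 * L ^ 2))) := by
    refine ((((hY1.mul' jr (by norm_num)).add (jY.const_mul (1 / L))).add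
      ((hY3.mul' hv2 (by norm_num)).const_mul (1 / L ^ 2))).add
      ((hσ.mul' jv (by norm_num)).const_mul (1 / L ^ 2))).congr fun z => ?_
    rw [div_eq_mul_inv (Y z)]
    generalize (L - v z)⁻¹ = ρ
    field_simp
    ring
  have hw3 : VanishesToOrder 3 (fun z => Y z / (L - v z) - (z.1 + z.2) / L) := by
    refine (((jw.mono (by norm_num)).sub ((((hs.pow 3).const_mul (κ ^ 2)).add
      ((ht.pow 3).const_mul (κ₁ ^ 2))).const_mul (a / (6 * L)))).add
      ((hσ.mul (((hs.pow 2).const_mul κ).add ((ht.pow 2).const_mul κ₁))).const_mul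
        (1 / (2 * L ^ 2)))).congr fun z => ?_
    ring
  have hp3 : VanishesToOrder 3 (fun z : ℝ × ℝ => p z - κ * z.1) :=
    ((jp.mono (by norm_num)).add ((hs.pow 3).const_mul (c - 2 / 3 * a * κ ^ 3))).congr
      fun z => by ring
  have hσL : VanishesToOrder 1 (fun z : ℝ × ℝ => (z.1 + z.2) / L) :=
    (hσ.const_mul (1 / L)).congr fun z => by ring
  have main := chordDeriv_slope_jet hab hσL (hs.const_mul κ) hw3 hp3
    ((hs.pow 2).const_mul (a / 2 * κ ^ 2)) jg
  have hX : ∀ᶠ z in 𝓝 (0 : ℝ × ℝ), 0 < L - v z := by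
    filter_upwards [(hv2.tendsto two_ne_zero).eventually (gt_mem_nhds hL)] with z hz
    linarith
  refine ((main.sub jp).add (jw.const_mul a)).congr' ?_
  filter_upwards [hX] with z hz
  have e : chordDeriv a b L ε α β z.1 z.2 = mixedNormDeriv a b (L - v z, -Y z) (-p z, -g z) := by
    simp only [chordDeriv, hv, hY, hp, hg, sub_sub]
    rfl
  rw [e, mixedNormDeriv_eq_slope a b hz, chordCubic]
  ring

end GeneratingFunction

/-! ### The billiard relation: visibility and uniqueness of the next point. -/

section BilliardMap

/-- The data of the theorem: the weights `a`, `b` of the norm and the two arcs of the table. -/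
structure IsTable (a b L ε : ℝ) (α β : ℝ → ℝ) (κ c κ₁ c₁ : ℝ) : Prop where
  a_pos : 0 < a
  b_nonneg : 0 ≤ b
  add_eq_one : a + b = 1
  L_pos : 0 < L
  ε_pos : 0 < ε
  left : IsTableArc ε α κ c
  right : IsTableArc ε β κ₁ c₁
  lt : ∀ t ∈ Ioo (-ε) ε, α t < L - β t

variable {a b L ε κ c κ₁ c₁ s s₁ s₂ : ℝ} {α β : ℝ → ℝ}

theorem neg_mem_Ioo_neg {t : ℝ} (ht : t ∈ Ioo (-ε) ε) : -t ∈ Ioo (-ε) ε :=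
  ⟨by linarith [ht.2], by linarith [ht.1]⟩

namespace IsTable

theorem symm (h : IsTable a b L ε α β κ c κ₁ c₁) : IsTable a b L ε β α κ₁ c₁ κ c where
  a_pos := h.a_pos
  b_nonneg := h.b_nonneg
  add_eq_one := h.add_eq_one
  L_pos := h.L_pos
  ε_pos := h.ε_pos
  left := h.right
  right := h.left
  lt t ht := by linarith [h.lt t ht]

/-- A chord between the two arcs is not degenerate. -/
theorem chord_ne_zero (h : IsTable a b L ε α β κ c κ₁ c₁) {t t₁ : ℝ} (ht : t ∈ Ioo (-ε) ε) :
    ((L - α t - β t₁, -(t + t₁)) : ℝ × ℝ) ≠ 0 := by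
  intro h0
  simp only [Prod.ext_iff, Prod.fst_zero, Prod.snd_zero] at h0
  have e : t₁ = -t := by linarith [h0.2]
  have h1 := h.lt t ht
  rw [e, h.right.even t ht] at h0
  linarith [h0.1]

theorem hasDerivAt_mixedNorm_sub_arcParam (h : IsTable a b L ε α β κ c κ₁ c₁)
    (hs : s ∈ arcRange (mixedNorm a b) (leftArc α) ε) :
    HasDerivAt (fun σ => mixedNorm a b (((L, 0) - arcParam (mixedNorm a b) (leftArc β) ε s₁) -
      arcParam (mixedNorm a b) (leftArc α) ε σ)) (chordDeriv a b L ε α β s s₁) s := by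
  have hy := hasDerivAt_footParam h.a_pos h.b_nonneg h.left.smooth h.ε_pos hs
  have hx := (hasDerivAt_of_contDiffOn h.left.smooth (footParam_mem hs)).comp s hy
  set y := footParam (mixedNorm a b) α ε with hydef
  set y₁ := footParam (mixedNorm a b) β ε with hy₁def
  have h1 : HasDerivAt (fun σ => L - α (y σ) - β (y₁ s₁))
      (-(deriv α (y s) * (arcSpeed a b α (y s))⁻¹)) s :=
    (hx.const_sub L).sub_const (β (y₁ s₁))
  have h2 : HasDerivAt (fun σ => -(y σ + y₁ s₁)) (-(arcSpeed a b α (y s))⁻¹) s :=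
    (hy.add_const (y₁ s₁)).neg
  refine (h1.mixedNorm a b h2 (h.chord_ne_zero (footParam_mem hs))).congr_of_eventuallyEq
    (.of_forall fun σ => ?_)
  simp only [arcParam_leftArc, Prod.mk_sub_mk, ← hydef, ← hy₁def]
  congr 2 <;> ring

theorem contDiffAt_chordDeriv (h : IsTable a b L ε α β κ c κ₁ c₁) :
    ContDiffAt ℝ ∞ (fun z : ℝ × ℝ => chordDeriv a b L ε α β z.1 z.2) 0 := by
  have h0 : (0 : ℝ) ∈ Ioo (-ε) ε := ⟨by linarith [h.ε_pos], h.ε_pos⟩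
  have hf : ContDiffAt ℝ ∞ (fun z : ℝ × ℝ => z.1) 0 := contDiffAt_fst
  have hg : ContDiffAt ℝ ∞ (fun z : ℝ × ℝ => z.2) 0 := contDiffAt_snd
  have y0 := footParam_zero h.a_pos h.b_nonneg h.left.smooth h.ε_pos
  have y0' := footParam_zero h.a_pos h.b_nonneg h.right.smooth h.ε_pos
  have hy : ContDiffAt ℝ ∞ (fun z : ℝ × ℝ => footParam (mixedNorm a b) α ε z.1) 0 :=
    ((contDiffOn_footParam h.a_pos h.b_nonneg h.left.smooth h.ε_pos).contDiffAt
      ((isOpen_arcRange h.a_pos h.b_nonneg h.left.smooth h.ε_pos).mem_nhds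
        (zero_mem_arcRange _ α h.ε_pos))).comp (0 : ℝ × ℝ) hf
  have hy₁ : ContDiffAt ℝ ∞ (fun z : ℝ × ℝ => footParam (mixedNorm a b) β ε z.2) 0 :=
    ((contDiffOn_footParam h.a_pos h.b_nonneg h.right.smooth h.ε_pos).contDiffAt
      ((isOpen_arcRange h.a_pos h.b_nonneg h.right.smooth h.ε_pos).mem_nhds
        (zero_mem_arcRange _ β h.ε_pos))).comp (0 : ℝ × ℝ) hg
  have comp : ∀ {φ : ℝ → ℝ} {y : ℝ × ℝ → ℝ}, ContDiffOn ℝ ∞ φ (Ioo (-ε) ε) →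
      ContDiffAt ℝ ∞ y 0 → y 0 = 0 → ContDiffAt ℝ ∞ (fun z => φ (y z)) 0 := by
    intro φ y hφ hy h00
    exact (show ContDiffAt ℝ ∞ φ (y 0) by
      rw [h00]; exact hφ.contDiffAt (isOpen_Ioo.mem_nhds h0)).comp (0 : ℝ × ℝ) hy
  have hsp := (comp (contDiffOn_arcSpeed a b h.left.smooth) hy y0).inv
    (arcSpeed_pos h.a_pos h.b_nonneg _).ne'
  have hne := h.chord_ne_zero (t := footParam (mixedNorm a b) α ε 0)
    (t₁ := footParam (mixedNorm a b) β ε 0) (by rwa [y0])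
  exact ((contDiffAt_const.sub (comp h.left.smooth hy y0)).sub
    (comp h.right.smooth hy₁ y0')).mixedNormDeriv a b (hy.add hy₁).neg
    ((comp (contDiffOn_deriv_Ioo h.left.smooth) hy y0).mul hsp).neg hsp.neg hne

end IsTable

/-- The relation `BilliardStep` is invariant under point reflections. -/
theorem billiardStep_const_sub {F : ℝ × ℝ → ℝ} (hF : ∀ v, F (-v) = F v) (O : ℝ × ℝ)
    (Q : Set (ℝ × ℝ)) (c d : ℝ → ℝ × ℝ) (I J : Set ℝ) (p q : ℝ × ℝ) :
    BilliardStep F Q (fun s => O - c s) I (fun s => O - d s) J p q ↔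
      BilliardStep F {x | O - x ∈ Q} c I d J p q := by
  have hseg : ∀ x y : ℝ × ℝ, openSegment ℝ (O - x) (O - y) ⊆ Q ↔
      openSegment ℝ x y ⊆ {x | O - x ∈ Q} := by
    intro x y
    simp only [openSegment_eq_image', image_subset_iff]
    refine forall₂_congr fun θ _ => ?_
    simp only [mem_preimage, mem_ofPred_eq]
    rw [show O - x + θ • (O - y - (O - x)) = O - (x + θ • (y - x)) by module]
  have hsub : ∀ x y : ℝ × ℝ, F (O - x - (O - y)) = F (x - y) := by
    intro x y
    rw [← hF (x - y)]
    congr 1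
    abel
  simp only [BilliardStep, momentum, Reflects, hseg, hsub]

variable (a b L ε α β) in
/-- The point with the arc length parameter `s` on the right arc. -/
theorem arcParam_mixedNorm_rightArc : arcParam (mixedNorm a b) (rightArc L β) ε =
    fun s => (L, 0) - arcParam (mixedNorm a b) (leftArc β) ε s :=
  funext fun s => arcParam_rightArc (mixedNorm_neg a b) L β ε s

namespace IsTable

/-- The chord between two points on the arcs lies in the interior of the table. -/
def Sees (a b L ε : ℝ) (α β : ℝ → ℝ) (s s₁ : ℝ) : Prop :=
  openSegment ℝ (arcParam (mixedNorm a b) (leftArc α) ε s)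
    ((L, 0) - arcParam (mixedNorm a b) (leftArc β) ε s₁) ⊆ billiardTable L ε α β

/-- The reflection at (L/2, 0) sends y to -y; evenness of both arcs makes it exchange their roles.
-/
theorem billiardTable_swap (h : IsTable a b L ε α β κ c κ₁ c₁) :
    billiardTable L ε β α = {x | (L, 0) - x ∈ billiardTable L ε α β} := by
  ext ⟨x, y⟩
  simp only [billiardTable, mem_ofPred_eq, Prod.mk_sub_mk, zero_sub, abs_neg]
  refine and_congr_right fun hy => ?_
  rw [h.left.even y (abs_lt.1 hy), h.right.even y (abs_lt.1 hy)]
  constructor <;> rintro ⟨h1, h2⟩ <;> constructor <;> linarith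

/-- The billiard step from the left to the right arc in terms of the function `chordDeriv`. -/
theorem billiardStep_iff (h : IsTable a b L ε α β κ c κ₁ c₁) (p m : ℝ × ℝ) :
    BilliardStep (mixedNorm a b) (billiardTable L ε α β)
      (arcParam (mixedNorm a b) (leftArc α) ε) (arcRange (mixedNorm a b) (leftArc α) ε)
      (arcParam (mixedNorm a b) (rightArc L β) ε) (arcRange (mixedNorm a b) (rightArc L β) ε) p m ↔
    p.1 ∈ arcRange (mixedNorm a b) (leftArc α) ε ∧ m.1 ∈ arcRange (mixedNorm a b) (leftArc β) ε ∧
      Sees a b L ε α β p.1 m.1 ∧ p.2 = chordDeriv a b L ε α β p.1 m.1 ∧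
      ∃ s₂ ∈ arcRange (mixedNorm a b) (leftArc α) ε, Sees a b L ε α β s₂ m.1 ∧
        chordDeriv a b L ε β α m.1 p.1 + chordDeriv a b L ε β α m.1 s₂ = 0 ∧
        m.2 = chordDeriv a b L ε β α m.1 s₂ := by
  have flip : ∀ x y : ℝ × ℝ, mixedNorm a b (x - ((L, 0) - y)) = mixedNorm a b ((L, 0) - x - y) := by
    intro x y
    rw [← mixedNorm_neg]
    congr 1
    abel
  have flip' : ∀ x y : ℝ × ℝ, mixedNorm a b ((L, 0) - y - x) = mixedNorm a b ((L, 0) - x - y) := by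
    intro x y
    congr 1
    abel
  rw [BilliardStep, arcRange_rightArc (mixedNorm_neg a b), arcParam_mixedNorm_rightArc]
  refine and_congr_right fun hp => and_congr_right fun hm => and_congr_right fun _ =>
    and_congr ?_ <| exists_congr fun s₂ => and_congr_right fun hs₂ => and_congr ?_ <|
      and_congr ?_ ?_
  · rw [momentum, (h.hasDerivAt_mixedNorm_sub_arcParam hp).deriv]
  · rw [openSegment_symm]; rfl
  · have h1 := (h.symm.hasDerivAt_mixedNorm_sub_arcParam (s₁ := p.1) hm).add
      (h.symm.hasDerivAt_mixedNorm_sub_arcParam (s₁ := s₂) hm)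
    rw [Reflects]
    simp only [flip, flip' (arcParam (mixedNorm a b) (leftArc α) ε p.1)]
    rw [← h1.deriv]
    rfl
  · rw [momentum]
    simp only [flip]
    rw [(h.symm.hasDerivAt_mixedNorm_sub_arcParam (s₁ := s₂) hm).deriv]

/-- Reflecting the table makes the return step a step from a left to a right arc, so the analysis of
one step serves for both. -/
theorem billiardStep_swap (h : IsTable a b L ε α β κ c κ₁ c₁) (m q : ℝ × ℝ) :
    BilliardStep (mixedNorm a b) (billiardTable L ε α β)
      (arcParam (mixedNorm a b) (rightArc L β) ε) (arcRange (mixedNorm a b) (rightArc L β) ε)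
      (arcParam (mixedNorm a b) (leftArc α) ε) (arcRange (mixedNorm a b) (leftArc α) ε) m q ↔
    BilliardStep (mixedNorm a b) (billiardTable L ε β α)
      (arcParam (mixedNorm a b) (leftArc β) ε) (arcRange (mixedNorm a b) (leftArc β) ε)
      (arcParam (mixedNorm a b) (rightArc L α) ε) (arcRange (mixedNorm a b) (rightArc L α) ε)
      m q := by
  rw [h.billiardTable_swap, ← billiardStep_const_sub (mixedNorm_neg a b),
    arcRange_rightArc (mixedNorm_neg a b), arcRange_rightArc (mixedNorm_neg a b),
    arcParam_mixedNorm_rightArc, arcParam_mixedNorm_rightArc]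
  simp only [sub_sub_cancel]

/-- A function that is positive to the right of a zero has a nonnegative derivative there. -/
theorem _root_.HasDerivAt.nonneg_of_pos_right {φ : ℝ → ℝ} {m δ : ℝ} (hφ : HasDerivAt φ m 0)
    (h0 : φ 0 = 0) (hδ : 0 < δ) (hpos : ∀ θ ∈ Ioo 0 δ, 0 < φ θ) : 0 ≤ m := by
  have h := hφ.tendsto_slope.mono_left (nhdsGT_le_nhdsNE 0)
  refine ge_of_tendsto h ?_
  filter_upwards [Ioo_mem_nhdsGT hδ] with θ hθ
  rw [slope_def_field, h0, sub_zero, sub_zero]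
  exact (div_pos (hpos θ hθ) hθ.1).le

/-- Two points which are visible from the same point in the same direction coincide. -/
theorem sees_injective (h : IsTable a b L ε α β κ c κ₁ c₁)
    (hs : s ∈ arcRange (mixedNorm a b) (leftArc α) ε)
    (hs₁ : s₁ ∈ arcRange (mixedNorm a b) (leftArc β) ε)
    (hs₂ : s₂ ∈ arcRange (mixedNorm a b) (leftArc β) ε)
    (h₁ : Sees a b L ε α β s s₁) (h₂ : Sees a b L ε α β s s₂)
    (heq : chordDeriv a b L ε α β s s₁ = chordDeriv a b L ε α β s s₂)
    (hlt : |chordDeriv a b L ε α β s s₁| < 1) : s₁ = s₂ := by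
  have ht := footParam_mem hs
  have ht₁ := footParam_mem hs₁
  have ht₂ := footParam_mem hs₂
  suffices hyy : footParam (mixedNorm a b) β ε s₁ = footParam (mixedNorm a b) β ε s₂ from
    footParam_injOn hs₁ hs₂ hyy
  simp only [Sees, arcParam_leftArc, openSegment_eq_image', image_subset_iff] at h₁ h₂
  simp only [chordDeriv] at heq hlt
  generalize footParam (mixedNorm a b) α ε s = t at *
  generalize footParam (mixedNorm a b) β ε s₁ = t₁ at *
  generalize footParam (mixedNorm a b) β ε s₂ = t₂ at *
  have hF := arcSpeed_pos (α := α) h.a_pos h.b_nonneg t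
  have hda := hasDerivAt_of_contDiffOn h.left.smooth ht
  set w : ℝ × ℝ := (deriv α t, 1) with hw
  have hw0 : w ≠ 0 := by simp [hw, Prod.ext_iff]
  have hE : ∀ v : ℝ × ℝ, mixedNormDeriv a b v (-(deriv α t * (arcSpeed a b α t)⁻¹),
      -(arcSpeed a b α t)⁻¹) = -(arcSpeed a b α t)⁻¹ * mixedNormDeriv a b v w := by
    intro v
    rw [← mixedNormDeriv_smul]
    congr 1
    ext <;> simp [hw, mul_comm]
  rw [hE, hE] at heq
  rw [hE] at hlt
  have hD := mul_left_cancel₀ (neg_ne_zero.2 (inv_ne_zero hF.ne')) heq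
  have hv₁ := h.chord_ne_zero (t₁ := t₁) ht
  have hv₂ := h.chord_ne_zero (t₁ := t₂) ht
  have e : ∀ τ : ℝ, ((L, 0) - (β τ, τ) - (α t, t) : ℝ × ℝ) = (L - α t - β τ, -(t + τ)) := by
    intro τ
    ext <;> simp <;> ring
  rw [e] at h₁ h₂
  -- visible points lie on the inner side of the tangent line
  have side : ∀ v : ℝ × ℝ, (Ioo (0 : ℝ) 1 ⊆ (fun θ : ℝ => ((α t, t) : ℝ × ℝ) + θ • v) ⁻¹'
      billiardTable L ε α β) → 0 ≤ v.1 - deriv α t * v.2 := by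
    intro v hv
    have hd : HasDerivAt (fun θ : ℝ => α t + θ * v.1 - α (t + θ * v.2))
        (v.1 - deriv α t * v.2) 0 := by
      have hl : HasDerivAt (fun θ : ℝ => t + θ * v.2) v.2 0 := by
        simpa using ((hasDerivAt_id (0 : ℝ)).mul_const v.2).const_add t
      have hc : HasDerivAt (fun θ : ℝ => α (t + θ * v.2)) (deriv α t * v.2) 0 :=
        HasDerivAt.comp (0 : ℝ) (by simpa using hda) hl
      have hl' : HasDerivAt (fun θ : ℝ => α t + θ * v.1) v.1 0 := by
        simpa using ((hasDerivAt_id (0 : ℝ)).mul_const v.1).const_add (α t)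
      exact hl'.sub hc
    refine hd.nonneg_of_pos_right (by simp) one_pos fun θ hθ => ?_
    have := (hv hθ).2.1
    simp only [Prod.fst_add, Prod.snd_add, Prod.smul_fst, Prod.smul_snd, smul_eq_mul] at this
    linarith
  have tangent : ∀ v : ℝ × ℝ, v.1 - deriv α t * v.2 = 0 → v = v.2 • w := by
    intro v hv
    ext <;> simp [hw]
    linarith
  -- Equality would make the chord tangent to the arc, where |u| = 1.
  have pos : ∀ v : ℝ × ℝ, v ≠ 0 → 0 ≤ v.1 - deriv α t * v.2 →
      |-(arcSpeed a b α t)⁻¹ * mixedNormDeriv a b v w| < 1 → 0 < v.1 - deriv α t * v.2 := by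
    intro v hv0 hv hv1
    refine lt_of_le_of_ne hv fun h0 => ?_
    have hvw := tangent v h0.symm
    have hv2 : v.2 ≠ 0 := fun h2 => hv0 (by rw [hvw, h2, zero_smul])
    rw [hvw, abs_mul, abs_mixedNormDeriv_smul_self hv2 hw0, abs_neg, ← abs_mul] at hv1
    change |(arcSpeed a b α t)⁻¹ * arcSpeed a b α t| < 1 at hv1
    rw [inv_mul_cancel₀ hF.ne', abs_one] at hv1
    exact lt_irrefl _ hv1
  have n₁ := pos _ hv₁ (side _ h₁) hlt
  have n₂ := pos _ hv₂ (side _ h₂) (by rwa [hD] at hlt)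
  set v₁ : ℝ × ℝ := (L - α t - β t₁, -(t + t₁)) with hv₁def
  set v₂ : ℝ × ℝ := (L - α t - β t₂, -(t + t₂)) with hv₂def
  -- With k chosen so that v₁ - k v₂ is tangent to the arc, the derivatives of the norm at v₁ and k
  -- v₂ agree on this difference, because the momenta are equal. Strict convexity then makes the
  -- chords parallel.
  obtain ⟨m, hm, hmv⟩ : ∃ m : ℝ, 0 < m ∧ v₂ = m • v₁ := by
    set k := (v₁.1 - deriv α t * v₁.2) / (v₂.1 - deriv α t * v₂.2) with hk
    have hk0 : 0 < k := div_pos n₁ n₂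
    have hdiff := tangent (v₁ - k • v₂) (by
      have : k * (v₂.1 - deriv α t * v₂.2) = v₁.1 - deriv α t * v₁.2 := div_mul_cancel₀ _ n₂.ne'
      simp only [Prod.fst_sub, Prod.snd_sub, Prod.smul_fst, Prod.smul_snd, smul_eq_mul]
      linarith)
    obtain ⟨k', hk', hkv⟩ := exists_smul_of_mixedNormDeriv_eq h.a_pos h.b_nonneg hv₁
      (smul_ne_zero hk0.ne' hv₂) (by
        rw [hdiff, mixedNormDeriv_smul, mixedNormDeriv_smul, hD,
          mixedNormDeriv_smul_left a b hk0])
    refine ⟨k⁻¹ * k', by positivity, ?_⟩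
    rw [mul_smul, ← hkv, inv_smul_smul₀ hk0.ne']
  -- the end point of a chord does not lie in the interior of the table
  have endpoint : ∀ τ ∈ Ioo (-ε) ε,
      ((α t, t) : ℝ × ℝ) + ((L - α t - β τ, -(t + τ)) : ℝ × ℝ) ∉ billiardTable L ε α β := by
    intro τ hτ hmem
    have := hmem.2.2
    simp only [Prod.mk_add_mk] at this
    rw [show t + -(t + τ) = -τ by ring, h.right.even τ hτ] at this
    linarith
  -- If the parallel chords had different lengths, the end point of the shorter would lie inside the
  -- longer one, hence in the open table.
  rcases lt_trichotomy m 1 with h1 | h1 | h1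
  · refine absurd (h₁ ⟨hm, h1⟩) ?_
    rw [mem_preimage, ← hmv]
    exact endpoint t₂ ht₂
  · rw [h1, one_smul] at hmv
    have := congrArg Prod.snd hmv
    simp only [hv₁def, hv₂def] at this
    linarith
  · refine absurd (h₂ ⟨inv_pos.2 hm, inv_lt_one_of_one_lt₀ h1⟩) ?_
    rw [mem_preimage, hmv, inv_smul_smul₀ hm.ne']
    exact endpoint t₁ ht₁

theorem _root_.IsTableArc.exists_convexOn (hα : IsTableArc ε α κ c) (hε : 0 < ε) :
    ∃ δ > 0, δ ≤ ε ∧ ConvexOn ℝ (Ioo (-δ) δ) α := by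
  have h0 : (0 : ℝ) ∈ Ioo (-ε) ε := ⟨by linarith, hε⟩
  have hd := contDiffOn_deriv_Ioo hα.smooth
  have hcont : ContinuousAt (deriv (deriv α)) 0 :=
    ((contDiffOn_deriv_Ioo hd).contDiffAt (isOpen_Ioo.mem_nhds h0)).continuousAt
  have hval : deriv (deriv α) 0 = κ := by
    have := hα.jet₂.eq_zero (by norm_num)
    simp only [ne_eq, OfNat.ofNat_ne_zero, not_false_eq_true, zero_pow, mul_zero, add_zero] at this
    linarith
  have hev : ∀ᶠ t in 𝓝 (0 : ℝ), 0 < deriv (deriv α) t :=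
    hcont.eventually (lt_mem_nhds (by rw [hval]; exact hα.pos))
  obtain ⟨δ, hδ, hball⟩ := Metric.eventually_nhds_iff_ball.1 hev
  have hsub : Ioo (-min δ ε) (min δ ε) ⊆ Ioo (-ε) ε :=
    Ioo_subset_Ioo (neg_le_neg (min_le_right _ _)) (min_le_right _ _)
  refine ⟨min δ ε, lt_min hδ hε, min_le_right _ _, convexOn_of_deriv2_nonneg (convex_Ioo _ _)
    (hα.smooth.continuousOn.mono hsub) ?_ ?_ ?_⟩
  · rw [interior_Ioo]
    exact fun t ht =>
      (hasDerivAt_of_contDiffOn hα.smooth (hsub ht)).differentiableAt.differentiableWithinAt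
  · rw [interior_Ioo]
    exact fun t ht =>
      (hasDerivAt_of_contDiffOn hd (hsub ht)).differentiableAt.differentiableWithinAt
  · rw [interior_Ioo]
    intro t ht
    refine (hball t ?_).le
    rw [mem_ball_zero_iff, Real.norm_eq_abs]
    exact (abs_lt.2 ht).trans_le (min_le_left _ _)

/-- Both arcs are convex near the axis, so α along the chord is bounded by interpolating its values
at the ends. There α(t) is the chord's own abscissa, or α(-t₁) = α(t₁) < L - β(t₁). The right arc is
treated alike. -/
theorem eventually_sees (h : IsTable a b L ε α β κ c κ₁ c₁) :
    ∀ᶠ z in 𝓝 (0 : ℝ × ℝ), Sees a b L ε α β z.1 z.2 := by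
  obtain ⟨δ, hδ, hδε, hα⟩ := h.left.exists_convexOn h.ε_pos
  obtain ⟨δ', hδ', hδε', hβ⟩ := h.right.exists_convexOn h.ε_pos
  set η := min δ δ' with hη
  have hη0 : 0 < η := lt_min hδ hδ'
  replace hα := hα.subset (Ioo_subset_Ioo (neg_le_neg (min_le_left δ δ')) (min_le_left δ δ'))
    (convex_Ioo _ _)
  replace hβ := hβ.subset (Ioo_subset_Ioo (neg_le_neg (min_le_right δ δ')) (min_le_right δ δ'))
    (convex_Ioo _ _)
  rw [← hη] at hα hβ
  have hηε : Ioo (-η) η ⊆ Ioo (-ε) ε := by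
    have : η ≤ ε := (min_le_left _ _).trans hδε
    exact Ioo_subset_Ioo (neg_le_neg this) this
  have hnhds : Ioo (-η) η ∈ 𝓝 (0 : ℝ) := Ioo_mem_nhds (by linarith) hη0
  have cont : ∀ {γ : ℝ → ℝ} {κ c : ℝ}, IsTableArc ε γ κ c →
      ∀ᶠ s in 𝓝 (0 : ℝ), footParam (mixedNorm a b) γ ε s ∈ Ioo (-η) η := by
    intro γ κ c hγ
    have := (hasDerivAt_footParam h.a_pos h.b_nonneg hγ.smooth h.ε_pos
      (zero_mem_arcRange _ γ h.ε_pos)).continuousAt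
    refine this.eventually ?_
    rw [footParam_zero h.a_pos h.b_nonneg hγ.smooth h.ε_pos]
    exact hnhds
  filter_upwards [(cont h.left).prod_inl_nhds (0 : ℝ), (cont h.right).prod_inr_nhds (0 : ℝ)]
    with z hz₀ hz₁
  simp only [Sees, arcParam_leftArc, openSegment_eq_image, image_subset_iff]
  generalize footParam (mixedNorm a b) α ε z.1 = t at *
  generalize footParam (mixedNorm a b) β ε z.2 = t₁ at *
  rintro θ ⟨hθ0, hθ1⟩
  have hθ : (0 : ℝ) ≤ 1 - θ := by linarith
  have hn := neg_mem_Ioo_neg hz₁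
  have hY : (1 - θ) * t + θ * -t₁ ∈ Ioo (-η) η :=
    convex_Ioo (-η) η hz₀ hn hθ hθ0.le (by ring)
  have c₁ := hα.2 hz₀ hn hθ hθ0.le (by ring)
  have c₂ := hβ.2 hz₀ hn hθ hθ0.le (by ring)
  simp only [smul_eq_mul] at c₁ c₂
  rw [h.left.even _ (hηε hz₁)] at c₁
  rw [h.right.even _ (hηε hz₁)] at c₂
  have l₀ := mul_le_mul_of_nonneg_left (h.lt t (hηε hz₀)).le hθ
  have l₁ := mul_lt_mul_of_pos_left (h.lt t₁ (hηε hz₁)) hθ0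
  have l₀' := mul_lt_mul_of_pos_left (h.lt t (hηε hz₀)) (by linarith : 0 < 1 - θ)
  rw [mem_preimage]
  simp only [billiardTable, mem_ofPred_eq, Prod.smul_mk, Prod.mk_sub_mk, Prod.mk_add_mk,
    smul_eq_mul, zero_sub]
  refine ⟨abs_lt.2 (hηε hY), ?_, ?_⟩
  · linarith
  · have : (1 - θ) * L + θ * L = L := by ring
    linarith

end IsTable

/-- A version of the implicit function theorem. -/
theorem exists_implicit_function {E : ℝ × ℝ → ℝ} (hE : ContDiffAt ℝ ∞ E 0) {p q : ℝ} (hq : q ≠ 0)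
    (hjet : VanishesToOrder 2 (fun z => E z - (p * z.1 + q * z.2))) :
    ∃ S : ℝ × ℝ → ℝ, S 0 = 0 ∧ ContDiffAt ℝ ∞ S 0 ∧ ∀ᶠ z in 𝓝 0, E (z.1, S z) = z.2 := by
  have hE0 : E 0 = 0 := by simpa using hjet.eq_zero two_ne_zero
  let A : ℝ × ℝ →L[ℝ] ℝ × ℝ := (ContinuousLinearMap.fst ℝ ℝ ℝ).prod
    (p • ContinuousLinearMap.fst ℝ ℝ ℝ + q • ContinuousLinearMap.snd ℝ ℝ ℝ)
  let B : ℝ × ℝ →L[ℝ] ℝ × ℝ := (ContinuousLinearMap.fst ℝ ℝ ℝ).prod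
    (q⁻¹ • ContinuousLinearMap.snd ℝ ℝ ℝ - (q⁻¹ * p) • ContinuousLinearMap.fst ℝ ℝ ℝ)
  have hBA : ∀ z, B (A z) = z := by
    intro z
    ext
    · simp [A, B]
    · simp [A, B]; field_simp; ring
  have hAB : ∀ z, A (B z) = z := by
    intro z
    ext
    · simp [A, B]
    · simp [A, B]; field_simp; ring
  let Φ' : (ℝ × ℝ) ≃L[ℝ] ℝ × ℝ := ContinuousLinearEquiv.equivOfInverse A B hBA hAB
  let Φ : ℝ × ℝ → ℝ × ℝ := fun z => (z.1, E z)
  have hΦ : ContDiffAt ℝ ∞ Φ 0 := contDiffAt_fst.prodMk hE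
  have hd : HasFDerivAt Φ (Φ' : ℝ × ℝ →L[ℝ] ℝ × ℝ) 0 := by
    have h1 : HasFDerivAt E
        (p • ContinuousLinearMap.fst ℝ ℝ ℝ + q • ContinuousLinearMap.snd ℝ ℝ ℝ) 0 := by
      rw [hasFDerivAt_iff_isLittleO_nhds_zero]
      have : (fun z : ℝ × ℝ => ‖z‖ ^ 2) =o[𝓝 0] fun z => z := by
        simpa using (Asymptotics.isLittleO_norm_pow_id (E' := ℝ × ℝ) one_lt_two)
      refine (Asymptotics.IsBigO.congr_left hjet fun z => ?_).trans_isLittleO this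
      simp [hE0]
    exact (ContinuousLinearMap.fst ℝ ℝ ℝ).hasFDerivAt.prodMk h1
  have hΦ0 : Φ 0 = 0 := by simp [Φ, hE0]
  have hn : (∞ : WithTop ℕ∞) ≠ 0 := by simp
  set Ψ := hΦ.localInverse hd hn with hΨ
  have hstrict := hΦ.hasStrictFDerivAt' hd hn
  refine ⟨fun z => (Ψ z).2, ?_, ?_, ?_⟩
  · have := hstrict.localInverse_apply_image
    rw [hΦ0] at this
    change (Ψ 0).2 = 0
    rw [show Ψ 0 = 0 from this]; rfl
  · have := hΦ.to_localInverse hd hn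
    rw [hΦ0] at this
    exact contDiffAt_snd.comp (0 : ℝ × ℝ) this
  · have := hstrict.eventually_right_inverse
    rw [hΦ0] at this
    filter_upwards [this] with z hz
    change Φ (Ψ z) = z at hz
    have h1 : (Ψ z).1 = z.1 := (Prod.ext_iff.1 hz).1
    have h2 : E (Ψ z) = z.2 := (Prod.ext_iff.1 hz).2
    rw [← h1]
    exact h2

end BilliardMap

/-! ### The two-step map as a smooth germ. -/

section TwoStepMap

variable {a b L ε κ c κ₁ c₁ : ℝ} {α β : ℝ → ℝ}

namespace IsTable

theorem vanishesToOrder_chordCubic (a b L κ c κ₁ : ℝ) {E : Type*} [NormedAddCommGroup E]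
    {s s₁ : E → ℝ} (hs : VanishesToOrder 1 s) (hs₁ : VanishesToOrder 1 s₁) :
    VanishesToOrder 3 (fun z => chordCubic a b L κ c κ₁ (s z) (s₁ z)) := by
  have h := hs.add hs₁
  refine (((((((hs.pow 3).const_mul (-(c - 2 / 3 * a * κ ^ 3))).add
    ((hs.mul (h.pow 2)).const_mul (a / 2 * κ / L ^ 2))).sub
    ((((hs.pow 3).const_mul (κ ^ 2)).add ((hs₁.pow 3).const_mul (κ₁ ^ 2))).const_mul
      (a ^ 2 / (6 * L)))).add
    ((h.mul (((hs.pow 2).const_mul κ).add ((hs₁.pow 2).const_mul κ₁))).const_mul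
      (a / (2 * L ^ 2)))).add
    ((h.pow 3).const_mul ((b - a / 2) / L ^ 3))).sub
    (((hs.pow 2).mul h).const_mul (a ^ 2 / 2 * κ ^ 2 / L))).congr fun z => ?_
  simp only [chordCubic]
  ring

/-- The mixed second derivative a/L of the chord length is nonzero, so u = ∂H/∂s can be solved for
s₁. -/
theorem exists_next_point (h : IsTable a b L ε α β κ c κ₁ c₁) :
    ∃ S : ℝ × ℝ → ℝ, S 0 = 0 ∧ ContDiffAt ℝ ∞ S 0 ∧
      ∀ᶠ z in 𝓝 0, chordDeriv a b L ε α β z.1 (S z) = z.2 := by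
  refine exists_implicit_function h.contDiffAt_chordDeriv (p := a / L - κ) (q := a / L)
    (div_pos h.a_pos h.L_pos).ne' ?_
  have hs : VanishesToOrder 1 (fun z : ℝ × ℝ => z.1) :=
    (ContinuousLinearMap.fst ℝ ℝ ℝ).vanishesToOrder_one
  have ht : VanishesToOrder 1 (fun z : ℝ × ℝ => z.2) :=
    (ContinuousLinearMap.snd ℝ ℝ ℝ).vanishesToOrder_one
  exact (((chordDeriv_jet h.a_pos h.b_nonneg h.add_eq_one h.L_pos h.ε_pos h.left h.right).mono
    (by norm_num)).add ((vanishesToOrder_chordCubic a b L κ c κ₁ hs ht).mono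
      (by norm_num))).congr fun z => by ring

/-- The foot point `S z` of the next point of reflection, as a function of the phase point. -/
def nextPoint (h : IsTable a b L ε α β κ c κ₁ c₁) : ℝ × ℝ → ℝ := h.exists_next_point.choose

theorem nextPoint_zero (h : IsTable a b L ε α β κ c κ₁ c₁) : h.nextPoint 0 = 0 :=
  h.exists_next_point.choose_spec.1

theorem contDiffAt_nextPoint (h : IsTable a b L ε α β κ c κ₁ c₁) : ContDiffAt ℝ ∞ h.nextPoint 0 :=
  h.exists_next_point.choose_spec.2.1

theorem chordDeriv_nextPoint (h : IsTable a b L ε α β κ c κ₁ c₁) :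
    ∀ᶠ z in 𝓝 0, chordDeriv a b L ε α β z.1 (h.nextPoint z) = z.2 :=
  h.exists_next_point.choose_spec.2.2

/-- The billiard map from the left to the right arc near the period-2 orbit. -/
def stepMap (h : IsTable a b L ε α β κ c κ₁ c₁) (z : ℝ × ℝ) : ℝ × ℝ :=
  -- By the reflection law, the momentum of the outgoing chord is minus the derivative of the length
  -- of the incoming one.
  (h.nextPoint z, -chordDeriv a b L ε β α (h.nextPoint z) z.1)

theorem stepMap_zero (h : IsTable a b L ε α β κ c κ₁ c₁) : h.stepMap 0 = 0 := by
  have := (chordDeriv_jet h.a_pos h.b_nonneg h.add_eq_one h.L_pos h.ε_pos h.right h.left).eq_zero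
    (by norm_num)
  simp only [chordCubic, Prod.fst_zero, Prod.snd_zero] at this
  have e : chordDeriv a b L ε β α 0 0 = 0 := by simpa using this
  simp [stepMap, h.nextPoint_zero, e]

theorem contDiffAt_stepMap (h : IsTable a b L ε α β κ c κ₁ c₁) : ContDiffAt ℝ ∞ h.stepMap 0 := by
  refine h.contDiffAt_nextPoint.prodMk ?_
  refine ContDiffAt.neg ?_
  have h1 : ContDiffAt ℝ ∞ (fun z : ℝ × ℝ => (h.nextPoint z, z.1)) 0 :=
    h.contDiffAt_nextPoint.prodMk contDiffAt_fst
  have h2 := h.symm.contDiffAt_chordDeriv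
  rw [show (0 : ℝ × ℝ) = (h.nextPoint 0, (0 : ℝ × ℝ).1) by rw [h.nextPoint_zero]; rfl] at h2
  exact h2.comp (0 : ℝ × ℝ) h1

/-- Visibility singles out s₁ among all points of the arc, not only those near the vertex. The
reflection law fixes u₁ by the incoming chord alone, so uniqueness of the subsequent point s₂ is not
needed. -/
theorem eventually_billiardStep_iff (h : IsTable a b L ε α β κ c κ₁ c₁) :
    ∀ᶠ p in 𝓝 (0 : ℝ × ℝ), ∀ m, BilliardStep (mixedNorm a b) (billiardTable L ε α β)
      (arcParam (mixedNorm a b) (leftArc α) ε) (arcRange (mixedNorm a b) (leftArc α) ε)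
      (arcParam (mixedNorm a b) (rightArc L β) ε) (arcRange (mixedNorm a b) (rightArc L β) ε)
      p m ↔ m = h.stepMap p := by
  have tS : Tendsto h.nextPoint (𝓝 0) (𝓝 0) := by
    simpa [h.nextPoint_zero] using h.contDiffAt_nextPoint.continuousAt.tendsto
  have tG : Tendsto h.stepMap (𝓝 0) (𝓝 0) := by
    simpa [h.stepMap_zero] using h.contDiffAt_stepMap.continuousAt.tendsto
  have tS' : Tendsto h.symm.nextPoint (𝓝 0) (𝓝 0) := by
    simpa [h.symm.nextPoint_zero] using h.symm.contDiffAt_nextPoint.continuousAt.tendsto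
  have t1 : Tendsto (fun z : ℝ × ℝ => z.1) (𝓝 0) (𝓝 0) := by
    simpa using (continuous_fst (X := ℝ) (Y := ℝ)).tendsto 0
  have t2 : Tendsto (fun z : ℝ × ℝ => z.2) (𝓝 0) (𝓝 0) := by
    simpa using (continuous_snd (X := ℝ) (Y := ℝ)).tendsto 0
  have hI : arcRange (mixedNorm a b) (leftArc α) ε ∈ 𝓝 0 :=
    (isOpen_arcRange h.a_pos h.b_nonneg h.left.smooth h.ε_pos).mem_nhds
      (zero_mem_arcRange _ α h.ε_pos)
  have hJ : arcRange (mixedNorm a b) (leftArc β) ε ∈ 𝓝 0 :=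
    (isOpen_arcRange h.a_pos h.b_nonneg h.right.smooth h.ε_pos).mem_nhds
      (zero_mem_arcRange _ β h.ε_pos)
  have tU : Tendsto (fun z => h.symm.nextPoint (h.stepMap z)) (𝓝 0) (𝓝 0) := tS'.comp tG
  have v1 : ∀ᶠ z in 𝓝 (0 : ℝ × ℝ), Sees a b L ε α β z.1 (h.nextPoint z) :=
    (t1.prodMk_nhds tS).eventually h.eventually_sees
  have v2 : ∀ᶠ z in 𝓝 (0 : ℝ × ℝ),
      Sees a b L ε α β (h.symm.nextPoint (h.stepMap z)) (h.nextPoint z) :=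
    (tU.prodMk_nhds tS).eventually h.eventually_sees
  have hlt : ∀ᶠ z in 𝓝 (0 : ℝ × ℝ), |z.2| < 1 :=
    t2.eventually ((continuous_abs.tendsto (0 : ℝ)).eventually
      (gt_mem_nhds (by rw [abs_zero]; exact one_pos)))
  filter_upwards [t1.eventually hI, tS.eventually hJ, tU.eventually hI, v1, v2, hlt,
    h.chordDeriv_nextPoint, tG.eventually h.symm.chordDeriv_nextPoint]
    with p hp hS hU hv1 hv2 hp2 he he2 m
  rw [h.billiardStep_iff]
  constructor
  · rintro ⟨-, hm, hv, hpE, s₂, hs₂, -, hrefl, hm2⟩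
    have h1 : m.1 = h.nextPoint p :=
      h.sees_injective hp hm hS hv hv1 (by rw [← hpE, he]) (by rwa [← hpE])
    refine Prod.ext h1 ?_
    rw [stepMap, hm2, ← h1]
    linarith
  · rintro rfl
    refine ⟨hp, hS, hv1, he.symm, _, hU, hv2, ?_, ?_⟩
    · rw [he2]
      exact add_neg_cancel _
    · exact he2.symm

/-- The two-step billiard map near the period-2 orbit. -/
def twoStepMap (h : IsTable a b L ε α β κ c κ₁ c₁) (z : ℝ × ℝ) : ℝ × ℝ :=
  h.symm.stepMap (h.stepMap z)

theorem twoStepMap_zero (h : IsTable a b L ε α β κ c κ₁ c₁) : h.twoStepMap 0 = 0 := by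
  rw [twoStepMap, h.stepMap_zero, h.symm.stepMap_zero]

theorem contDiffAt_twoStepMap (h : IsTable a b L ε α β κ c κ₁ c₁) :
    ContDiffAt ℝ ∞ h.twoStepMap 0 :=
  ContDiffAt.comp (0 : ℝ × ℝ) (by rw [h.stepMap_zero]; exact h.symm.contDiffAt_stepMap)
    h.contDiffAt_stepMap

theorem eventually_twoStep_iff (h : IsTable a b L ε α β κ c κ₁ c₁) :
    ∀ᶠ p in 𝓝 (0 : ℝ × ℝ), ∀ q, TwoStep (mixedNorm a b) L ε α β p q ↔ q = h.twoStepMap p := by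
  have tG : Tendsto h.stepMap (𝓝 0) (𝓝 0) := by
    simpa [h.stepMap_zero] using h.contDiffAt_stepMap.continuousAt.tendsto
  filter_upwards [h.eventually_billiardStep_iff,
    tG.eventually h.symm.eventually_billiardStep_iff] with p h1 h2 q
  simp only [TwoStep, h1, h.billiardStep_swap, exists_eq_left, h2, twoStepMap]

end IsTable

end TwoStepMap

/-! ### From a quartic generating function to the jet of the two-step map. -/

section GeneratingQuartic

variable {E : Type*} [NormedAddCommGroup E]

theorem vanishesToOrder_quarticField (k : Fin 5 → ℝ) {z : E → ℝ × ℝ} (hz : VanishesToOrder 1 z) :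
    VanishesToOrder 3 (fun e => quarticField k (z e)) := by
  have h1 : VanishesToOrder 1 (fun e => (z e).1) :=
    (ContinuousLinearMap.fst ℝ ℝ ℝ).vanishesToOrder_comp hz
  have h2 : VanishesToOrder 1 (fun e => (z e).2) :=
    (ContinuousLinearMap.snd ℝ ℝ ℝ).vanishesToOrder_comp hz
  have aux : ∀ e₀ e₁ e₂ e₃ : ℝ, VanishesToOrder 3 (fun e => e₀ * (z e).1 ^ 3 +
      e₁ * ((z e).1 ^ 2 * (z e).2) + e₂ * ((z e).1 * (z e).2 ^ 2) + e₃ * (z e).2 ^ 3) :=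
    fun e₀ e₁ e₂ e₃ => ((((h1.pow 3).const_mul e₀).add (((h1.pow 2).mul h2).const_mul e₁)).add
      ((h1.mul (h2.pow 2)).const_mul e₂)).add ((h2.pow 3).const_mul e₃)
  refine VanishesToOrder.prodMk ?_ ?_
  · exact (aux (k 1) (2 * k 2) (3 * k 3) (4 * k 4)).congr fun e => by ring
  · exact (aux (4 * k 0) (3 * k 1) (2 * k 2) (k 3)).neg.congr fun e => by ring

theorem vanishesToOrder_quarticField_sub (k : Fin 5 → ℝ) {z w : E → ℝ × ℝ}
    (hz : VanishesToOrder 1 z) (hw : VanishesToOrder 1 w)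
    (hzw : VanishesToOrder 2 (fun e => z e - w e)) :
    VanishesToOrder 4 (fun e => quarticField k (z e) - quarticField k (w e)) := by
  have h1 : VanishesToOrder 1 (fun e => (z e).1) :=
    (ContinuousLinearMap.fst ℝ ℝ ℝ).vanishesToOrder_comp hz
  have h2 : VanishesToOrder 1 (fun e => (z e).2) :=
    (ContinuousLinearMap.snd ℝ ℝ ℝ).vanishesToOrder_comp hz
  have g1 : VanishesToOrder 1 (fun e => (w e).1) :=
    (ContinuousLinearMap.fst ℝ ℝ ℝ).vanishesToOrder_comp hw
  have g2 : VanishesToOrder 1 (fun e => (w e).2) :=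
    (ContinuousLinearMap.snd ℝ ℝ ℝ).vanishesToOrder_comp hw
  have d1 : VanishesToOrder 2 (fun e => (z e).1 - (w e).1) :=
    (ContinuousLinearMap.fst ℝ ℝ ℝ).vanishesToOrder_comp hzw
  have d2 : VanishesToOrder 2 (fun e => (z e).2 - (w e).2) :=
    (ContinuousLinearMap.snd ℝ ℝ ℝ).vanishesToOrder_comp hzw
  have aux : ∀ e₀ e₁ e₂ e₃ : ℝ, VanishesToOrder 4 (fun e => (e₀ * (z e).1 ^ 3 +
      e₁ * ((z e).1 ^ 2 * (z e).2) + e₂ * ((z e).1 * (z e).2 ^ 2) + e₃ * (z e).2 ^ 3) -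
      (e₀ * (w e).1 ^ 3 +
      e₁ * ((w e).1 ^ 2 * (w e).2) + e₂ * ((w e).1 * (w e).2 ^ 2) + e₃ * (w e).2 ^ 3)) := by
    intro e₀ e₁ e₂ e₃
    have hq1 := (h1.pow 2).add ((h1.mul g1).add (g1.pow 2))
    have hq2 := (h2.pow 2).add ((h2.mul g2).add (g2.pow 2))
    refine (((((d1.mul hq1).const_mul e₀).add
      ((d1.mul ((h1.add g1).mul h2)).const_mul e₁)).add (((d2.mul (g1.pow 2)).const_mul e₁).add
      ((d1.mul (h2.pow 2)).const_mul e₂))).add (((d2.mul ((h2.add g2).mul g1)).const_mul e₂).add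
      ((d2.mul hq2).const_mul e₃))).congr fun e => by ring
  refine VanishesToOrder.prodMk (f := fun e => (quarticField k (z e)).1 - (quarticField k (w e)).1)
    (g := fun e => (quarticField k (z e)).2 - (quarticField k (w e)).2) ?_ ?_
  · exact (aux (k 1) (2 * k 2) (3 * k 3) (4 * k 4)).congr fun e => by
      simp only [quarticField]; ring
  · exact (aux (4 * k 0) (3 * k 1) (2 * k 2) (k 3)).neg.congr fun e => by
      simp only [quarticField]; ring

/-- The coefficients of the quartic form `∑ P i * x ^ (4 - i) * y ^ i` after the substitution
`x = m s + n u`, `y = m' s + n' u`. -/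
def quarticSubst (P : Fin 5 → ℝ) (m n m' n' : ℝ) : Fin 5 → ℝ :=
  ![P 0 * m ^ 4 + P 1 * m ^ 3 * m' + P 2 * m ^ 2 * m' ^ 2 + P 3 * m * m' ^ 3 + P 4 * m' ^ 4,
    4 * P 0 * m ^ 3 * n + P 1 * (3 * m ^ 2 * n * m' + m ^ 3 * n') +
      P 2 * (2 * m * n * m' ^ 2 + 2 * m ^ 2 * m' * n') +
      P 3 * (n * m' ^ 3 + 3 * m * m' ^ 2 * n') + 4 * P 4 * m' ^ 3 * n',
    6 * P 0 * m ^ 2 * n ^ 2 + P 1 * (3 * m * n ^ 2 * m' + 3 * m ^ 2 * n * n') +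
      P 2 * (n ^ 2 * m' ^ 2 + 4 * m * n * m' * n' + m ^ 2 * n' ^ 2) +
      P 3 * (3 * n * m' ^ 2 * n' + 3 * m * m' * n' ^ 2) + 6 * P 4 * m' ^ 2 * n' ^ 2,
    4 * P 0 * m * n ^ 3 + P 1 * (n ^ 3 * m' + 3 * m * n ^ 2 * n') +
      P 2 * (2 * n ^ 2 * m' * n' + 2 * m * n * n' ^ 2) +
      P 3 * (3 * n * m' * n' ^ 2 + m * n' ^ 3) + 4 * P 4 * m' * n' ^ 3,
    P 0 * n ^ 4 + P 1 * n ^ 3 * n' + P 2 * n ^ 2 * n' ^ 2 + P 3 * n * n' ^ 3 + P 4 * n' ^ 4]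

/-- The chain rule for the gradient of a quartic form. -/
theorem quarticField_quarticSubst (P : Fin 5 → ℝ) (m n m' n' : ℝ) (z : ℝ × ℝ) :
    quarticField (quarticSubst P m n m' n') z =
      (n' * (quarticField P (m * z.1 + n * z.2, m' * z.1 + n' * z.2)).1 -
        n * (quarticField P (m * z.1 + n * z.2, m' * z.1 + n' * z.2)).2,
      -m' * (quarticField P (m * z.1 + n * z.2, m' * z.1 + n' * z.2)).1 +
        m * (quarticField P (m * z.1 + n * z.2, m' * z.1 + n' * z.2)).2) := by
  simp only [quarticField, quarticSubst, Matrix.cons_val_zero, Matrix.cons_val_one,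
    Matrix.cons_val]
  ext <;> ring

theorem quarticField_add (k k' : Fin 5 → ℝ) (z : ℝ × ℝ) :
    quarticField (k + k') z = quarticField k z + quarticField k' z := by
  simp only [quarticField, Pi.add_apply]
  ext <;> simp <;> ring

/-- The jet of a two-step map with the generating function
`g₂₀/2 s² + g₁₁ s s₁ + g₀₂/2 s₁² + ∑ P i * s ^ (4 - i) * s₁ ^ i`. -/
theorem quartic_jet_of_generating {s₁ s₂ u₂ : ℝ × ℝ → ℝ} {g₂₀ g₁₁ g₀₂ : ℝ} {P : Fin 5 → ℝ}
    (hg : g₁₁ ≠ 0) (hs₁ : VanishesToOrder 1 s₁) (hs₂ : VanishesToOrder 1 s₂)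
    (hA : VanishesToOrder 4 (fun z => z.2 -
      (g₂₀ * z.1 + g₁₁ * s₁ z - (quarticField P (z.1, s₁ z)).2)))
    (hB : VanishesToOrder 4 (fun z => g₁₁ * (z.1 + s₂ z) + 2 * g₀₂ * s₁ z +
      (quarticField P (z.1, s₁ z)).1 + (quarticField P (s₂ z, s₁ z)).1))
    (hC : VanishesToOrder 4 (fun z => u₂ z +
      (g₂₀ * s₂ z + g₁₁ * s₁ z - (quarticField P (s₂ z, s₁ z)).2)))
    {p q r : ℝ} (hp : p = 2 * (g₂₀ / g₁₁) * (g₀₂ / g₁₁) - 1) (hq : q = -2 * (g₀₂ / g₁₁) / g₁₁)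
    (hr : r = -2 * (g₂₀ / g₁₁) * ((g₂₀ / g₁₁) * (g₀₂ / g₁₁) - 1) * g₁₁) {k : Fin 5 → ℝ}
    (hk : k = quarticSubst P 1 0 (-(g₂₀ / g₁₁)) (1 / g₁₁) +
      quarticSubst P p q (-(g₂₀ / g₁₁)) (1 / g₁₁)) :
    VanishesToOrder 4 (fun z => (s₂ z, u₂ z) -
      (p * (z.1 + (quarticField k z).1) + q * (z.2 + (quarticField k z).2),
        r * (z.1 + (quarticField k z).1) + p * (z.2 + (quarticField k z).2))) := by
  have hs : VanishesToOrder 1 (fun z : ℝ × ℝ => z.1) :=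
    (ContinuousLinearMap.fst ℝ ℝ ℝ).vanishesToOrder_one
  have hu : VanishesToOrder 1 (fun z : ℝ × ℝ => z.2) :=
    (ContinuousLinearMap.snd ℝ ℝ ℝ).vanishesToOrder_one
  -- `l₁` and `l₂` are the linear parts of `s₁` and `s₂`. The errors have order three, so the linear
  -- orbit may be inserted into the cubic terms.
  set l₁ : ℝ × ℝ → ℝ := fun z => -(g₂₀ / g₁₁) * z.1 + 1 / g₁₁ * z.2 with hl₁
  set l₂ : ℝ × ℝ → ℝ := fun z => p * z.1 + q * z.2 with hl₂
  have ol₁ : VanishesToOrder 1 l₁ := (hs.const_mul _).add (hu.const_mul _)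
  have ol₂ : VanishesToOrder 1 l₂ := (hs.const_mul _).add (hu.const_mul _)
  have fst : ∀ {n} {v : ℝ × ℝ → ℝ × ℝ}, VanishesToOrder n v → VanishesToOrder n fun z => (v z).1 :=
    fun h => (ContinuousLinearMap.fst ℝ ℝ ℝ).vanishesToOrder_comp h
  have snd : ∀ {n} {v : ℝ × ℝ → ℝ × ℝ}, VanishesToOrder n v → VanishesToOrder n fun z => (v z).2 :=
    fun h => (ContinuousLinearMap.snd ℝ ℝ ℝ).vanishesToOrder_comp h
  have f0 := vanishesToOrder_quarticField P (hs.prodMk hs₁)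
  have f2 := vanishesToOrder_quarticField P (hs₂.prodMk hs₁)
  have d₁ : VanishesToOrder 3 (fun z => s₁ z - l₁ z) := by
    refine (((hA.mono (by norm_num)).sub (snd f0)).const_mul (-(1 / g₁₁))).congr fun z => ?_
    simp only [hl₁]
    field_simp
    ring
  have d₂ : VanishesToOrder 3 (fun z => s₂ z - l₂ z) := by
    refine ((((hB.mono (by norm_num)).sub (fst f0)).sub (fst f2)).const_mul (1 / g₁₁) |>.sub
      (d₁.const_mul (2 * (g₀₂ / g₁₁)))).congr fun z => ?_
    simp only [hl₁, hl₂, hp, hq]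
    field_simp
    ring
  have e0 := vanishesToOrder_quarticField_sub P (hs.prodMk hs₁) (hs.prodMk ol₁)
    ((((hs.sub hs).mul hs).prodMk (d₁.mono (by norm_num))).congr fun z => by simp)
  have e2 := vanishesToOrder_quarticField_sub P (hs₂.prodMk hs₁) (ol₂.prodMk ol₁)
    ((d₂.prodMk d₁).mono (by norm_num))
  have m₁ : VanishesToOrder 4 (fun z => s₁ z -
      (l₁ z + 1 / g₁₁ * (quarticField P (z.1, l₁ z)).2)) := by
    refine ((hA.sub (snd e0)).const_mul (-(1 / g₁₁))).congr fun z => ?_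
    simp only [hl₁, Prod.snd_sub]
    field_simp
    ring
  have m₂ : VanishesToOrder 4 (fun z => s₂ z - (l₂ z - 2 * (g₀₂ / g₁₁) / g₁₁ *
      (quarticField P (z.1, l₁ z)).2 - 1 / g₁₁ * (quarticField P (z.1, l₁ z)).1 -
      1 / g₁₁ * (quarticField P (l₂ z, l₁ z)).1)) := by
    refine ((((hB.sub (fst e0)).sub (fst e2)).const_mul (1 / g₁₁)).sub
      (m₁.const_mul (2 * (g₀₂ / g₁₁)))).congr fun z => ?_
    simp only [hl₁, hl₂, hp, hq, Prod.fst_sub]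
    field_simp
    ring
  -- `k` is the quartic form P(s, l₁) + P(l₂, l₁), the sum over the two chords of the linear orbit;
  -- its field is computed by the chain rule.
  have hk' : ∀ z, quarticField k z =
      (1 / g₁₁ * (quarticField P (z.1, l₁ z)).1 + (1 / g₁₁ * (quarticField P (l₂ z, l₁ z)).1 -
        q * (quarticField P (l₂ z, l₁ z)).2),
      g₂₀ / g₁₁ * (quarticField P (z.1, l₁ z)).1 + (quarticField P (z.1, l₁ z)).2 +
        (g₂₀ / g₁₁ * (quarticField P (l₂ z, l₁ z)).1 + p * (quarticField P (l₂ z, l₁ z)).2)) := by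
    intro z
    rw [hk, quarticField_add, quarticField_quarticSubst, quarticField_quarticSubst]
    ext <;> simp [hl₁, hl₂]
  refine VanishesToOrder.prodMk (f := fun z => s₂ z -
    (p * (z.1 + (quarticField k z).1) + q * (z.2 + (quarticField k z).2)))
    (g := fun z => u₂ z -
    (r * (z.1 + (quarticField k z).1) + p * (z.2 + (quarticField k z).2))) ?_ ?_
  · refine m₂.congr fun z => ?_
    simp only [hk', hl₂, hp, hq]
    generalize quarticField P _ = v
    generalize quarticField P _ = w
    field_simp
    ring
  · refine (((hC.sub (m₂.const_mul g₂₀)).sub (m₁.const_mul g₁₁)).add (snd e2)).congr fun z => ?_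
    simp only [hk', hl₁, hl₂, hp, hq, hr, Prod.snd_sub]
    generalize quarticField P _ = v
    generalize quarticField P _ = w
    generalize quarticField P _ = v'
    field_simp
    ring

end GeneratingQuartic

/-! ### The explicit formula for the twist coefficient. -/

section TwistCoefficient

/-- The coefficients of the quartic part of the generating function of the billiard map. -/
def chordQuartic (a b L κ c κ₁ c₁ : ℝ) : Fin 5 → ℝ :=
  ![-(c / 4 - a * κ ^ 3 / 6) + a / (4 * L ^ 2) * κ - a ^ 2 / (6 * L) * κ ^ 2 +
      (b / 4 - a / 8) / L ^ 3,
    2 * (a / (4 * L ^ 2)) * κ - a ^ 2 / (6 * L) * κ ^ 2 + 4 * ((b / 4 - a / 8) / L ^ 3),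
    a / (4 * L ^ 2) * (κ + κ₁) + 6 * ((b / 4 - a / 8) / L ^ 3),
    2 * (a / (4 * L ^ 2)) * κ₁ - a ^ 2 / (6 * L) * κ₁ ^ 2 + 4 * ((b / 4 - a / 8) / L ^ 3),
    -(c₁ / 4 - a * κ₁ ^ 3 / 6) + a / (4 * L ^ 2) * κ₁ - a ^ 2 / (6 * L) * κ₁ ^ 2 +
      (b / 4 - a / 8) / L ^ 3]

/-- The cubic parts of the momenta at both ends are the partial derivatives of one quartic form, the
quartic part of the chord length. -/
theorem quarticField_chordQuartic (a b κ c κ₁ c₁ s s₁ : ℝ) {L : ℝ} (hL : L ≠ 0) :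
    quarticField (chordQuartic a b L κ c κ₁ c₁) (s, s₁) =
      (chordCubic a b L κ₁ c₁ κ s₁ s, -chordCubic a b L κ c κ₁ s s₁) := by
  simp only [quarticField, chordQuartic, chordCubic, Matrix.cons_val_zero, Matrix.cons_val_one,
    Matrix.cons_val]
  ext
  · field_simp
    ring
  · field_simp
    ring

/-- The twist coefficient in terms of the generating function. -/
theorem twist_of_generating {g X Y p q r : ℝ} (hg : g ≠ 0) (hX : X ≠ 0) (hY : Y ≠ 0)
    (hXY : X * Y - 1 ≠ 0) (P : Fin 5 → ℝ) (hp : p = 2 * X * Y - 1) (hq : q = -2 * Y / g)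
    (hr : r = -2 * X * (X * Y - 1) * g) {k : Fin 5 → ℝ}
    (hk : k = quarticSubst P 1 0 (-X) (1 / g) + quarticSubst P p q (-X) (1 / g)) :
    -(3 * k 0 * (-q / r) + k 2 + 3 * k 4 * (-r / q)) / 2 =
      (3 * P 0 * Y / X - 3 * P 1 * Y + P 2 * (1 + 2 * X * Y) - 3 * P 3 * X + 3 * P 4 * X / Y) /
        (g ^ 2 * (X * Y - 1)) := by
  have h1 : -q / r = -Y / (X * (X * Y - 1) * g ^ 2) := by
    rw [hq, hr]
    field_simp
  have h2 : -r / q = -X * (X * Y - 1) * g ^ 2 / Y := by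
    rw [hq, hr]
    field_simp
  rw [h1, h2]
  simp only [hk, quarticSubst, Pi.add_apply, Matrix.cons_val_zero, Matrix.cons_val]
  generalize P 0 = P₀
  generalize P 1 = P₁
  generalize P 2 = P₂
  generalize P 3 = P₃
  generalize P 4 = P₄
  subst hp hq
  field_simp
  ring

theorem twist_chordQuartic {a b L R₀ R₁ S₀ S₁ : ℝ} (ha : a ≠ 0) (hab : a + b = 1) (hL : L ≠ 0)
    (hR₀ : R₀ ≠ 0) (hR₁ : R₁ ≠ 0) (h₀ : L - a * R₀ ≠ 0) (h₁ : L - a * R₁ ≠ 0)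
    (h₂ : L - a * (R₀ + R₁) ≠ 0) {P : Fin 5 → ℝ} {X Y c c₁ : ℝ}
    (hX : X = 1 - L / (a * R₀)) (hY : Y = 1 - L / (a * R₁))
    (hc : c = (3 * R₀⁻¹ - S₀) * R₀⁻¹ ^ 2 / 6) (hc₁ : c₁ = (3 * R₁⁻¹ - S₁) * R₁⁻¹ ^ 2 / 6)
    (hP : P = chordQuartic a b L R₀⁻¹ c R₁⁻¹ c₁) :
    (3 * P 0 * Y / X - 3 * P 1 * Y + P 2 * (1 + 2 * X * Y) - 3 * P 3 * X + 3 * P 4 * X / Y) /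
        ((a / L) ^ 2 * (X * Y - 1)) = twistNumerator a L R₀ R₁ S₀ S₁ /
      (8 * a ^ 2 * R₀ * R₁ * (L - a * R₀) * (L - a * R₁) * (L - a * (R₀ + R₁))) := by
  have hX' : X = -(L - a * R₀) / (a * R₀) := by rw [hX]; field_simp; ring
  have hY' : Y = -(L - a * R₁) / (a * R₁) := by rw [hY]; field_simp; ring
  have hXY : X * Y - 1 = L * (L - a * (R₀ + R₁)) / (a ^ 2 * R₀ * R₁) := by
    rw [hX', hY']; field_simp; ring
  obtain rfl : b = 1 - a := by linarith
  have e1 : Y / X = (L - a * R₁) * R₀ / ((L - a * R₀) * R₁) := by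
    rw [hX', hY']; field_simp
  have e2 : X / Y = (L - a * R₀) * R₁ / ((L - a * R₁) * R₀) := by
    rw [hX', hY']; field_simp
  rw [mul_div_assoc, mul_div_assoc _ X Y, e1, e2, hXY, hX', hY', hP]
  simp only [chordQuartic, Matrix.cons_val_zero, Matrix.cons_val_one, Matrix.cons_val, hc, hc₁]
  rw [twistNumerator]
  -- Named factors let the denominators be cleared without expansion; they are substituted back for
  -- the polynomial identity.
  generalize hd₀ : L - a * R₀ = d₀ at *
  generalize hd₁ : L - a * R₁ = d₁ at *
  generalize hd₂ : L - a * (R₀ + R₁) = d₂ at *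
  field_simp
  obtain rfl : d₂ = d₀ + d₁ - L := by rw [← hd₀, ← hd₁, ← hd₂]; ring
  obtain rfl := hd₀
  obtain rfl := hd₁
  ring

end TwistCoefficient

/-! ### Eigenvalues of the linear part. -/

section Multipliers

variable {f : ℝ × ℝ → ℝ × ℝ} {p q r : ℝ}

theorem mem_multipliers_iff (hf : VanishesToOrder 2 (fun z => f z -
    (p * z.1 + q * z.2, r * z.1 + p * z.2))) (hdet : p ^ 2 - q * r = 1) (μ : ℂ) :
    μ ∈ multipliers f 0 ↔ μ ^ 2 - 2 * p * μ + 1 = 0 := by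
  let A : ℝ × ℝ →L[ℝ] ℝ × ℝ :=
    (p • ContinuousLinearMap.fst ℝ ℝ ℝ + q • ContinuousLinearMap.snd ℝ ℝ ℝ).prod
      (r • ContinuousLinearMap.fst ℝ ℝ ℝ + p • ContinuousLinearMap.snd ℝ ℝ ℝ)
  have hf0 : f 0 = 0 := by simpa [← Prod.zero_eq_mk] using hf.eq_zero two_ne_zero
  have hA : HasFDerivAt f A 0 := by
    rw [hasFDerivAt_iff_isLittleO_nhds_zero]
    have : (fun z : ℝ × ℝ => ‖z‖ ^ 2) =o[𝓝 0] fun z => z := by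
      simpa using (Asymptotics.isLittleO_norm_pow_id (E' := ℝ × ℝ) one_lt_two)
    refine (Asymptotics.IsBigO.congr_left hf fun z => ?_).trans_isLittleO this
    simp [A, hf0]
  have hM : LinearMap.toMatrix (Module.Basis.finTwoProd ℝ) (Module.Basis.finTwoProd ℝ)
      (A : ℝ × ℝ →ₗ[ℝ] ℝ × ℝ) = !![p, q; r, p] := by
    ext i j
    fin_cases i <;> fin_cases j <;> simp [LinearMap.toMatrix_apply, A]
  rw [multipliers, mem_ofPred_eq, hA.fderiv, hM, Matrix.charpoly_fin_two, Polynomial.IsRoot]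
  have hdet' : (p : ℂ) * p - q * r = 1 := by
    rw [← sq]; exact_mod_cast hdet
  simp [Matrix.trace_fin_two, Matrix.det_fin_two, hdet']
  ring_nf

/-- If p² ≥ 1, the characteristic polynomial μ² - 2pμ + 1 has a real root, and a real number of
modulus one is ±1. -/
theorem sq_lt_one_of_isEllipticFixedPoint (hf : VanishesToOrder 2 (fun z => f z -
    (p * z.1 + q * z.2, r * z.1 + p * z.2))) (hdet : p ^ 2 - q * r = 1)
    (h : IsEllipticFixedPoint f 0) : p ^ 2 < 1 := by
  by_contra! hp
  set x := p + √(p ^ 2 - 1) with hx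
  have hsq : √(p ^ 2 - 1) ^ 2 = p ^ 2 - 1 := Real.sq_sqrt (by linarith)
  have hroot : x ^ 2 - 2 * p * x + 1 = 0 := by rw [hx]; linear_combination hsq
  obtain ⟨h1, h2, h3⟩ := h.2 (x : ℂ) ((mem_multipliers_iff hf hdet _).2 (by exact_mod_cast hroot))
  rw [Complex.norm_real, Real.norm_eq_abs] at h1
  rcases eq_or_eq_neg_of_abs_eq h1 with h4 | h4
  · exact h2 (by rw [h4]; norm_num)
  · exact h3 (by rw [h4]; norm_num)

theorem ne_zero_of_multipliers_pow_four_ne_one (hf : VanishesToOrder 2 (fun z => f z -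
    (p * z.1 + q * z.2, r * z.1 + p * z.2))) (hdet : p ^ 2 - q * r = 1)
    (h : ∀ μ ∈ multipliers f 0, μ ^ 4 ≠ 1) : p ≠ 0 := by
  rintro rfl
  exact h Complex.I ((mem_multipliers_iff hf hdet _).2 (by simp)) Complex.I_pow_four

end Multipliers

/-! ### Jet of the two-step billiard map and conclusion. -/

namespace IsTable

variable {a b L ε κ c κ₁ c₁ : ℝ} {α β : ℝ → ℝ}

/-- X and Y are the pure second derivatives of the chord length divided by the mixed one, g. The
three equations fed into `quartic_jet_of_generating` are the initial momentum, the reflection law at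
s₁, and the final momentum. -/
theorem twoStepMap_jet (h : IsTable a b L ε α β κ c κ₁ c₁) {g X Y p q r : ℝ} {k : Fin 5 → ℝ}
    (hg : g = a / L) (hX : X = (a / L - κ) / g) (hY : Y = (a / L - κ₁) / g)
    (hp : p = 2 * X * Y - 1) (hq : q = -2 * Y / g) (hr : r = -2 * X * (X * Y - 1) * g)
    (hk : k = quarticSubst (chordQuartic a b L κ c κ₁ c₁) 1 0 (-X) (1 / g) +
      quarticSubst (chordQuartic a b L κ c κ₁ c₁) p q (-X) (1 / g)) :
    VanishesToOrder 4 (fun z => h.twoStepMap z -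
      (p * (z.1 + (quarticField k z).1) + q * (z.2 + (quarticField k z).2),
        r * (z.1 + (quarticField k z).1) + p * (z.2 + (quarticField k z).2))) := by
  have hn : (∞ : WithTop ℕ∞) ≠ 0 := by simp
  have hs : VanishesToOrder 1 (fun z : ℝ × ℝ => z.1) :=
    (ContinuousLinearMap.fst ℝ ℝ ℝ).vanishesToOrder_one
  have hm : VanishesToOrder 1 h.stepMap := h.contDiffAt_stepMap.vanishesToOrder_one hn h.stepMap_zero
  have hs₁ : VanishesToOrder 1 h.nextPoint :=
    h.contDiffAt_nextPoint.vanishesToOrder_one hn h.nextPoint_zero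
  have hs₂ : VanishesToOrder 1 (fun z => h.symm.nextPoint (h.stepMap z)) :=
    (h.symm.contDiffAt_nextPoint.vanishesToOrder_one hn h.symm.nextPoint_zero).comp' hm
  have jE := chordDeriv_jet h.a_pos h.b_nonneg h.add_eq_one h.L_pos h.ε_pos h.left h.right
  have jE' := chordDeriv_jet h.a_pos h.b_nonneg h.add_eq_one h.L_pos h.ε_pos h.right h.left
  have hg0 : g ≠ 0 := by rw [hg]; exact (div_pos h.a_pos h.L_pos).ne'
  refine quartic_jet_of_generating (P := chordQuartic a b L κ c κ₁ c₁) (g₂₀ := a / L - κ)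
    (g₀₂ := a / L - κ₁) hg0 hs₁ hs₂ ?_ ?_ ?_ (by rw [hp, hX, hY]) (by rw [hq, hY])
    (by rw [hr, hX, hY]) (by rw [hk, hX])
  · refine (jE.comp' (hs.prodMk hs₁)).congr' ?_
    filter_upwards [h.chordDeriv_nextPoint] with z hz
    simp only [hz, quarticField_chordQuartic _ _ _ _ _ _ _ _ h.L_pos.ne', hg]
    ring
  · refine ((jE'.comp' (hs₁.prodMk hs)).add (jE'.comp' (hs₁.prodMk hs₂))).neg.congr' ?_
    filter_upwards [(hm.tendsto one_ne_zero).eventually h.symm.chordDeriv_nextPoint] with z hz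
    have hz' : chordDeriv a b L ε β α (h.nextPoint z) (h.symm.nextPoint (h.stepMap z)) =
        -chordDeriv a b L ε β α (h.nextPoint z) z.1 := hz
    simp only [hz', quarticField_chordQuartic _ _ _ _ _ _ _ _ h.L_pos.ne', hg]
    ring
  · refine (jE.comp' (hs₂.prodMk hs₁)).neg.congr fun z => ?_
    simp only [quarticField_chordQuartic _ _ _ _ _ _ _ _ h.L_pos.ne', hg, stepMap]
    ring

end IsTable

/-- The relations R = 1/κ and R'' = 3κ - 6c/κ² are solved for κ and c. -/
theorem exists_isTableArc {a b ε : ℝ} {α : ℝ → ℝ} (ha : 0 < a) (hb : 0 ≤ b) (hab : a + b = 1)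
    (hε : 0 < ε) (hα : ContDiffOn ℝ ∞ α (Ioo (-ε) ε)) (hα0 : α 0 = 0)
    (heven : ∀ t ∈ Ioo (-ε) ε, α (-t) = α t) {R S : ℝ}
    (hR : R = curvatureRadius (arcParam (mixedNorm a b) (leftArc α) ε) 0)
    (hS : S = iteratedDeriv 2 (curvatureRadius (arcParam (mixedNorm a b) (leftArc α) ε)) 0)
    (hpos : 0 < R) : IsTableArc ε α R⁻¹ ((3 * R⁻¹ - S) * R⁻¹ ^ 2 / 6) := by
  obtain ⟨κ, c, j₂, j₁, j₀⟩ := exists_arc_jet hα hε hα0 heven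
  obtain ⟨h1, h2⟩ := curvatureRadius_jet ha hb hab hα hε j₂ j₁ j₀
  rw [← hR] at h1
  have hκ : 0 < κ := by rwa [h1, inv_pos] at hpos
  have h3 := h2 hκ.ne'
  rw [← hS] at h3
  have hκR : R⁻¹ = κ := by rw [h1, inv_inv]
  have hc : (3 * R⁻¹ - S) * R⁻¹ ^ 2 / 6 = c := by
    rw [hκR, h3]
    field_simp
    ring
  rw [hκR] at hc ⊢
  rw [hc]
  exact ⟨hα, heven, j₂, j₁, j₀, hκ⟩

/-- The linear part of a map with a given quartic jet. -/
theorem vanishesToOrder_two_of_quartic_jet {f : ℝ × ℝ → ℝ × ℝ} {p q r : ℝ} {k : Fin 5 → ℝ}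
    (hf : VanishesToOrder 4 (fun z => f z -
      (p * (z.1 + (quarticField k z).1) + q * (z.2 + (quarticField k z).2),
        r * (z.1 + (quarticField k z).1) + p * (z.2 + (quarticField k z).2)))) :
    VanishesToOrder 2 (fun z => f z - (p * z.1 + q * z.2, r * z.1 + p * z.2)) := by
  have hv := vanishesToOrder_quarticField k (E := ℝ × ℝ) .id
  have h1 : VanishesToOrder 3 (fun z => (quarticField k z).1) :=
    (ContinuousLinearMap.fst ℝ ℝ ℝ).vanishesToOrder_comp hv
  have h2 : VanishesToOrder 3 (fun z => (quarticField k z).2) :=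
    (ContinuousLinearMap.snd ℝ ℝ ℝ).vanishesToOrder_comp hv
  refine ((hf.mono (by norm_num)).add ((((h1.const_mul p).add (h2.const_mul q)).prodMk
    ((h1.const_mul r).add (h2.const_mul p))).mono (by norm_num))).congr fun z => ?_
  ext <;> simp <;> ring

end

theorem theorem4p2 (a b L ε : ℝ) (α β : ℝ → ℝ)
    (ha : 0 < a) (hb : 0 ≤ b) (hab : a + b = 1) (hL : 0 < L) (hε : 0 < ε)
    (hα : ContDiffOn ℝ ∞ α (Ioo (-ε) ε)) (hβ : ContDiffOn ℝ ∞ β (Ioo (-ε) ε))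
    (hα0 : α 0 = 0) (hβ0 : β 0 = 0)
    (hαeven : ∀ t ∈ Ioo (-ε) ε, α (-t) = α t) (hβeven : ∀ t ∈ Ioo (-ε) ε, β (-t) = β t)
    (hQ : ∀ t ∈ Ioo (-ε) ε, α t < L - β t)
    (R₀ R₁ S₀ S₁ : ℝ)
    (hR₀ : R₀ = curvatureRadius (arcParam (mixedNorm a b) (leftArc α) ε) 0)
    (hR₁ : R₁ = curvatureRadius (arcParam (mixedNorm a b) (rightArc L β) ε) 0)
    (hS₀ : S₀ = iteratedDeriv 2 (curvatureRadius (arcParam (mixedNorm a b) (leftArc α) ε)) 0)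
    (hS₁ : S₁ = iteratedDeriv 2 (curvatureRadius (arcParam (mixedNorm a b) (rightArc L β) ε)) 0)
    (hR₀pos : 0 < R₀) (hR₁pos : 0 < R₁)
    (hB : (L - a * R₀) * (L - a * R₁) ≠ 0) :
    ∃ f : ℝ × ℝ → ℝ × ℝ,
      -- near the period-2 orbit the two-step billiard relation is the graph of a smooth map `f`
      (∀ᶠ p in 𝓝 (0 : ℝ × ℝ), ∀ q, TwoStep (mixedNorm a b) L ε α β p q ↔ q = f p) ∧
      f 0 = 0 ∧ ContDiffAt ℝ ∞ f 0 ∧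
      (IsEllipticFixedPoint f 0 →
        ((∀ μ ∈ multipliers f 0, μ ^ 4 ≠ 1) →
          IsFirstTwistCoefficient f 0 (twistNumerator a L R₀ R₁ S₀ S₁ /
            (8 * a ^ 2 * R₀ * R₁ * (L - a * R₀) * (L - a * R₁) * (L - a * (R₀ + R₁))))) ∧
        (∀ τ, IsFirstTwistCoefficient f 0 τ →
          τ = twistNumerator a L R₀ R₁ S₀ S₁ /
            (8 * a ^ 2 * R₀ * R₁ * (L - a * R₀) * (L - a * R₁) * (L - a * (R₀ + R₁))))) := by
  have hright : curvatureRadius (arcParam (mixedNorm a b) (rightArc L β) ε) =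
      curvatureRadius (arcParam (mixedNorm a b) (leftArc β) ε) := by
    rw [arcParam_mixedNorm_rightArc, curvatureRadius_const_sub]
  rw [hright] at hR₁ hS₁
  have h : IsTable a b L ε α β R₀⁻¹ ((3 * R₀⁻¹ - S₀) * R₀⁻¹ ^ 2 / 6)
      R₁⁻¹ ((3 * R₁⁻¹ - S₁) * R₁⁻¹ ^ 2 / 6) :=
    ⟨ha, hb, hab, hL, hε, exists_isTableArc ha hb hab hε hα hα0 hαeven hR₀ hS₀ hR₀pos,
      exists_isTableArc ha hb hab hε hβ hβ0 hβeven hR₁ hS₁ hR₁pos, hQ⟩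
  refine ⟨h.twoStepMap, h.eventually_twoStep_iff, h.twoStepMap_zero, h.contDiffAt_twoStepMap,
    fun hell => ?_⟩
  have hX : 1 - L / (a * R₀) = (a / L - R₀⁻¹) / (a / L) := by field_simp
  have hY : 1 - L / (a * R₁) = (a / L - R₁⁻¹) / (a / L) := by field_simp
  have hjet := h.twoStepMap_jet rfl hX hY rfl rfl rfl rfl
  obtain ⟨h₀, h₁⟩ := mul_ne_zero_iff.1 hB
  have hg0 : a / L ≠ 0 := (div_pos ha hL).ne'
  have hXY : (1 - L / (a * R₀)) * (1 - L / (a * R₁)) - 1 =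
      L * (L - a * (R₀ + R₁)) / (a ^ 2 * R₀ * R₁) := by field_simp; ring
  have hτ := twist_chordQuartic (a := a) (b := b) (L := L) (R₀ := R₀) (R₁ := R₁) (S₀ := S₀)
    (S₁ := S₁) ha.ne' hab hL.ne' hR₀pos.ne' hR₁pos.ne' h₀ h₁
  have hX0 : 1 - L / (a * R₀) ≠ 0 := by
    rw [show 1 - L / (a * R₀) = -(L - a * R₀) / (a * R₀) by field_simp; ring]
    exact div_ne_zero (neg_ne_zero.2 h₀) (by positivity)
  have hY0 : 1 - L / (a * R₁) ≠ 0 := by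
    rw [show 1 - L / (a * R₁) = -(L - a * R₁) / (a * R₁) by field_simp; ring]
    exact div_ne_zero (neg_ne_zero.2 h₁) (by positivity)
  replace hτ := fun h₂ => hτ h₂ rfl rfl rfl rfl rfl
  generalize 1 - L / (a * R₀) = X at *
  generalize 1 - L / (a * R₁) = Y at *
  generalize a / L = g at *
  have hdet : (2 * X * Y - 1) ^ 2 - (-2 * Y / g) * (-2 * X * (X * Y - 1) * g) = 1 := by
    field_simp
    ring
  have hjet₁ := vanishesToOrder_two_of_quartic_jet hjet
  have hp := sq_lt_one_of_isEllipticFixedPoint hjet₁ hdet hell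
  -- XY = 1 would mean p = 1, a parabolic map. So ellipticity supplies the last factor L - a(R₀ +
  -- R₁) ≠ 0 of the denominator.
  have hXY0 : X * Y - 1 ≠ 0 := by
    intro h0
    rw [show 2 * X * Y - 1 = 2 * (X * Y - 1) + 1 by ring, h0] at hp
    norm_num at hp
  have h₂ : L - a * (R₀ + R₁) ≠ 0 := by
    intro h0
    rw [h0, mul_zero, zero_div] at hXY
    exact hXY0 hXY
  have htwist := twist_of_quartic_jet hdet hp hjet
  rw [twist_of_generating hg0 hX0 hY0 hXY0 _ rfl rfl rfl rfl, hτ h₂] at htwist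
  exact ⟨fun hμ => htwist.1 (ne_zero_of_multipliers_pow_four_ne_one hjet₁ hdet hμ), htwist.2⟩
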